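/- **Setting.** Let $\Gamma$ be the dual graph of the minimal good resolution of a complex normal surface singularity whose link is a rational homology sphere: a finite tree with vertex set $\mathcal V$, vertices decorated by integers $b_v$, with negative definite intersection matrix $I$ ($I_{vv}=b_v$; for $v\ne w$, $I_{vw}=1$ if $v,w$ are adjacent and $0$ otherwise), and $b_v\le -2$ whenever the valency $\delta_v$ is at most $2$. Let $L=\mathbb Z\langle E_v\rangle_{v\in\mathcal V}$ with pairing $(\cdot,\cdot)$ given by $I$, let $L'=\{x\in L\otimes\mathbb R:(x,E_v)\in\mathbb Z\ \forall v\}$, $H=L'/L$, and let $E_v^*\in L'$ be defined by $(E_v^*,E_w)=-1$ if $v=w$ and $0$ otherwise. Let $\mathcal N$ be the set of nodes ($\delta_v\ge3$) and $\mathcal E$ the set of ends ($\delta_v=1$). For $n\in\mathcal N$ let $\mathcal N_n$ (resp. $\mathcal E_n$) be the set of nodes different from $n$ (resp. of ends) joined to $n$ by a path with no node in its interior; put $\delta_{n,\mathcal N}=|\mathcal N_n|$ and $\widehat{\mathcal N}=\{n\in\mathcal N:\delta_{n,\mathcal N}\ge2\}$. Assume $\mathcal N\neq\emptyset$ and $\delta_{n,\mathcal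 N}\ge1$ for all $n\in\mathcal N$. Fix a partial order on $\mathcal N$ in which $n$ and $n'$ are comparable whenever $n'\in\mathcal N_n$; below, sums and conditions over $n<n'$ or $n'<n$ involve only pairs with $n'\in\mathcal N_n$. For $n'\in\mathcal N_n$ let $n_{n'}$ be the vertex adjacent to $n$ on the path from $n$ to $n'$. For a set $S$ of vertices let $\det_S$ be the determinant of the submatrix of $-I$ with rows and columns in $S$ ($\det_\emptyset=1$). For $u\in\mathcal E_n$ let $\alpha_u=\det_{(n,u]}$, and let $\omega_u$ be the determinant of $(n,u]$ without its vertex adjacent to $n$. For $n'\in\mathcal N_n$ let $\alpha_{n,n'}=\det_{(n,n')}$, and let $\omega_{n,n'}$ be the determinant of $(n,n')$ without its vertex adjacent to $n$, with $\omega_{n,n'}=0$ if $n,n'$ are adjacent. **Poincaré series.** Let $Z_H(\mathbf t)=\sum_{h\in H}Z_h(\mathbf t)\,h$ be the expansion at the origin of $\prod_{v\in\mathcal V}(1-[E_v^*]\mathbf t^{E_v^*})^{\delta_v-2}$, where $\mathbf t^{l}=\prod_v t_v^{l_v}$ for $l=\sum_v l_vE_v$ and $Z_h(\mathbf t)$ has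 integer coefficients; and let $Z_h(\mathbf t_{\mathcal N})$ be obtained from $Z_h(\mathbf t)$ by setting $t_v=1$ for all $v\notin\mathcal N$. **Lifts and modules.** A reduced lift $a$ of $h$ consists of integers $a_n$ $(n\in\mathcal N)$, $a_u$ $(u\in\mathcal E)$, $a_{n_{n'}}$ $(n<n')$ such that the element $\sum_n a_nE_n^*+\sum_u a_uE_u^*+\sum_{n<n'}a_{n_{n'}}E^*_{n_{n'}}$ of $L'$, also denoted $a$, has class $h$. Let $\pi_{\mathcal N}$ be the projection onto the coordinates of the $E_n$, $n\in\mathcal N$, and $\mathbf c_a=\pi_{\mathcal N}(a)$. For $k=(k_n)_{n\in\mathcal N}$ the lift $a-k$ is obtained by replacing $a_n$ by $a_n-k_n$. Put $$\mathbb Z^{\mathcal N}(a)=\{\ell\in\mathbb Z^{\mathcal N}:\ \ell_n+\omega_{n',n}\ell_{n'}\equiv a_{n_{n'}}\ (\mathrm{mod}\ \alpha_{n,n'})\ \ \forall\, n<n'\},$$ $$N_a(\ell,n)=a_n+\sum_{n'>n}\frac{\omega_{n,n'}}{\alpha_{n,n'}}a_{n_{n'}}+\sum_{n'<n}\frac{1}{\alpha_{n,n'}}a_{n'_{n}}-\Big(b_n+\sum_{n'\in\mathcal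 N_n}\frac{\omega_{n,n'}}{\alpha_{n,n'}}\Big)\ell_n-\sum_{n'\in\mathcal N_n}\frac{\ell_{n'}}{\alpha_{n,n'}}+\sum_{u\in\mathcal E_n}\Big\lfloor\frac{a_u-\omega_u\ell_n}{\alpha_u}\Big\rfloor,$$ and $\overline N_a(\ell,n)=N_a(\ell,n)+\sum_{u\in\mathcal E_n}\big\{\frac{a_u-\omega_u\ell_n}{\alpha_u}\big\}$. Let $\mathcal M_a$ (resp. $\overline{\mathcal M}_a$) be the set of $\ell\in\mathbb Z^{\mathcal N}(a)$ with $N_a(\ell,n)\ge0$ (resp. $\overline N_a(\ell,n)\ge0$) for all $n\in\mathcal N$; $\mathcal M_0$ is the one for the zero lift. Let $\mathcal C^{orb}=\pi_{\mathcal N}\{x\in L\otimes\mathbb R:(x,E_v)\le0\ \forall v\}$. For an integer $\kappa\ge0$ call $\{\mathfrak v_n\}_{n\in\mathcal N}\subset\mathcal M_0$ *adapted to $(a,\kappa)$* if $\mathbb R_{\ge0}\langle\mathfrak v_n\rangle_{n\in\mathcal N}=\mathcal C^{orb}$ and, for all $\ell\in\overline{\mathcal M}_a$ and $n\in\mathcal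 N$, $N_a(\ell+\mathfrak v_n,n')=N_a(\ell,n')$ for all $n'\ne n$, and $N_a(\ell+\mathfrak v_n,n)\ge\kappa$. Given such vectors, let $\Box=\sum_n[0,1)\mathfrak v_n$ and, for $\mathcal I\subseteq\mathcal N$, $$\mathcal M^-_{a,\mathcal I}=\{\ell\in(\Box-\mathbf c_a)\cap\mathbb Z^{\mathcal N}(a):\ N_a(\ell,n)<0\ \ \forall n\in\mathcal I\},$$ and, for $\widehat{\mathcal N}\subseteq\mathcal I\subseteq\mathcal N$, $$\mathrm{gr}_k\mathcal M^-_{a,\mathcal I}=\{\ell\in(\Box-\mathbf c_{a-k})\cap\mathbb Z^{\mathcal N}(a):\ N_a(\ell,n)<0\ \ \forall n\in\mathcal I\setminus\widehat{\mathcal N},\ \ N_a(\ell,n)=k_n\ \ \forall n\in\widehat{\mathcal N}\}.$$ For $r\in\{1,2\}$, "$0\le k\le\delta-r$" means that $k$ is an integer vector with $0\le k_n\le\delta_{n,\mathcal N}-r$ for $n\in\widehat{\mathcal N}$ and $k_n=0$ for $n\in\mathcal N\setminus\widehat{\mathcal N}$, and $(-1)^k\binom{\delta-r}{k}=\prod_{n\in\widehat{\mathcal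 N}}(-1)^{k_n}\binom{\delta_{n,\mathcal N}-r}{k_n}$. **Theorem.** The series $Z_H(\mathbf t)$ and $Z_h(\mathbf t_{\mathcal N})$ are well defined: each $1-[E_v^*]\mathbf t^{E_v^*}$ is invertible as a formal series, and each coefficient of $Z_h(\mathbf t_{\mathcal N})$ is a sum with finitely many nonzero terms. Let $h\in H$ and let $a$ be a reduced lift of $h$. (a) If $\{\mathfrak v_n\}_{n\in\mathcal N}$ is adapted to $(a-k,0)$ for every $0\le k\le\delta-1$, then $$Z_h(\mathbf t_{\mathcal N})=\sum_{0\le k\le\delta-1}(-1)^k\binom{\delta-1}{k}\sum_{\emptyset\subseteq\mathcal I\subseteq\mathcal N}(-1)^{|\mathcal I|}\,\frac{\sum_{\ell\in\mathcal M^-_{a-k,\mathcal I}}\mathbf t^{\mathbf c_a+\ell}}{\prod_{n\notin\mathcal I}(1-\mathbf t^{\mathfrak v_n})}.$$ (b) If $\{\mathfrak v_n\}_{n\in\mathcal N}$ is adapted to $(a-k,1)$ for every $0\le k\le\delta-2$, then $$Z_h(\mathbf t_{\mathcal N})=\sum_{0\le k\le\delta-2}(-1)^k\binom{\delta-2}{k}\sum_{\widehat{\mathcal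 N}\subseteq\mathcal I\subseteq\mathcal N}(-1)^{|\mathcal I\setminus\widehat{\mathcal N}|}\,\frac{\sum_{\ell\in\mathrm{gr}_k\mathcal M^-_{a,\mathcal I}}\mathbf t^{\mathbf c_a+\ell}}{\prod_{n\notin\mathcal I}(1-\mathbf t^{\mathfrak v_n})}.$$ Both are identities of formal series in the variables $t_n$, $n\in\mathcal N$, the denominators being invertible. -/

import Mathlib

open scoped Classical

noncomputable section

/-- The intersection matrix of a graph whose vertices `v` are decorated by integers `b v`. -/
def intersectionMatrix {V : Type*} (G : SimpleGraph V) (b : V → ℤ) : Matrix V V ℤ :=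
  Matrix.of fun v w => if v = w then b v else if G.Adj v w then 1 else 0

/-- The dual graph of the minimal good resolution of a normal surface singularity whose link is a
rational homology sphere (all genera vanish): a negative definite plumbing tree such that every
vertex of valency at most two has decoration at most `-2`. -/
structure ResolutionGraph (V : Type*) [Fintype V] where
  graph : SimpleGraph V
  euler : V → ℤ
  isTree : graph.IsTree
  negDef : (-((intersectionMatrix graph euler).map (Int.cast : ℤ → ℝ))).PosDef
  minimal : ∀ v, graph.degree v ≤ 2 → euler v ≤ -2

namespace ResolutionGraph

variable {V : Type*} [Fintype V] (Γ : ResolutionGraph V)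

/-! ### Lattices, the group `H`, dual vectors -/

/-- The intersection form `I`, with real entries. -/
def form : Matrix V V ℝ := (intersectionMatrix Γ.graph Γ.euler).map (Int.cast : ℤ → ℝ)

/-- The intersection pairing on `L ⊗ ℝ`, whose elements are written in the basis `E_v`. -/
def pairing (x y : V → ℝ) : ℝ := x ⬝ᵥ (Γ.form.mulVec y)

/-- The lattice `L`, spanned by the `E_v`. -/
def lattice : AddSubgroup (V → ℝ) where
  carrier := {x | ∀ v, ∃ k : ℤ, x v = k}
  zero_mem' := fun _ => ⟨0, by simp⟩
  add_mem' := by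
    intro x y hx hy v
    obtain ⟨k, hk⟩ := hx v
    obtain ⟨m, hm⟩ := hy v
    exact ⟨k + m, by simp [hk, hm]⟩
  neg_mem' := by
    intro x hx v
    obtain ⟨k, hk⟩ := hx v
    exact ⟨-k, by simp [hk]⟩

/-- The dual lattice `L'`: all `x` with `(x, E_v) ∈ ℤ` for every `v`. -/
def dualLattice : AddSubgroup (V → ℝ) where
  carrier := {x | ∀ v, ∃ k : ℤ, Γ.pairing x (Pi.single v 1) = k}
  zero_mem' := fun _ => ⟨0, by simp [pairing]⟩
  add_mem' := by
    intro x y hx hy v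
    obtain ⟨k, hk⟩ := hx v
    obtain ⟨m, hm⟩ := hy v
    refine ⟨k + m, ?_⟩
    simp only [pairing, add_dotProduct] at hk hm ⊢
    push_cast
    rw [hk, hm]
  neg_mem' := by
    intro x hx v
    obtain ⟨k, hk⟩ := hx v
    refine ⟨-k, ?_⟩
    simp only [pairing, neg_dotProduct] at hk ⊢
    push_cast
    rw [hk]

/-- The finite group `H = L' / L`. -/
abbrev H : Type _ := Γ.dualLattice ⧸ (lattice (V := V)).addSubgroupOf Γ.dualLattice

/-- The (anti)dual vector `E_v^*`, in the basis `E_w`. -/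
def dualVec (v : V) : V → ℝ := fun w => (-Γ.form)⁻¹ v w

theorem pairing_dualVec (v w : V) :
    Γ.pairing (Γ.dualVec v) (Pi.single w 1) = if v = w then -1 else 0 := by
  have hu : IsUnit (-Γ.form).det := Γ.negDef.det_pos.ne'.isUnit
  have h1 : ((-Γ.form)⁻¹ * (-Γ.form)) v w = (1 : Matrix V V ℝ) v w := by
    rw [Matrix.nonsing_inv_mul _ hu]
  have h2 : Γ.pairing (Γ.dualVec v) (Pi.single w 1) = ((-Γ.form)⁻¹ * Γ.form) v w := by
    simp [pairing, dualVec, Matrix.mul_apply, dotProduct]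
  rw [Matrix.mul_neg, Matrix.neg_apply, Matrix.one_apply, neg_eq_iff_eq_neg] at h1
  rw [h2, h1]
  split_ifs <;> simp

/-- `E_v^*` as an element of `L'`. -/
def dualGen (v : V) : Γ.dualLattice :=
  ⟨Γ.dualVec v, fun w => by
    rw [Γ.pairing_dualVec v w]
    split_ifs
    · exact ⟨-1, by simp⟩
    · exact ⟨0, by simp⟩⟩

/-- The class `[l'] ∈ H` of `l' ∈ L'`. -/
def cls (x : Γ.dualLattice) : Γ.H := QuotientAddGroup.mk x

/-! ### Nodes, ends, chains -/

/-- The nodes: vertices of valency at least three. -/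
abbrev Node : Type _ := {v : V // 3 ≤ Γ.graph.degree v}

/-- The ends: vertices of valency one. -/
abbrev EndVertex : Type _ := {v : V // Γ.graph.degree v = 1}

/-- The unique path between two vertices of the tree. -/
def pathWalk (v w : V) : Γ.graph.Walk v w := (Γ.isTree.existsUnique_path v w).choose

/-- The vertices of `[v, w]`. -/
def path (v w : V) : Finset V := (Γ.pathWalk v w).support.toFinset

/-- The vertex next to `v` on `[v, w]`. -/
def firstVertex (v w : V) : V := (Γ.pathWalk v w).snd

/-- The set `𝒩_n` of nodes connected to `n` by a (possibly empty) chain. -/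
def nodesAt (n : Γ.Node) : Finset Γ.Node :=
  Finset.univ.filter fun n' =>
    n' ≠ n ∧ ∀ x ∈ Γ.path n n', x ≠ n → x ≠ n' → ¬ 3 ≤ Γ.graph.degree x

/-- The set `ℰ_n` of ends connected to `n` by their legs. -/
def endsAt (n : Γ.Node) : Finset Γ.EndVertex :=
  Finset.univ.filter fun u =>
    ∀ x ∈ Γ.path n u, x ≠ n → ¬ 3 ≤ Γ.graph.degree x

/-- `δ_{n,𝒩}`. -/
def deltaN (n : Γ.Node) : ℕ := (Γ.nodesAt n).card

/-- The nodes `n` with `δ_{n,𝒩} ≥ 2`. -/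
def hatN : Finset Γ.Node := Finset.univ.filter fun n => 2 ≤ Γ.deltaN n

/-! ### Generalized Seifert invariants -/

/-- The determinant of the negative of the intersection matrix of the full subgraph on `S`. -/
def subDet (S : Finset V) : ℤ :=
  ((-intersectionMatrix Γ.graph Γ.euler).submatrix
    (Subtype.val : {x // x ∈ S} → V) (Subtype.val : {x // x ∈ S} → V)).det

/-- `α_u` for the leg `(n, u]`. -/
def alphaEnd (n : Γ.Node) (u : Γ.EndVertex) : ℤ := Γ.subDet (Γ.path n u \ {n.1})

/-- `ω_u` for the leg `(n, u]`: the determinant of the leg without its vertex next to `n`. -/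
def omegaEnd (n : Γ.Node) (u : Γ.EndVertex) : ℤ :=
  Γ.subDet (Γ.path n u \ {n.1, Γ.firstVertex n u})

/-- `α_{n,n'}` for the chain `(n, n')`; equal to `1` if the chain is empty. -/
def alphaChain (n n' : Γ.Node) : ℤ := Γ.subDet (Γ.path n n' \ {n.1, n'.1})

/-- `ω_{n,n'}` for the chain `(n, n')`, regarded as a leg starting at `n`: the determinant of the
chain without its vertex next to `n`. An empty chain has `(α, ω) = (1, 0)`. -/
def omegaChain (n n' : Γ.Node) : ℤ :=
  if Γ.graph.Adj n n' then 0 else Γ.subDet (Γ.path n n' \ {n.1, Γ.firstVertex n n', n'.1})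

/-! ### The topological Poincaré series -/

/-- The factor `1 - g_v t^{E_v^*}`, in a ring of formal series in `t` with coefficients in the
group ring `ℤ[H]`; here `g_v = [E_v^*]`. -/
def zetaFactor (v : V) : HahnSeries (V → ℝ) (AddMonoidAlgebra ℤ Γ.H) :=
  1 - HahnSeries.single (Γ.dualVec v) (AddMonoidAlgebra.single (Γ.cls (Γ.dualGen v)) 1)

/-- `Z_H(t)`, the expansion at the origin of `∏_v (1 - g_v t^{E_v^*})^{δ_v - 2}`. -/
def poincareH : HahnSeries (V → ℝ) (AddMonoidAlgebra ℤ Γ.H) :=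
  ∏ v, if 2 ≤ Γ.graph.degree v then Γ.zetaFactor v ^ (Γ.graph.degree v - 2)
    else Ring.inverse (Γ.zetaFactor v) ^ (2 - Γ.graph.degree v)

/-- The coefficient of `t^l` in the `h`-equivariant part `Z_h(t)`, where
`Z_H(t) = ∑_h Z_h(t) h`. -/
def poincareCoeff (h : Γ.H) (l : V → ℝ) : ℤ := (Γ.poincareH.coeff l).coeff h

/-- The projection `π_𝒩` that keeps the coordinates at the nodes. -/
def proj (x : V → ℝ) : Γ.Node → ℝ := fun n => x n

/-- The coefficient of `t_𝒩^x` in the reduced series `Z_h(t_𝒩)`, that is `Z_h(t)` with `t_v = 1`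
for all `v` that are not nodes. -/
def reducedCoeff (h : Γ.H) (x : Γ.Node → ℝ) : ℤ :=
  ∑ᶠ l ∈ {l : V → ℝ | Γ.proj l = x}, Γ.poincareCoeff h l

/-! ### Reduced lifts -/

/-- Integer coefficients `a_n` (nodes), `a_u` (ends) and `a_{n_{n'}}` (pairs of nodes `n < n'`
joined by a chain; other values of `chain` are never used). -/
structure LiftCoeffs where
  node : Γ.Node → ℤ
  leaf : Γ.EndVertex → ℤ
  chain : Γ.Node → Γ.Node → ℤ

variable {Γ}

/-- The zero lift. -/
def zeroLift : Γ.LiftCoeffs := ⟨0, 0, 0⟩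

/-- The lift `a - k`, where `k = ∑ k_n E_n^*`. -/
def LiftCoeffs.shift (a : Γ.LiftCoeffs) (k : Γ.Node → ℕ) : Γ.LiftCoeffs :=
  { a with node := fun n => a.node n - k n }

/-- The real cone generated by the vectors `v n`. -/
def realCone (v : Γ.Node → Γ.Node → ℤ) : Set (Γ.Node → ℝ) :=
  {x | ∃ s : Γ.Node → ℝ, (∀ n, 0 ≤ s n) ∧ ∀ i, x i = ∑ n, s n * (v n i : ℝ)}

variable (Γ) in
/-- The cone `𝒞^orb = π_𝒩(𝒮'_ℝ)`, the projection of the real Lipman cone. -/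
def orbCone : Set (Γ.Node → ℝ) :=
  Γ.proj '' {x : V → ℝ | ∀ v, Γ.pairing x (Pi.single v 1) ≤ 0}

variable [PartialOrder Γ.Node]

/-- The element
`a = ∑_n a_n E_n^* + ∑_u a_u E_u^* + ∑_{n<n'} a_{n_{n'}} E_{n_{n'}}^*` of `L'`, where `n_{n'}` is
the vertex next to `n` on the way to `n'`. -/
def LiftCoeffs.toDual (a : Γ.LiftCoeffs) : Γ.dualLattice :=
  ∑ n, a.node n • Γ.dualGen n + ∑ u, a.leaf u • Γ.dualGen u +
    ∑ n, ∑ n' ∈ (Γ.nodesAt n).filter (fun n' => n < n'),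
      a.chain n n' • Γ.dualGen (Γ.firstVertex n n')

/-- `a` is a reduced lift of `h`. -/
def LiftCoeffs.IsLiftOf (a : Γ.LiftCoeffs) (h : Γ.H) : Prop := Γ.cls a.toDual = h

/-- `𝐜_a = π_𝒩(a)`. -/
def LiftCoeffs.center (a : Γ.LiftCoeffs) : Γ.Node → ℝ := Γ.proj a.toDual

/-! ### The modules and their holes -/

/-- The affine lattice `ℤ^𝒩(a)`. -/
def affineLattice (a : Γ.LiftCoeffs) : Set (Γ.Node → ℤ) :=
  {l | ∀ n, ∀ n' ∈ Γ.nodesAt n, n < n' →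
    l n + Γ.omegaChain n' n * l n' ≡ a.chain n n' [ZMOD Γ.alphaChain n n']}

/-- The quasilinear function `N_a(ℓ, n)`. -/
def quasi (a : Γ.LiftCoeffs) (l : Γ.Node → ℤ) (n : Γ.Node) : ℝ :=
  (a.node n : ℝ)
    + ∑ n' ∈ (Γ.nodesAt n).filter (fun n' => n < n'),
        (Γ.omegaChain n n' : ℝ) / Γ.alphaChain n n' * a.chain n n'
    + ∑ n' ∈ (Γ.nodesAt n).filter (fun n' => n' < n),
        1 / (Γ.alphaChain n n' : ℝ) * a.chain n' n
    - ((Γ.euler n : ℝ) + ∑ n' ∈ Γ.nodesAt n, (Γ.omegaChain n n' : ℝ) / Γ.alphaChain n n') * l n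
    - ∑ n' ∈ Γ.nodesAt n, 1 / (Γ.alphaChain n n' : ℝ) * l n'
    + ∑ u ∈ Γ.endsAt n,
        (⌊((a.leaf u : ℝ) - Γ.omegaEnd n u * l n) / Γ.alphaEnd n u⌋ : ℝ)

/-- The linear function `N̄_a(ℓ, n)`. -/
def quasiBar (a : Γ.LiftCoeffs) (l : Γ.Node → ℤ) (n : Γ.Node) : ℝ :=
  quasi a l n + ∑ u ∈ Γ.endsAt n,
    Int.fract (((a.leaf u : ℝ) - Γ.omegaEnd n u * l n) / Γ.alphaEnd n u)

/-- `ℳ_a`. -/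
def modSet (a : Γ.LiftCoeffs) : Set (Γ.Node → ℤ) :=
  {l | l ∈ affineLattice a ∧ ∀ n, 0 ≤ quasi a l n}

/-- The normalization of `ℳ_a`. -/
def modSetBar (a : Γ.LiftCoeffs) : Set (Γ.Node → ℤ) :=
  {l | l ∈ affineLattice a ∧ ∀ n, 0 ≤ quasiBar a l n}

/-- The vectors `𝔳_n` in `ℳ_0` generate the cone `𝒞^orb` and, on the normalization of `ℳ_a`,
translation by `𝔳_n` leaves `N_a(·, n')` unchanged for `n' ≠ n` and makes `N_a(·, n)` at least
`κ`. -/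
structure IsAdapted (a : Γ.LiftCoeffs) (κ : ℕ) (v : Γ.Node → Γ.Node → ℤ) : Prop where
  mem : ∀ n, v n ∈ modSet (zeroLift : Γ.LiftCoeffs)
  cone : realCone v = Γ.orbCone
  unchanged : ∀ l ∈ modSetBar a, ∀ n n', n' ≠ n → quasi a (l + v n) n' = quasi a l n'
  bound : ∀ l ∈ modSetBar a, ∀ n, (κ : ℝ) ≤ quasi a (l + v n) n

/-- The integral vectors of `□ - 𝐜_a`, where `□ = ∑_n [0,1) 𝔳_n`. -/
def box (a : Γ.LiftCoeffs) (v : Γ.Node → Γ.Node → ℤ) : Set (Γ.Node → ℤ) :=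
  {l | ∃ s : Γ.Node → ℝ, (∀ n, 0 ≤ s n ∧ s n < 1) ∧
    ∀ i, (l i : ℝ) + a.center i = ∑ n, s n * (v n i : ℝ)}

/-- `ℳ^-_{a,ℐ}`. -/
def holes (a : Γ.LiftCoeffs) (v : Γ.Node → Γ.Node → ℤ) (S : Finset Γ.Node) :
    Set (Γ.Node → ℤ) :=
  {l | l ∈ box a v ∧ l ∈ affineLattice a ∧ ∀ n ∈ S, quasi a l n < 0}

/-- `gr_k ℳ^-_{a,ℐ}`, for the filtration associated with the nodes `n` with `δ_{n,𝒩} ≥ 2`. -/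
def gradedHoles (a : Γ.LiftCoeffs) (k : Γ.Node → ℕ) (v : Γ.Node → Γ.Node → ℤ)
    (S : Finset Γ.Node) : Set (Γ.Node → ℤ) :=
  {l | l ∈ box (a.shift k) v ∧ l ∈ affineLattice a ∧
    (∀ n ∈ S \ Γ.hatN, quasi a l n < 0) ∧ ∀ n ∈ Γ.hatN, quasi a l n = k n}

/-- The box holds finitely many integral vectors, so the sums over holes are finite. -/
theorem box_finite (a : Γ.LiftCoeffs) (v : Γ.Node → Γ.Node → ℤ) : (box a v).Finite := by
  refine (Set.finite_Icc (fun i => ⌊-(∑ n, |(v n i : ℝ)|) - a.center i⌋)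
    (fun i => ⌈(∑ n, |(v n i : ℝ)|) - a.center i⌉)).subset ?_
  rintro l ⟨s, hs, hl⟩
  have key : ∀ i, |(l i : ℝ) + a.center i| ≤ ∑ n, |(v n i : ℝ)| := by
    intro i
    rw [hl i]
    refine (Finset.abs_sum_le_sum_abs _ _).trans (Finset.sum_le_sum fun n _ => ?_)
    rw [abs_mul, abs_of_nonneg (hs n).1]
    exact mul_le_of_le_one_left (abs_nonneg _) (hs n).2.le
  constructor <;> intro i
  · have h1 := (abs_le.mp (key i)).1
    have h2 := Int.floor_le (-(∑ n, |(v n i : ℝ)|) - a.center i)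
    have h3 : ((⌊-(∑ n, |(v n i : ℝ)|) - a.center i⌋ : ℤ) : ℝ) ≤ l i := by linarith
    exact_mod_cast h3
  · have h1 := (abs_le.mp (key i)).2
    have h2 := Int.le_ceil ((∑ n, |(v n i : ℝ)|) - a.center i)
    have h3 : (l i : ℝ) ≤ (⌈(∑ n, |(v n i : ℝ)|) - a.center i⌉ : ℤ) := by linarith
    exact_mod_cast h3

/-! ### Series in the node variables -/

variable (Γ) in
/-- The monomial `t^x` in the node variables. -/
def mono (x : Γ.Node → ℝ) : HahnSeries (Γ.Node → ℝ) ℤ := HahnSeries.single x 1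

/-- The finite sum `∑_{ℓ ∈ D} t^{𝐜_a + ℓ}`. -/
def numerator (a : Γ.LiftCoeffs) (D : Set (Γ.Node → ℤ)) : HahnSeries (Γ.Node → ℝ) ℤ :=
  ∑ᶠ l ∈ D, Γ.mono (fun i => a.center i + (l i : ℝ))

variable (Γ) in
/-- The polynomial `∏_{n ∉ ℐ} (1 - t^{𝔳_n})`. -/
def denominator (v : Γ.Node → Γ.Node → ℤ) (S : Finset Γ.Node) : HahnSeries (Γ.Node → ℝ) ℤ :=
  ∏ n ∈ Sᶜ, (1 - Γ.mono (fun i => (v n i : ℝ)))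

variable (Γ) in
/-- The indices `0 ≤ k ≤ δ - r`: `0 ≤ k_n ≤ δ_{n,𝒩} - r` if `δ_{n,𝒩} ≥ 2`, and `k_n = 0` for the
other nodes. It is used for `r = 1` and `r = 2`. -/
def levels (r : ℕ) : Finset (Γ.Node → ℕ) :=
  Fintype.piFinset fun n => if n ∈ Γ.hatN then Finset.Icc 0 (Γ.deltaN n - r) else {0}

variable (Γ) in
/-- The signed binomial coefficient `(-1)^k binom(δ - r, k)`. -/
def signedBinom (r : ℕ) (k : Γ.Node → ℕ) : ℤ :=
  ∏ n ∈ Γ.hatN, (-1) ^ k n * ((Γ.deltaN n - r).choose (k n) : ℤ)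

end ResolutionGraph

end

/-! ### Tridiagonal determinants and continuants -/

noncomputable section

/-! In `Z_H` the vertices of valency two contribute nothing, the nodes contribute polynomial
factors, and the ends contribute geometric series. The coefficient of `t_𝒩^x` in the `h`-part of the
end series is the number of tuples `m_u ≥ 0` such that `∑ m_u E_u^*` projects to `x` and differs
from the lift `a` by an element of `L`.

Both conditions are translated to the nodes by eliminating the interior vertices of chains and legs
(`chain_relation`, `leg_relation`). The coefficients of these relations are the continuants `α` and
`ω`. Summing the relations around a node gives linear forms `Λ_n` on the node coordinates
(`orbForm`) which are bijective, satisfy `Λ_n(𝐜_a + ℓ) = N̄_a(ℓ, n)` and cut out `𝒞^orb`.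
Integrality along a chain or leg reduces to one congruence modulo `α` (`integral_iff`). The tuples
counted at `𝐜_a + ℓ`, for `ℓ ∈ ℤ^𝒩(a)`, are therefore those with `m_u ≡ a_u - ω_u ℓ_n` modulo `α_u`
and `∑_u m_u / α_u = N̄_a(ℓ, n)`. With `m_u = r_u + α_u j_u`, `r_u` the remainder, the second
condition becomes `∑_u j_u = N_a(ℓ, n)`, so the count is the product over `n` of the coefficients of
`X^{N_a(ℓ, n)}` in `(1 - X)^(-|ℰ_n|)` (`hasReduction_endSeries`).

Multiplying by the factor at a node `n` replaces `a` by `a - E_n^*`, which lowers `N_a(·, n)` by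
one; on the power series side this is multiplication by `1 - X` (`HasReduction.zetaFactor_mul`).
Hence the coefficient of `Z_h(t_𝒩)` at `𝐜_a + ℓ` is the product of the coefficients of `X^{N_a(ℓ,
n)}` in `(1 - X)^(δ_{n,𝒩} - 2)`. When `δ_{n,𝒩} = 1` this tests `N_a(ℓ, n) ≥ 0`. When `δ_{n,𝒩} ≥ 2`,
writing the series as `(1 - X)^(δ_{n,𝒩} - 1) / (1 - X)` gives a signed sum of tests `N_a(ℓ, n) ≥
k_n`, and expanding the polynomial itself gives tests `N_a(ℓ, n) = k_n`. These lead to (a) and (b).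

It remains to find the generating series of the sets cut out by the tests. The `𝔳_n` form a basis,
so a point of the normalization is uniquely a box element `ℓ₀` plus `∑ m_n 𝔳_n`. By adaptedness
`N(·, n)` has its value at `ℓ₀` if `m_n = 0` and is at least `κ` otherwise. Thus the inequality at
`n` fails only if `m_n = 0` and `N(ℓ₀, n) < 0`, and inclusion-exclusion over the failing nodes gives
the alternating sum over `ℐ` (`IsAdapted.coeff_sum_holes`). In (b), `κ = 1` makes `N_a(ℓ, n) = k_n`
possible only when `m_n = 0` (`IsAdapted.coeff_sum_gradedHoles`). -/

theorem det_eq_of_first_row_col_tridiagonal {R : Type*} [CommRing R] {k : ℕ}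
    (A : Matrix (Fin (k + 2)) (Fin (k + 2)) R) (hrow : ∀ j : Fin k, A 0 j.succ.succ = 0)
    (hcol : ∀ i : Fin k, A i.succ.succ 0 = 0) :
    A.det = A 0 0 * (A.submatrix Fin.succ Fin.succ).det -
      A 0 1 * A 1 0 *
        (A.submatrix (fun i : Fin k => i.succ.succ) (fun i : Fin k => i.succ.succ)).det := by
  rw [Matrix.det_succ_row_zero, Fin.sum_univ_succ, Fin.sum_univ_succ]
  rw [Finset.sum_eq_zero (s := Finset.univ) (f := fun i : Fin k => _)]
  swap
  · intro j _
    simp [hrow]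
  -- In the minor of the entry `(0, 1)` the only entry of the first column that survives is `A 1 0`.
  rw [Matrix.det_succ_column_zero (A.submatrix Fin.succ (Fin.succAbove (Fin.succ 0))),
    Fin.sum_univ_succ]
  rw [Finset.sum_eq_zero (s := Finset.univ) (f := fun i : Fin k => _)]
  swap
  · intro j _
    have h0 : (Fin.succAbove (Fin.succ (0 : Fin (k + 1))) (0 : Fin (k + 1))) = 0 := rfl
    simp only [Matrix.submatrix_apply, h0, hcol]
    simp
  have e : ((A.submatrix Fin.succ (Fin.succAbove (Fin.succ 0))).submatrix
      (Fin.succAbove 0) Fin.succ) =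
      A.submatrix (fun i : Fin k => i.succ.succ) (fun i : Fin k => i.succ.succ) := by
    ext i j
    simp only [Matrix.submatrix_apply]
    congr 1
  rw [e]
  have h0 : (Fin.succAbove (Fin.succ (0 : Fin (k + 1))) (0 : Fin (k + 1))) = 0 := rfl
  have h1 : (Fin.succ 0 : Fin (k + 2)) = 1 := rfl
  simp only [Matrix.submatrix_apply, h0]
  simp [h1]
  ring

/-- The linear relation along a chain with continuants `D`. -/
theorem continuant_relation (D x y β : ℕ → ℝ) (s : ℕ) (h1 : D s = 1) (h0 : D (s + 1) = 0)
    (hD : ∀ i < s, D i = β (i + 1) * D (i + 1) - D (i + 2))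
    (hy : ∀ i, 1 ≤ i → i ≤ s → y i = β i * x i - x (i - 1) - x (i + 1)) :
    D 0 * x 1 = D 1 * x 0 + x (s + 1) + ∑ j ∈ Finset.Ioc 0 s, D j * y j := by
  -- Induction from the far end of the chain: for `m = 0` the boundary values of `D` make the
  -- relation trivial, and each further step eliminates one more coordinate by the two recursions at
  -- the same index.
  have key : ∀ m ≤ s, D (s - m) * x (s - m + 1) = D (s - m + 1) * x (s - m) + x (s + 1) +
      ∑ j ∈ Finset.Ioc (s - m) s, D j * y j := by
    intro m
    induction m with
    | zero => intro _; simp [h1, h0]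
    | succ m ih =>
      intro hm
      have ih := ih (by omega)
      obtain ⟨i, hi⟩ : ∃ i, s - (m + 1) = i := ⟨_, rfl⟩
      have e : s - m = i + 1 := by omega
      rw [e] at ih
      rw [hi]
      have hI : Finset.Ioc i s = insert (i + 1) (Finset.Ioc (i + 1) s) := by
        ext j; simp only [Finset.mem_Ioc, Finset.mem_insert]; omega
      rw [hI, Finset.sum_insert (by simp)]
      have e1 := hD i (by omega)
      have e2 := hy (i + 1) (by omega) (by omega)
      simp only [Nat.add_sub_cancel] at e2
      rw [e1, e2]
      linear_combination ih
  simpa using key s le_rfl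

namespace ResolutionGraph

variable {V : Type*} [Fintype V] (Γ : ResolutionGraph V)

/-! ### The intersection form -/

/-- The vector of the numbers `-(d, E_v)`, which are the coordinates of `d` in the basis of the
`E_v^*`. -/
def coef : (V → ℝ) →ₗ[ℝ] (V → ℝ) := (-Γ.form).mulVecLin

theorem form_apply (v w : V) : Γ.form v w =
    if v = w then (Γ.euler v : ℝ) else if Γ.graph.Adj v w then 1 else 0 := by
  simp only [form, intersectionMatrix, Matrix.map_apply, Matrix.of_apply]
  split_ifs <;> simp

theorem form_comm (v w : V) : Γ.form v w = Γ.form w v := by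
  rw [form_apply, form_apply]
  by_cases h : v = w
  · simp [h]
  · simp [h, Ne.symm h, Γ.graph.adj_comm]

theorem coef_apply (d : V → ℝ) (v : V) :
    Γ.coef d v = -(Γ.euler v : ℝ) * d v - ∑ w ∈ Γ.graph.neighborFinset v, d w := by
  have h : ∀ w, (-Γ.form) v w * d w = (if w = v then -(Γ.euler v : ℝ) * d v else 0) -
      (if Γ.graph.Adj v w then d w else 0) := by
    intro w
    rw [Matrix.neg_apply, form_apply]
    by_cases h : v = w
    · subst h; simp
    · by_cases h' : Γ.graph.Adj v w <;> simp [h, h', Ne.symm h]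
  simp only [coef, Matrix.mulVecLin_apply, Matrix.mulVec, dotProduct, h]
  rw [Finset.sum_sub_distrib, Finset.sum_ite_eq', if_pos (Finset.mem_univ _),
    ← Finset.sum_filter]
  congr 1
  apply Finset.sum_congr _ (fun _ _ => rfl)
  ext w; simp

theorem pairing_single (d : V → ℝ) (v : V) : Γ.pairing d (Pi.single v 1) = -Γ.coef d v := by
  simp only [pairing, coef, Matrix.mulVecLin_apply, Matrix.neg_mulVec, Pi.neg_apply, neg_neg]
  simp only [dotProduct, Matrix.mulVec, Pi.single_apply, mul_ite, mul_one, mul_zero,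
    Finset.sum_ite_eq', Finset.mem_univ, if_true]
  exact Finset.sum_congr rfl fun w _ => by rw [mul_comm, form_comm]

theorem coef_dualVec (v w : V) : Γ.coef (Γ.dualVec v) w = if v = w then 1 else 0 := by
  have h := Γ.pairing_dualVec v w
  rw [pairing_single] at h
  split_ifs at h ⊢ <;> linarith

/-- Let `m` be the negative part of `d`. If `m ≠ 0`, then `m · (-I)m > 0` and `m · (-I)d ≥ 0`. Their
sum is the pairing of `m` with the positive part of `d`, which is nonpositive: the supports are
disjoint and the off-diagonal entries of `-I` are nonpositive. -/
theorem nonneg_of_coef_nonneg {d : V → ℝ} (h : ∀ v, 0 ≤ Γ.coef d v) (v : V) : 0 ≤ d v := by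
  by_contra hv
  set m : V → ℝ := fun v => max (-d v) 0
  have hm : m ≠ 0 := by
    intro h0
    have := congrFun h0 v
    simp only [m, Pi.zero_apply] at this
    have := le_max_left (-d v) 0
    linarith
  have h1 := Γ.negDef.dotProduct_mulVec_pos hm
  have h2 : 0 ≤ ∑ v, m v * Γ.coef d v :=
    Finset.sum_nonneg fun v _ => mul_nonneg (le_max_right _ _) (h v)
  have h3 : m ⬝ᵥ (-Γ.form).mulVec m + ∑ v, m v * Γ.coef d v ≤ 0 := by
    simp only [coef, Matrix.mulVecLin_apply, Matrix.mulVec, dotProduct, ← Finset.sum_add_distrib,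
      ← mul_add]
    refine Finset.sum_nonpos fun v _ => ?_
    rw [Finset.mul_sum]
    refine Finset.sum_nonpos fun w _ => ?_
    rw [Matrix.neg_apply, form_apply]
    have e : m w + d w = max (d w) 0 := by
      simp only [m]
      rcases le_total (d w) 0 with h | h
      · rw [max_eq_left (by linarith), max_eq_right h]; ring
      · rw [max_eq_right (by linarith), max_eq_left h]; ring
    rw [e]
    by_cases hvw : v = w
    · subst hvw
      have : m v * max (d v) 0 = 0 := by
        simp only [m]
        rcases le_total (d v) 0 with h | h
        · rw [max_eq_right h, mul_zero]
        · rw [max_eq_right (by linarith), zero_mul]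
      simp only [if_true]
      apply le_of_eq
      linear_combination -(Γ.euler v : ℝ) * this
    · have : 0 ≤ m v * max (d w) 0 := mul_nonneg (le_max_right _ _) (le_max_right _ _)
      rw [if_neg hvw]
      split_ifs
      · linarith
      · simp
  have h4 : 0 < m ⬝ᵥ (-Γ.form).mulVec m := by rw [star_trivial] at h1; exact h1
  linarith

theorem dualVec_nonneg (v w : V) : 0 ≤ Γ.dualVec v w :=
  Γ.nonneg_of_coef_nonneg (fun u => by rw [coef_dualVec]; split_ifs <;> simp) w

/-- At a vertex where the nonnegative vector `E_v^*` vanishes, nonnegativity of its coefficient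
forces it to vanish at all neighbours. By connectedness it would vanish everywhere, against its
coefficient 1 at `v`. -/
theorem dualVec_pos (v w : V) : 0 < Γ.dualVec v w := by
  have step : ∀ a b, Γ.graph.Adj a b → Γ.dualVec v a = 0 → Γ.dualVec v b = 0 := by
    intro a b hab ha
    have h := Γ.coef_apply (Γ.dualVec v) a
    rw [coef_dualVec, ha, mul_zero, zero_sub] at h
    have h1 : 0 ≤ ∑ w ∈ Γ.graph.neighborFinset a, Γ.dualVec v w :=
      Finset.sum_nonneg fun w _ => Γ.dualVec_nonneg v w
    have h2 : ∑ w ∈ Γ.graph.neighborFinset a, Γ.dualVec v w = 0 := by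
      split_ifs at h <;> linarith
    exact (Finset.sum_eq_zero_iff_of_nonneg fun w _ => Γ.dualVec_nonneg v w).1 h2 b (by simpa)
  have all : ∀ a b, Γ.dualVec v a = 0 → Γ.dualVec v b = 0 := by
    intro a b ha
    obtain ⟨p⟩ := Γ.isTree.connected a b
    induction p with
    | nil => exact ha
    | cons hab _ ih => exact ih (step _ _ hab ha)
  refine lt_of_le_of_ne (Γ.dualVec_nonneg v w) fun h => ?_
  have h0 : Γ.dualVec v = 0 := funext fun b => all w b h.symm
  have := Γ.coef_dualVec v v
  simp [h0] at this

/-! ### Principal minors -/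

theorem subDet_eq_det_submatrix {k : ℕ} (f : Fin k → V) (hf : Function.Injective f)
    (S : Finset V) (hS : ∀ v, v ∈ S ↔ ∃ i, f i = v) :
    Γ.subDet S = ((-intersectionMatrix Γ.graph Γ.euler).submatrix f f).det := by
  let g : Fin k → {x // x ∈ S} := fun i => ⟨f i, (hS _).2 ⟨i, rfl⟩⟩
  have hg : Function.Bijective g := by
    constructor
    · intro i j h; exact hf (congrArg Subtype.val h)
    · rintro ⟨v, hv⟩
      obtain ⟨i, hi⟩ := (hS v).1 hv
      exact ⟨i, Subtype.ext hi⟩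
  rw [subDet, ← Matrix.det_submatrix_equiv_self (Equiv.ofBijective g hg)]
  rfl

theorem subDet_pos (S : Finset V) : 0 < Γ.subDet S := by
  have h := (Γ.negDef.submatrix (Subtype.val_injective (p := fun x => x ∈ S))).det_pos
  have e : (((-intersectionMatrix Γ.graph Γ.euler).submatrix
      (Subtype.val : {x // x ∈ S} → V) (Subtype.val : {x // x ∈ S} → V)).det : ℝ) =
      ((-(intersectionMatrix Γ.graph Γ.euler).map (Int.cast : ℤ → ℝ)).submatrix
      (Subtype.val : {x // x ∈ S} → V) (Subtype.val : {x // x ∈ S} → V)).det := by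
    rw [Int.cast_det]
    congr 1
    ext i j
    simp
  rw [← e] at h
  exact_mod_cast h

theorem subDet_empty : Γ.subDet ∅ = 1 := by
  simp [subDet]

/-- The expansion of a principal minor along a string of vertices. -/
theorem subDet_image_succ (w : ℕ → V) (i t : ℕ) (hit : i + 2 < t)
    (hinj : Set.InjOn w (Set.Ioo i t))
    (hadj : Γ.graph.Adj (w (i + 1)) (w (i + 2)))
    (hnot : ∀ j, i + 2 < j → j < t → ¬ Γ.graph.Adj (w (i + 1)) (w j)) :
    Γ.subDet ((Finset.Ioo i t).image w) =
      -Γ.euler (w (i + 1)) * Γ.subDet ((Finset.Ioo (i + 1) t).image w) -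
        Γ.subDet ((Finset.Ioo (i + 2) t).image w) := by
  obtain ⟨k, rfl⟩ : ∃ k, t = i + 3 + k := ⟨t - (i + 3), by omega⟩
  -- All three minors are put into the same enumeration `w (c + 1), w (c + 2), …`, so that deleting
  -- leading rows and columns becomes a shift of `c`.
  have gen : ∀ (c m : ℕ), i ≤ c → c + 1 + m = i + 3 + k →
      Γ.subDet ((Finset.Ioo c (i + 3 + k)).image w) =
      ((-intersectionMatrix Γ.graph Γ.euler).submatrix (fun j : Fin m => w (c + 1 + j))
        (fun j : Fin m => w (c + 1 + j))).det := by
    intro c m hc hm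
    apply subDet_eq_det_submatrix
    · intro a b hab
      have := hinj ⟨by omega, by omega⟩ ⟨by omega, by omega⟩ hab
      exact Fin.ext (by omega)
    · intro v
      simp only [Finset.mem_image, Finset.mem_Ioo]
      constructor
      · rintro ⟨j, ⟨h1, h2⟩, rfl⟩
        exact ⟨⟨j - (c + 1), by omega⟩, by congr 1; simp; omega⟩
      · rintro ⟨j, rfl⟩
        exact ⟨_, ⟨by omega, by omega⟩, rfl⟩
  rw [gen i (k + 2) le_rfl (by omega), gen (i + 1) (k + 1) (by omega) (by omega),
    gen (i + 2) k (by omega) (by omega), det_eq_of_first_row_col_tridiagonal]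
  · have hne : w (i + 1) ≠ w (i + 2) := hadj.ne
    have e1 : ((-intersectionMatrix Γ.graph Γ.euler).submatrix
        (fun j : Fin (k + 2) => w (i + 1 + j)) (fun j : Fin (k + 2) => w (i + 1 + j))).submatrix
        Fin.succ Fin.succ = (-intersectionMatrix Γ.graph Γ.euler).submatrix
        (fun j : Fin (k + 1) => w (i + 1 + 1 + j)) (fun j : Fin (k + 1) => w (i + 1 + 1 + j)) := by
      ext a b
      simp only [Matrix.submatrix_apply, Fin.val_succ]
      rw [show i + 1 + (a + 1 : ℕ) = i + 1 + 1 + a by omega,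
        show i + 1 + (b + 1 : ℕ) = i + 1 + 1 + b by omega]
    have e2 : ((-intersectionMatrix Γ.graph Γ.euler).submatrix
        (fun j : Fin (k + 2) => w (i + 1 + j)) (fun j : Fin (k + 2) => w (i + 1 + j))).submatrix
        (fun j : Fin k => j.succ.succ) (fun j : Fin k => j.succ.succ) =
        (-intersectionMatrix Γ.graph Γ.euler).submatrix
        (fun j : Fin k => w (i + 2 + 1 + j)) (fun j : Fin k => w (i + 2 + 1 + j)) := by
      ext a b
      simp only [Matrix.submatrix_apply, Fin.val_succ]
      rw [show i + 1 + (a + 1 + 1 : ℕ) = i + 2 + 1 + a by omega,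
        show i + 1 + (b + 1 + 1 : ℕ) = i + 2 + 1 + b by omega]
    rw [e1, e2]
    simp [intersectionMatrix, hadj, hadj.symm, hne, hne.symm, add_assoc]
  · intro j
    have hn := hnot (i + 3 + j) (by omega) (by omega)
    have hne : w (i + 1) ≠ w (i + 3 + j) := fun h => by
      have := hinj ⟨by omega, by omega⟩ ⟨by omega, by omega⟩ h
      omega
    have e : i + 1 + (j + 1 + 1 : ℕ) = i + 3 + j := by omega
    simp [intersectionMatrix, e, hn, hne]
  · intro j
    have hn := hnot (i + 3 + j) (by omega) (by omega)
    have hne : w (i + 1) ≠ w (i + 3 + j) := fun h => by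
      have := hinj ⟨by omega, by omega⟩ ⟨by omega, by omega⟩ h
      omega
    have e : i + 1 + (j + 1 + 1 : ℕ) = i + 3 + j := by omega
    rw [Γ.graph.adj_comm] at hn
    simp [intersectionMatrix, e, hn, hne.symm]

theorem subDet_singleton (v : V) : Γ.subDet {v} = -Γ.euler v := by
  rw [Γ.subDet_eq_det_submatrix (fun _ : Fin 1 => v) (Function.injective_of_subsingleton _) {v}
    (by intro x; simp [eq_comm])]
  simp [intersectionMatrix]

end ResolutionGraph

/-! ### Paths with interior vertices of degree two -/

namespace SimpleGraph

variable {V : Type*} {G : SimpleGraph V} [Fintype V]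

/-- A path whose interior vertices have degree two is determined by its first edge. -/
theorem Walk.mem_support_of_snd_eq {n v x : V} (p : G.Walk n v) (q : G.Walk n x)
    (hp : p.IsPath) (hq : q.IsPath) (hp0 : ¬ p.Nil) (hq0 : ¬ q.Nil) (h : p.snd = q.snd)
    (hdeg : ∀ y ∈ p.support, y ≠ n → y ≠ v → G.degree y = 2) (hx : G.degree x ≠ 2) :
    v ∈ q.support := by
  induction p with
  | nil => simp at hp0
  | @cons n w v hnw p' ih =>
    cases q with
    | nil => simp at hq0
    | @cons _ w' _ hnw' q' =>
      simp only [Walk.snd_cons] at h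
      subst h
      rw [Walk.cons_isPath_iff] at hp hq
      rw [Walk.support_cons]
      refine List.mem_cons_of_mem _ ?_
      cases p' with
      | nil => exact q'.start_mem_support
      | @cons _ w2 _ hw p'' =>
        have hwv : w ≠ v := by
          rintro rfl
          have := hp.1
          rw [Walk.cons_isPath_iff] at this
          exact this.2 p''.end_mem_support
        have hw2 : G.degree w = 2 := hdeg w (by simp) hnw.ne' hwv
        cases q' with
        | nil => exact absurd hw2 hx
        | @cons _ w3 _ hw' q'' =>
          apply ih _ hp.1 hq.1 (by simp) (by simp)
          · simp only [Walk.snd_cons]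
            -- If the next edges differed, `n`, `w2`, `w3` would be three distinct neighbours of a
            -- vertex of degree two.
            by_contra hne
            have h2n : w2 ≠ n := by
              rintro rfl
              exact hp.2 (by simp)
            have h3n : w3 ≠ n := by
              rintro rfl
              exact hq.2 (by simp)
            have hsub : ({n, w2, w3} : Finset V) ⊆ G.neighborFinset w := by
              intro y hy
              simp only [Finset.mem_insert, Finset.mem_singleton] at hy
              rw [mem_neighborFinset]
              rcases hy with rfl | rfl | rfl
              exacts [hnw.symm, hw, hw']
            have := Finset.card_le_card hsub
            rw [card_neighborFinset_eq_degree, hw2, Finset.card_eq_three.2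
              ⟨n, w2, w3, h2n.symm, h3n.symm, hne, rfl⟩] at this
            omega
          · intro y hy hyw hyv
            refine hdeg y (by simp only [Walk.support_cons] at hy ⊢; exact List.mem_cons_of_mem _ hy)
              ?_ hyv
            rintro rfl
            exact hp.2 hy

theorem Walk.IsPath.two_le_degree_of_mem_support {n x y : V} {p : G.Walk n x} (hp : p.IsPath)
    (hy : y ∈ p.support) (hyn : y ≠ n) (hyx : y ≠ x) : 2 ≤ G.degree y := by
  obtain ⟨i, rfl, hi⟩ := Walk.mem_support_iff_exists_getVert.1 hy
  have hi0 : i ≠ 0 := by rintro rfl; simp at hyn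
  have hil : i ≠ p.length := by rintro rfl; simp at hyx
  have h1 : G.Adj (p.getVert i) (p.getVert (i + 1)) := p.adj_getVert_succ (by omega)
  have h2 : G.Adj (p.getVert (i - 1)) (p.getVert i) := by
    have := p.adj_getVert_succ (i := i - 1) (by omega)
    rwa [Nat.sub_add_cancel (by omega)] at this
  have hne : p.getVert (i - 1) ≠ p.getVert (i + 1) := fun h => by
    have := hp.getVert_injOn (show i - 1 ≤ p.length by omega)
      (show i + 1 ≤ p.length by omega) h
    omega
  rw [← card_neighborFinset_eq_degree, ← Finset.card_pair hne]
  apply Finset.card_le_card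
  intro z hz
  simp only [Finset.mem_insert, Finset.mem_singleton] at hz
  rw [mem_neighborFinset]
  rcases hz with rfl | rfl
  exacts [h2.symm, h1]

theorem Walk.IsPath.neighborFinset_getVert {n x : V} {p : G.Walk n x} (hp : p.IsPath) {i : ℕ}
    (hi0 : 0 < i) (hil : i < p.length) (hdeg : G.degree (p.getVert i) = 2) :
    p.getVert (i - 1) ≠ p.getVert (i + 1) ∧
      G.neighborFinset (p.getVert i) = {p.getVert (i - 1), p.getVert (i + 1)} := by
  have h1 : G.Adj (p.getVert i) (p.getVert (i + 1)) := p.adj_getVert_succ (by omega)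
  have h2 : G.Adj (p.getVert (i - 1)) (p.getVert i) := by
    have := p.adj_getVert_succ (i := i - 1) (by omega)
    rwa [Nat.sub_add_cancel (by omega)] at this
  have hne : p.getVert (i - 1) ≠ p.getVert (i + 1) := fun h => by
    have := hp.getVert_injOn (show i - 1 ≤ p.length by omega)
      (show i + 1 ≤ p.length by omega) h
    omega
  refine ⟨hne, (Finset.eq_of_subset_of_card_le ?_ ?_).symm⟩
  · intro z hz
    simp only [Finset.mem_insert, Finset.mem_singleton] at hz
    rw [mem_neighborFinset]
    rcases hz with rfl | rfl
    exacts [h2.symm, h1]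
  · rw [card_neighborFinset_eq_degree, hdeg, Finset.card_pair hne]

/-- As long as the last vertex has degree two, the path continues through the neighbour it did not
come from, and acyclicity keeps it a path. The length of a path is bounded by the number of
vertices, so this stops. -/
theorem IsTree.exists_path_extending_edge (hG : G.IsTree) {n w : V} (hnw : G.Adj n w) :
    ∃ (x : V) (p : G.Walk n x), p.IsPath ∧ ¬ p.Nil ∧ p.snd = w ∧
      (∀ y ∈ p.support, y ≠ n → y ≠ x → G.degree y = 2) ∧ G.degree x ≠ 2 := by
  by_contra hcon
  push Not at hcon
  have key : ∀ k : ℕ, ∃ (x : V) (p : G.Walk n x), p.IsPath ∧ ¬ p.Nil ∧ p.snd = w ∧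
      (∀ y ∈ p.support, y ≠ n → y ≠ x → G.degree y = 2) ∧ k < p.length := by
    intro k
    induction k with
    | zero =>
      refine ⟨w, Walk.cons hnw Walk.nil, ?_, by simp, by simp, ?_, by simp⟩
      · simp [hnw.ne]
      · intro y hy h1 h2
        simp [h1, h2] at hy
    | succ k ih =>
      obtain ⟨x, p, hp, hp0, hw, hdeg, hk⟩ := ih
      have hx := hcon x p hp hp0 hw hdeg
      obtain ⟨z, hz, hzp⟩ : ∃ z, G.Adj x z ∧ z ≠ p.penultimate := by
        by_contra hno
        push Not at hno
        have : G.neighborFinset x ⊆ {p.penultimate} := by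
          intro z hz
          rw [mem_neighborFinset] at hz
          simp [hno z hz]
        have := Finset.card_le_card this
        rw [card_neighborFinset_eq_degree, hx] at this
        simp at this
      have hzs : z ∉ p.support := fun h =>
        hzp (hG.isAcyclic.eq_penultimate_of_adj_end hp hz h)
      refine ⟨z, p.concat hz, ?_, ?_, ?_, ?_, ?_⟩
      · exact hp.concat hzs hz
      · intro h
        have := Walk.length_eq_zero_iff.2 h
        simp at this
      · cases p with
        | nil => simp at hp0
        | cons _ _ => simpa [Walk.concat_cons] using hw
      · intro y hy h1 h2
        rw [Walk.support_concat] at hy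
        simp only [List.mem_append, List.mem_singleton, h2, or_false] at hy
        by_cases hyx : y = x
        · rw [hyx, hx]
        · exact hdeg y hy h1 hyx
      · simp; omega
  obtain ⟨x, p, hp, -, -, -, hk⟩ := key (Fintype.card V)
  have := hp.length_lt
  omega

end SimpleGraph

/-! ### Chains and legs of the resolution tree -/

namespace ResolutionGraph

variable {V : Type*} [Fintype V] (Γ : ResolutionGraph V)

theorem pathWalk_isPath (n x : V) : (Γ.pathWalk n x).IsPath :=
  (Γ.isTree.existsUnique_path n x).choose_spec.1

theorem eq_pathWalk {n x : V} {p : Γ.graph.Walk n x} (hp : p.IsPath) : p = Γ.pathWalk n x :=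
  (Γ.isTree.existsUnique_path n x).choose_spec.2 p hp

theorem pathWalk_reverse (n x : V) : (Γ.pathWalk n x).reverse = Γ.pathWalk x n :=
  Γ.eq_pathWalk (Γ.pathWalk_isPath n x).reverse

theorem length_pathWalk_comm (n x : V) :
    (Γ.pathWalk n x).length = (Γ.pathWalk x n).length := by
  rw [← pathWalk_reverse, SimpleGraph.Walk.length_reverse]

theorem getVert_pathWalk_comm (n x : V) (i : ℕ) :
    (Γ.pathWalk x n).getVert i = (Γ.pathWalk n x).getVert ((Γ.pathWalk n x).length - i) := by
  rw [← pathWalk_reverse, SimpleGraph.Walk.getVert_reverse]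

theorem mem_path {n x y : V} : y ∈ Γ.path n x ↔ y ∈ (Γ.pathWalk n x).support := by
  simp [path]

theorem path_comm (n x : V) : Γ.path n x = Γ.path x n := by
  ext y
  rw [mem_path, mem_path, ← pathWalk_reverse, SimpleGraph.Walk.support_reverse,
    List.mem_reverse]

/-- The path from `n` to `x` has positive length and all its interior vertices have degree two. -/
def IsRay (n x : V) : Prop :=
  x ≠ n ∧ ∀ y ∈ Γ.path n x, y ≠ n → y ≠ x → Γ.graph.degree y = 2

variable {Γ}

theorem IsRay.symm {n x : V} (h : Γ.IsRay n x) : Γ.IsRay x n :=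
  ⟨h.1.symm, fun y hy h1 h2 => h.2 y (by rwa [path_comm]) h2 h1⟩

theorem IsRay.not_nil {n x : V} (h : Γ.IsRay n x) : ¬ (Γ.pathWalk n x).Nil :=
  SimpleGraph.Walk.not_nil_of_ne h.1.symm

theorem IsRay.length_pos {n x : V} (h : Γ.IsRay n x) : 0 < (Γ.pathWalk n x).length :=
  SimpleGraph.Walk.not_nil_iff_lt_length.1 h.not_nil

theorem IsRay.adj_firstVertex {n x : V} (h : Γ.IsRay n x) : Γ.graph.Adj n (Γ.firstVertex n x) :=
  SimpleGraph.Walk.adj_snd h.not_nil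

theorem firstVertex_eq_getVert (n x : V) : Γ.firstVertex n x = (Γ.pathWalk n x).getVert 1 := rfl

theorem IsRay.degree_getVert {n x : V} (h : Γ.IsRay n x) {i : ℕ} (hi0 : 0 < i)
    (hil : i < (Γ.pathWalk n x).length) : Γ.graph.degree ((Γ.pathWalk n x).getVert i) = 2 := by
  refine h.2 _ (Γ.mem_path.2 (SimpleGraph.Walk.getVert_mem_support _ _)) ?_ ?_
  · intro e
    have := ((Γ.pathWalk_isPath n x).getVert_eq_start_iff hil.le).1 e
    omega
  · intro e
    have := ((Γ.pathWalk_isPath n x).getVert_eq_end_iff hil.le).1 e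
    omega

theorem IsRay.mem_path_of_firstVertex_eq {n v x : V} (hv : Γ.IsRay n v) (hx : x ≠ n)
    (hdx : Γ.graph.degree x ≠ 2) (h : Γ.firstVertex n v = Γ.firstVertex n x) : v ∈ Γ.path n x := by
  rw [mem_path]
  exact SimpleGraph.Walk.mem_support_of_snd_eq (Γ.pathWalk n v) _ (Γ.pathWalk_isPath _ _)
    (Γ.pathWalk_isPath _ _) hv.not_nil (SimpleGraph.Walk.not_nil_of_ne hx.symm) h
    (fun y hy => hv.2 y (Γ.mem_path.2 hy)) hdx

theorem IsRay.eq_of_firstVertex_eq {n v x : V} (hv : Γ.IsRay n v) (hx : Γ.IsRay n x)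
    (hdv : Γ.graph.degree v ≠ 2) (hdx : Γ.graph.degree x ≠ 2)
    (h : Γ.firstVertex n v = Γ.firstVertex n x) : v = x := by
  by_contra hne
  exact hdv (hx.2 v (hv.mem_path_of_firstVertex_eq hx.1 hdx h) hv.1 hne)

theorem degree_eq_two_of_mem_path {n x y : V} (hy : y ∈ Γ.path n x) (hyn : y ≠ n)
    (hyx : y ≠ x) (h : ¬ 3 ≤ Γ.graph.degree y) : Γ.graph.degree y = 2 := by
  have := (Γ.pathWalk_isPath n x).two_le_degree_of_mem_support (Γ.mem_path.1 hy) hyn hyx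
  omega

theorem mem_nodesAt {n n' : Γ.Node} : n' ∈ Γ.nodesAt n ↔ Γ.IsRay n n' := by
  simp only [nodesAt, Finset.mem_filter, Finset.mem_univ, true_and, IsRay, ne_eq, Subtype.ext_iff]
  refine and_congr_right fun hne => ⟨fun h y hy h1 h2 => ?_, fun h y hy h1 h2 => ?_⟩
  · exact degree_eq_two_of_mem_path hy h1 h2 (h y hy h1 h2)
  · have := h y hy h1 h2; omega

theorem mem_endsAt {n : Γ.Node} {u : Γ.EndVertex} : u ∈ Γ.endsAt n ↔ Γ.IsRay n u := by
  simp only [endsAt, Finset.mem_filter, Finset.mem_univ, true_and, IsRay]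
  constructor
  · intro h
    refine ⟨fun e => ?_, fun y hy h1 h2 => degree_eq_two_of_mem_path hy h1 h2 (h y hy h1)⟩
    have h1 := u.2
    have h2 := n.2
    rw [e] at h1; omega
  · rintro ⟨hne, h⟩ y hy h1
    by_cases h2 : y = u
    · rw [h2, u.2]; omega
    · rw [h y hy h1 h2]; omega

theorem mem_nodesAt_comm {n n' : Γ.Node} : n' ∈ Γ.nodesAt n ↔ n ∈ Γ.nodesAt n' := by
  rw [mem_nodesAt, mem_nodesAt]
  exact ⟨IsRay.symm, IsRay.symm⟩

theorem Node.degree_ne_two (n : Γ.Node) : Γ.graph.degree n ≠ 2 := by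
  have := n.2; omega

theorem EndVertex.degree_ne_two (u : Γ.EndVertex) : Γ.graph.degree u ≠ 2 := by
  have := u.2; omega

/-- The edges at a node are the first edges of its chains and legs. -/
theorem neighborFinset_node (n : Γ.Node) :
    Γ.graph.neighborFinset n = (Γ.nodesAt n).image (fun n' : Γ.Node => Γ.firstVertex n n') ∪
      (Γ.endsAt n).image (fun u : Γ.EndVertex => Γ.firstVertex n u) := by
  ext w
  simp only [SimpleGraph.mem_neighborFinset, Finset.mem_union, Finset.mem_image]
  constructor
  · intro hw
    obtain ⟨x, p, hp, hp0, rfl, hint, hx⟩ := Γ.isTree.exists_path_extending_edge hw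
    obtain rfl := Γ.eq_pathWalk hp
    have hray : Γ.IsRay n x := by
      refine ⟨?_, fun y hy => hint y (Γ.mem_path.1 hy)⟩
      rintro rfl
      exact hp0 (SimpleGraph.Walk.isPath_iff_nil.1 hp)
    by_cases h3 : 3 ≤ Γ.graph.degree x
    · exact Or.inl ⟨⟨x, h3⟩, mem_nodesAt.2 hray, rfl⟩
    · have h1 : 0 < Γ.graph.degree x :=
        (Γ.graph.degree_pos_iff_exists_adj x).2 ⟨_, hray.symm.adj_firstVertex⟩
      exact Or.inr ⟨⟨x, by omega⟩, mem_endsAt.2 hray, rfl⟩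
  · rintro (⟨n', h, rfl⟩ | ⟨u, h, rfl⟩)
    · exact (mem_nodesAt.1 h).adj_firstVertex
    · exact (mem_endsAt.1 h).adj_firstVertex

theorem sum_neighborFinset_node {M : Type*} [AddCommMonoid M] (n : Γ.Node) (f : V → M) :
    ∑ w ∈ Γ.graph.neighborFinset n, f w = ∑ n' ∈ Γ.nodesAt n, f (Γ.firstVertex n n') +
      ∑ u ∈ Γ.endsAt n, f (Γ.firstVertex n u) := by
  rw [neighborFinset_node, Finset.sum_union, Finset.sum_image, Finset.sum_image]
  · intro u hu u' hu' h
    exact Subtype.ext ((mem_endsAt.1 hu).eq_of_firstVertex_eq (mem_endsAt.1 hu')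
      u.degree_ne_two u'.degree_ne_two h)
  · intro u hu u' hu' h
    exact Subtype.ext ((mem_nodesAt.1 hu).eq_of_firstVertex_eq (mem_nodesAt.1 hu')
      u.degree_ne_two u'.degree_ne_two h)
  · rw [Finset.disjoint_left]
    rintro w hw hw'
    obtain ⟨n', h1, rfl⟩ := Finset.mem_image.1 hw
    obtain ⟨u, h2, h⟩ := Finset.mem_image.1 hw'
    have := (mem_endsAt.1 h2).eq_of_firstVertex_eq (mem_nodesAt.1 h1)
      u.degree_ne_two n'.degree_ne_two h
    have h3 := n'.2
    rw [← this, u.2] at h3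
    omega

theorem degree_node (n : Γ.Node) : Γ.graph.degree n = Γ.deltaN n + (Γ.endsAt n).card := by
  have := sum_neighborFinset_node n (fun _ => 1)
  simpa [deltaN] using this

/-- The node is the first one met on the way from `v` to an arbitrary node: the vertices passed
before it are interior to a path and are not nodes, so they have degree two. -/
theorem exists_ray_to_node [Nonempty Γ.Node] {v : V} (hv : ¬ 3 ≤ Γ.graph.degree v) :
    ∃ n : Γ.Node, Γ.IsRay v n := by
  obtain ⟨m⟩ := ‹Nonempty Γ.Node›
  have hex : ∃ i, i ≤ (Γ.pathWalk v m).length ∧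
      3 ≤ Γ.graph.degree ((Γ.pathWalk v m).getVert i) :=
    ⟨_, le_rfl, by rw [SimpleGraph.Walk.getVert_length]; exact m.2⟩
  obtain ⟨hi, h3⟩ := Nat.find_spec hex
  have hmin := fun j => Nat.find_min hex (m := j)
  set i := Nat.find hex
  refine ⟨⟨_, h3⟩, ?_, ?_⟩
  · intro h
    exact hv (h ▸ h3)
  · intro y hy h1 h2
    have htake : ((Γ.pathWalk v m).take i).IsPath := (Γ.pathWalk_isPath v m).take i
    rw [mem_path, ← Γ.eq_pathWalk htake] at hy
    obtain ⟨j, rfl, hj⟩ := SimpleGraph.Walk.mem_support_iff_exists_getVert.1 hy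
    refine degree_eq_two_of_mem_path (n := v) (x := m) ?_ h1 ?_ ?_
    · rw [mem_path]
      rw [SimpleGraph.Walk.take_getVert]
      exact SimpleGraph.Walk.getVert_mem_support _ _
    · intro e
      rw [SimpleGraph.Walk.take_getVert] at e h2
      have hjl := ((Γ.pathWalk_isPath v m).getVert_eq_end_iff (by omega)).1 e
      apply h2
      congr 1
      omega
    · rw [SimpleGraph.Walk.take_getVert] at h2 ⊢
      have hlt : i ⊓ j < i := by
        rcases lt_or_ge j i with h | h
        · omega
        · exact absurd (by rw [min_eq_left h]) h2
      intro h3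
      exact hmin _ hlt ⟨by omega, h3⟩

/-- An end has a single edge, so two rays from it to nodes share their first edge and therefore
coincide. -/
theorem EndVertex.existsUnique_node [Nonempty Γ.Node] (u : Γ.EndVertex) :
    ∃! n : Γ.Node, u ∈ Γ.endsAt n := by
  obtain ⟨n, hn⟩ := exists_ray_to_node (Γ := Γ) (v := u) (by rw [u.2]; omega)
  refine ⟨n, mem_endsAt.2 hn.symm, fun n' hn' => ?_⟩
  have hn' := (mem_endsAt.1 hn').symm
  apply Subtype.ext
  apply hn'.eq_of_firstVertex_eq hn n'.degree_ne_two n.degree_ne_two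
  have h1 := u.2
  rw [← SimpleGraph.card_neighborFinset_eq_degree, Finset.card_eq_one] at h1
  obtain ⟨w, hw⟩ := h1
  have e1 := (SimpleGraph.mem_neighborFinset _ _ _).2 hn.adj_firstVertex
  have e2 := (SimpleGraph.mem_neighborFinset _ _ _).2 hn'.adj_firstVertex
  rw [hw, Finset.mem_singleton] at e1 e2
  rw [e1, e2]

/-- Every vertex that is not a node lies on a leg or a chain. -/
theorem exists_mem_path [Nonempty Γ.Node] {v : V} (hv : ¬ 3 ≤ Γ.graph.degree v) :
    (∃ n : Γ.Node, ∃ n' ∈ Γ.nodesAt n, v ∈ Γ.path n n') ∨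
      ∃ n : Γ.Node, ∃ u ∈ Γ.endsAt n, v ∈ Γ.path n u := by
  obtain ⟨n, hn⟩ := exists_ray_to_node hv
  have h := (SimpleGraph.mem_neighborFinset _ _ _).2 hn.symm.adj_firstVertex
  rw [neighborFinset_node, Finset.mem_union, Finset.mem_image, Finset.mem_image] at h
  rcases h with ⟨n', h, e⟩ | ⟨u, h, e⟩
  · exact Or.inl ⟨n, n', h, hn.symm.mem_path_of_firstVertex_eq (mem_nodesAt.1 h).1
      n'.degree_ne_two e.symm⟩
  · exact Or.inr ⟨n, u, h, hn.symm.mem_path_of_firstVertex_eq (mem_endsAt.1 h).1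
      u.degree_ne_two e.symm⟩

end ResolutionGraph

namespace ResolutionGraph

variable {V : Type*} [Fintype V] {Γ : ResolutionGraph V}

/-! ### Linear relations along chains and legs -/

variable (Γ) in
/-- The determinant of the part of the path from `n` to `x` with indices strictly between `i`
and `t`. -/
def stringDet (n x : V) (i t : ℕ) : ℤ :=
  Γ.subDet ((Finset.Ioo i t).image (Γ.pathWalk n x).getVert)

theorem stringDet_pos (n x : V) (i t : ℕ) : 0 < Γ.stringDet n x i t := Γ.subDet_pos _

theorem stringDet_self (n x : V) (i : ℕ) : Γ.stringDet n x i (i + 1) = 1 := by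
  have : Finset.Ioo i (i + 1) = ∅ := by ext; simp
  rw [stringDet, this, Finset.image_empty, subDet_empty]

theorem mem_path_iff_getVert {n x y : V} :
    y ∈ Γ.path n x ↔ ∃ i, i ≤ (Γ.pathWalk n x).length ∧ (Γ.pathWalk n x).getVert i = y := by
  rw [mem_path, SimpleGraph.Walk.mem_support_iff_exists_getVert]
  exact exists_congr fun i => and_comm

theorem getVert_pathWalk_inj {n x : V} {i j : ℕ} (hi : i ≤ (Γ.pathWalk n x).length)
    (hj : j ≤ (Γ.pathWalk n x).length) :
    (Γ.pathWalk n x).getVert i = (Γ.pathWalk n x).getVert j ↔ i = j :=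
  ⟨fun h => (Γ.pathWalk_isPath n x).getVert_injOn hi hj h, fun h => h ▸ rfl⟩

/-- The determinants `α` and `ω` are all of this form. With `s` the length of the path, the pairs
`(i, t)` are `(0, s + 1)` and `(1, s + 1)` for legs, and `(0, s)` and `(1, s)` for chains. -/
theorem path_sdiff (n x : V) (S : Finset V) (i t : ℕ) (ht : t ≤ (Γ.pathWalk n x).length + 1)
    (hS : ∀ j ≤ (Γ.pathWalk n x).length, (Γ.pathWalk n x).getVert j ∈ S ↔ j ≤ i ∨ t ≤ j) :
    Γ.subDet (Γ.path n x \ S) = Γ.stringDet n x i t := by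
  rw [stringDet]
  congr 1
  ext y
  simp only [Finset.mem_sdiff, mem_path_iff_getVert, Finset.mem_image, Finset.mem_Ioo]
  constructor
  · rintro ⟨⟨j, hj, rfl⟩, hjS⟩
    rw [hS j hj] at hjS
    exact ⟨j, by omega, rfl⟩
  · rintro ⟨j, hj, rfl⟩
    exact ⟨⟨j, by omega, rfl⟩, by rw [hS j (by omega)]; omega⟩

theorem getVert_eq_start_iff' {n x : V} {j : ℕ} (hj : j ≤ (Γ.pathWalk n x).length) :
    (Γ.pathWalk n x).getVert j = n ↔ j = 0 :=
  (Γ.pathWalk_isPath n x).getVert_eq_start_iff hj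

theorem getVert_eq_end_iff' {n x : V} {j : ℕ} (hj : j ≤ (Γ.pathWalk n x).length) :
    (Γ.pathWalk n x).getVert j = x ↔ j = (Γ.pathWalk n x).length :=
  (Γ.pathWalk_isPath n x).getVert_eq_end_iff hj

theorem IsRay.getVert_eq_firstVertex_iff {n x : V} (h : Γ.IsRay n x) {j : ℕ}
    (hj : j ≤ (Γ.pathWalk n x).length) :
    (Γ.pathWalk n x).getVert j = Γ.firstVertex n x ↔ j = 1 := by
  rw [firstVertex_eq_getVert, getVert_pathWalk_inj hj h.length_pos]

theorem alphaEnd_eq {n : Γ.Node} {u : Γ.EndVertex} :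
    Γ.alphaEnd n u = Γ.stringDet n u 0 ((Γ.pathWalk n u).length + 1) := by
  apply path_sdiff _ _ _ _ _ le_rfl
  intro j hj
  rw [Finset.mem_singleton, getVert_eq_start_iff' hj]
  omega

theorem omegaEnd_eq {n : Γ.Node} {u : Γ.EndVertex} (h : Γ.IsRay n u) :
    Γ.omegaEnd n u = Γ.stringDet n u 1 ((Γ.pathWalk n u).length + 1) := by
  apply path_sdiff _ _ _ _ _ le_rfl
  intro j hj
  rw [Finset.mem_insert, Finset.mem_singleton, getVert_eq_start_iff' hj,
    h.getVert_eq_firstVertex_iff hj]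
  omega

theorem IsRay.length_eq_one_iff {n x : V} (h : Γ.IsRay n x) :
    (Γ.pathWalk n x).length = 1 ↔ Γ.graph.Adj n x := by
  constructor
  · intro e
    have := h.adj_firstVertex
    rwa [firstVertex_eq_getVert, ← e, SimpleGraph.Walk.getVert_length] at this
  · intro e
    have hp : (SimpleGraph.Walk.cons e SimpleGraph.Walk.nil).IsPath := by simp [e.ne]
    rw [← Γ.eq_pathWalk hp]
    simp

theorem alphaChain_eq {n n' : Γ.Node} :
    Γ.alphaChain n n' = Γ.stringDet n n' 0 (Γ.pathWalk n n').length := by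
  apply path_sdiff _ _ _ _ _ (by omega)
  intro j hj
  rw [Finset.mem_insert, Finset.mem_singleton, getVert_eq_start_iff' hj, getVert_eq_end_iff' hj]
  omega

theorem alphaChain_comm (n n' : Γ.Node) : Γ.alphaChain n n' = Γ.alphaChain n' n := by
  rw [alphaChain, alphaChain, path_comm, Finset.pair_comm]

theorem alphaChain_pos (n n' : Γ.Node) : 0 < Γ.alphaChain n n' := Γ.subDet_pos _

theorem alphaEnd_pos (n : Γ.Node) (u : Γ.EndVertex) : 0 < Γ.alphaEnd n u := Γ.subDet_pos _

/-- The empty chain is separate because its `ω` is 0 by convention, whereas the determinant of an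
empty matrix is 1. -/
theorem omegaChain_eq {n n' : Γ.Node} (h : Γ.IsRay n n') :
    Γ.omegaChain n n' = if (Γ.pathWalk n n').length = 1 then 0 else
      Γ.stringDet n n' 1 (Γ.pathWalk n n').length := by
  rw [omegaChain]
  simp only [← h.length_eq_one_iff]
  split_ifs with h1
  · rfl
  · apply path_sdiff _ _ _ _ _ (by omega)
    intro j hj
    rw [Finset.mem_insert, Finset.mem_insert, Finset.mem_singleton, getVert_eq_start_iff' hj,
      getVert_eq_end_iff' hj, h.getVert_eq_firstVertex_iff hj]
    have := h.length_pos
    omega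

theorem IsRay.coef_getVert {n x : V} (h : Γ.IsRay n x) (d : V → ℝ) {i : ℕ} (hi0 : 0 < i)
    (hil : i < (Γ.pathWalk n x).length) :
    Γ.coef d ((Γ.pathWalk n x).getVert i) =
      -(Γ.euler ((Γ.pathWalk n x).getVert i) : ℝ) * d ((Γ.pathWalk n x).getVert i) -
        d ((Γ.pathWalk n x).getVert (i - 1)) - d ((Γ.pathWalk n x).getVert (i + 1)) := by
  obtain ⟨hne, hnb⟩ := (Γ.pathWalk_isPath n x).neighborFinset_getVert hi0 hil
    (h.degree_getVert hi0 hil)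
  rw [coef_apply, hnb, Finset.sum_pair hne]
  ring

theorem IsRay.coef_end {n x : V} (h : Γ.IsRay n x) (hx : Γ.graph.degree x = 1) (d : V → ℝ) :
    Γ.coef d x = -(Γ.euler x : ℝ) * d x -
      d ((Γ.pathWalk n x).getVert ((Γ.pathWalk n x).length - 1)) := by
  have hl := h.length_pos
  have hadj := (Γ.pathWalk n x).adj_getVert_succ (i := (Γ.pathWalk n x).length - 1) (by omega)
  rw [Nat.sub_add_cancel (by omega), SimpleGraph.Walk.getVert_length] at hadj
  rw [← SimpleGraph.card_neighborFinset_eq_degree, Finset.card_eq_one] at hx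
  obtain ⟨w, hw⟩ := hx
  have e := (SimpleGraph.mem_neighborFinset _ _ _).2 hadj.symm
  rw [hw, Finset.mem_singleton] at e
  rw [coef_apply, hw, Finset.sum_singleton, e]

theorem IsRay.stringDet_rec {n x : V} (h : Γ.IsRay n x) {t : ℕ}
    (ht : t ≤ (Γ.pathWalk n x).length + 1) {i : ℕ} (hi : i + 2 < t) :
    Γ.stringDet n x i t = -Γ.euler ((Γ.pathWalk n x).getVert (i + 1)) * Γ.stringDet n x (i + 1) t -
      Γ.stringDet n x (i + 2) t := by
  apply Γ.subDet_image_succ _ _ _ hi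
  · intro a ha b hb hab
    simp only [Set.mem_Ioo] at ha hb
    exact (getVert_pathWalk_inj (by omega) (by omega)).1 hab
  · exact SimpleGraph.Walk.adj_getVert_succ _ (by omega)
  · intro j hj hjt hadj
    obtain ⟨-, hnb⟩ := (Γ.pathWalk_isPath n x).neighborFinset_getVert (i := i + 1) (by omega)
      (by omega) (h.degree_getVert (by omega) (by omega))
    have := (SimpleGraph.mem_neighborFinset _ _ _).2 hadj
    rw [hnb, Finset.mem_insert, Finset.mem_singleton, getVert_pathWalk_inj (by omega) (by omega),
      getVert_pathWalk_inj (by omega) (by omega)] at this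
    omega

/-- Tail determinants of the ray are continuants, so the interior coordinates can be eliminated. The
sequence `X` is arbitrary so that a leg can be prolonged by the value 0 beyond its end. -/
theorem IsRay.relation {n x : V} (h : Γ.IsRay n x) (s : ℕ) (hs : s ≤ (Γ.pathWalk n x).length)
    (X y : ℕ → ℝ)
    (hy : ∀ i, 1 ≤ i → i ≤ s →
      y i = -(Γ.euler ((Γ.pathWalk n x).getVert i) : ℝ) * X i - X (i - 1) - X (i + 1)) :
    (Γ.stringDet n x 0 (s + 1) : ℝ) * X 1 =
      (if s = 0 then 0 else (Γ.stringDet n x 1 (s + 1) : ℝ)) * X 0 + X (s + 1) +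
      ∑ j ∈ Finset.Ioc 0 s, (Γ.stringDet n x j (s + 1) : ℝ) * y j := by
  -- The cut-off at `s` matters: at `s + 1` the continuant has to be 0, while the determinant of the
  -- empty string is 1.
  have key := continuant_relation
    (fun i => if i ≤ s then (Γ.stringDet n x i (s + 1) : ℝ) else 0) X y
    (fun i => -(Γ.euler ((Γ.pathWalk n x).getVert i) : ℝ)) s
    (by simp [stringDet_self]) (by simp) ?_ hy
  · have e : ∑ j ∈ Finset.Ioc 0 s, (if j ≤ s then (Γ.stringDet n x j (s + 1) : ℝ) else 0) * y j =
        ∑ j ∈ Finset.Ioc 0 s, (Γ.stringDet n x j (s + 1) : ℝ) * y j := by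
      refine Finset.sum_congr rfl fun j hj => ?_
      rw [if_pos (Finset.mem_Ioc.1 hj).2]
    rw [e] at key
    simp only [zero_le, if_true] at key
    rw [key]
    rcases Nat.eq_zero_or_pos s with rfl | h0
    · simp
    · rw [if_pos (show 1 ≤ s from h0), if_neg (by omega)]
  · intro i hi
    rw [if_pos hi.le, if_pos (by omega)]
    by_cases h2 : i + 2 ≤ s
    · rw [if_pos h2, h.stringDet_rec (by omega) (by omega)]
      push_cast
      ring
    · have : s = i + 1 := by omega
      subst this
      rw [if_neg (by omega), stringDet_self]
      have : Finset.Ioo i (i + 1 + 1) = {i + 1} := by ext; simp; omega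
      rw [stringDet, this, Finset.image_singleton, subDet_singleton]
      push_cast
      ring

/-- Elimination of the interior of a chain. Divided by `α` it feeds the linear form `Λ_n`; read
modulo `α` it gives the congruences of `ℤ^𝒩(a)`. -/
theorem chain_relation {n n' : Γ.Node} (h : n' ∈ Γ.nodesAt n) (d : V → ℝ) :
    (Γ.alphaChain n n' : ℝ) * d (Γ.firstVertex n n') =
      Γ.omegaChain n n' * d n + d n' +
      ∑ j ∈ Finset.Ioo 0 (Γ.pathWalk n n').length,
        (Γ.stringDet n n' j (Γ.pathWalk n n').length : ℝ) *
          Γ.coef d ((Γ.pathWalk n n').getVert j) := by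
  have hr := mem_nodesAt.1 h
  obtain ⟨s, hs⟩ : ∃ s, (Γ.pathWalk n n').length = s + 1 :=
    ⟨_, (Nat.sub_add_cancel hr.length_pos).symm⟩
  have key := hr.relation s (by omega) (fun i => d ((Γ.pathWalk n n').getVert i))
    (fun i => Γ.coef d ((Γ.pathWalk n n').getVert i))
    (fun i h1 h2 => hr.coef_getVert d h1 (by omega))
  have e : (Γ.omegaChain n n' : ℝ) = if s = 0 then 0 else (Γ.stringDet n n' 1 (s + 1) : ℝ) := by
    rw [omegaChain_eq hr, hs]
    by_cases h0 : s = 0 <;> simp [h0]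
  have e2 : Finset.Ioo 0 (s + 1) = Finset.Ioc 0 s := by ext; simp
  rw [alphaChain_eq, e, hs, firstVertex_eq_getVert, key, e2]
  conv_lhs => rw [← hs]
  rw [SimpleGraph.Walk.getVert_length, SimpleGraph.Walk.getVert_zero, hs]

/-- The same elimination along a leg; no second node appears because the coordinate beyond the end
counts as 0. -/
theorem leg_relation {n : Γ.Node} {u : Γ.EndVertex} (h : u ∈ Γ.endsAt n) (d : V → ℝ) :
    (Γ.alphaEnd n u : ℝ) * d (Γ.firstVertex n u) =
      Γ.omegaEnd n u * d n +
      ∑ j ∈ Finset.Ioc 0 (Γ.pathWalk n u).length,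
        (Γ.stringDet n u j ((Γ.pathWalk n u).length + 1) : ℝ) *
          Γ.coef d ((Γ.pathWalk n u).getVert j) := by
  have hr := mem_endsAt.1 h
  have hl := hr.length_pos
  have key := hr.relation _ le_rfl
    (fun i => if i ≤ (Γ.pathWalk n u).length then d ((Γ.pathWalk n u).getVert i) else 0)
    (fun i => Γ.coef d ((Γ.pathWalk n u).getVert i)) ?_
  · rw [if_neg hl.ne', if_pos (show 1 ≤ (Γ.pathWalk n u).length from hl), if_pos (Nat.zero_le _),
      if_neg (show ¬ (Γ.pathWalk n u).length + 1 ≤ (Γ.pathWalk n u).length by omega)] at key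
    rw [alphaEnd_eq, omegaEnd_eq hr, firstVertex_eq_getVert, key, SimpleGraph.Walk.getVert_zero]
    ring
  · intro i h1 h2
    rw [if_pos h2, if_pos (by omega)]
    rcases Nat.lt_or_ge i (Γ.pathWalk n u).length with h3 | h3
    · rw [if_pos (by omega), hr.coef_getVert d h1 h3]
    · have : i = (Γ.pathWalk n u).length := by omega
      rw [if_neg (by omega), this, SimpleGraph.Walk.getVert_length, hr.coef_end u.2 d, sub_zero]

/-! ### The orbifold form on the node coordinates -/

variable (Γ) in
/-- The linear forms `Λ_n` on the node coordinates that define the cone `𝒞^orb`. -/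
def orbForm : (Γ.Node → ℝ) →ₗ[ℝ] (Γ.Node → ℝ) where
  toFun z n := -((Γ.euler n : ℝ) + ∑ n' ∈ Γ.nodesAt n, (Γ.omegaChain n n' : ℝ) / Γ.alphaChain n n'
      + ∑ u ∈ Γ.endsAt n, (Γ.omegaEnd n u : ℝ) / Γ.alphaEnd n u) * z n
    - ∑ n' ∈ Γ.nodesAt n, 1 / (Γ.alphaChain n n' : ℝ) * z n'
  map_add' x y := by
    ext n
    simp only [Pi.add_apply, mul_add, Finset.sum_add_distrib]
    ring
  map_smul' c x := by
    ext n
    simp only [Pi.smul_apply, smul_eq_mul, RingHom.id_apply, mul_sub, Finset.mul_sum]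
    congr 1
    · ring
    · exact Finset.sum_congr rfl fun _ _ => by ring

theorem orbForm_apply (z : Γ.Node → ℝ) (n : Γ.Node) : Γ.orbForm z n =
    -((Γ.euler n : ℝ) + ∑ n' ∈ Γ.nodesAt n, (Γ.omegaChain n n' : ℝ) / Γ.alphaChain n n'
      + ∑ u ∈ Γ.endsAt n, (Γ.omegaEnd n u : ℝ) / Γ.alphaEnd n u) * z n
    - ∑ n' ∈ Γ.nodesAt n, 1 / (Γ.alphaChain n n' : ℝ) * z n' := rfl

/-- In `-(d, E_n)` each neighbouring coordinate is replaced by its chain or leg relation divided by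
`α`. The result is a combination of the numbers `-(d, E_v)` with positive weights, which is what
makes `Λ_n` nonnegative on the projected Lipman cone. -/
theorem orbForm_proj (d : V → ℝ) (n : Γ.Node) : Γ.orbForm (Γ.proj d) n = Γ.coef d n +
    ∑ n' ∈ Γ.nodesAt n, (∑ j ∈ Finset.Ioo 0 (Γ.pathWalk n n').length,
        (Γ.stringDet n n' j (Γ.pathWalk n n').length : ℝ) *
          Γ.coef d ((Γ.pathWalk n n').getVert j)) / Γ.alphaChain n n' +
    ∑ u ∈ Γ.endsAt n, (∑ j ∈ Finset.Ioc 0 (Γ.pathWalk n u).length,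
        (Γ.stringDet n u j ((Γ.pathWalk n u).length + 1) : ℝ) *
          Γ.coef d ((Γ.pathWalk n u).getVert j)) / Γ.alphaEnd n u := by
  have h1 : ∑ n' ∈ Γ.nodesAt n, (∑ j ∈ Finset.Ioo 0 (Γ.pathWalk n n').length,
        (Γ.stringDet n n' j (Γ.pathWalk n n').length : ℝ) *
          Γ.coef d ((Γ.pathWalk n n').getVert j)) / Γ.alphaChain n n' =
      ∑ n' ∈ Γ.nodesAt n, (d (Γ.firstVertex n n') -
        (Γ.omegaChain n n' : ℝ) / Γ.alphaChain n n' * d n - 1 / (Γ.alphaChain n n' : ℝ) * d n') := by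
    refine Finset.sum_congr rfl fun n' h => ?_
    have h0 : (Γ.alphaChain n n' : ℝ) ≠ 0 := by exact_mod_cast (alphaChain_pos n n').ne'
    have := chain_relation h d
    field_simp
    linear_combination -this
  have h2 : ∑ u ∈ Γ.endsAt n, (∑ j ∈ Finset.Ioc 0 (Γ.pathWalk n u).length,
        (Γ.stringDet n u j ((Γ.pathWalk n u).length + 1) : ℝ) *
          Γ.coef d ((Γ.pathWalk n u).getVert j)) / Γ.alphaEnd n u =
      ∑ u ∈ Γ.endsAt n, (d (Γ.firstVertex n u) -
        (Γ.omegaEnd n u : ℝ) / Γ.alphaEnd n u * d n) := by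
    refine Finset.sum_congr rfl fun u h => ?_
    have h0 : (Γ.alphaEnd n u : ℝ) ≠ 0 := by exact_mod_cast (alphaEnd_pos n u).ne'
    have := leg_relation h d
    field_simp
    linear_combination -this
  rw [h1, h2, coef_apply, sum_neighborFinset_node, orbForm_apply]
  simp only [proj, Finset.sum_sub_distrib, ← Finset.sum_mul]
  ring

theorem orbForm_proj_nonneg {d : V → ℝ} (h : ∀ v, 0 ≤ Γ.coef d v) (n : Γ.Node) :
    0 ≤ Γ.orbForm (Γ.proj d) n := by
  rw [orbForm_proj]
  have hs : ∀ (n x : V) i t, (0 : ℝ) ≤ Γ.stringDet n x i t := fun n x i t => by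
    exact_mod_cast (stringDet_pos n x i t).le
  refine add_nonneg (add_nonneg (h _) (Finset.sum_nonneg fun n' _ => ?_))
    (Finset.sum_nonneg fun u _ => ?_)
  · exact div_nonneg (Finset.sum_nonneg fun j _ => mul_nonneg (hs _ _ _ _) (h _))
      (by exact_mod_cast (alphaChain_pos n n').le)
  · exact div_nonneg (Finset.sum_nonneg fun j _ => mul_nonneg (hs _ _ _ _) (h _))
      (by exact_mod_cast (alphaEnd_pos n u).le)

/-- The combination `∑_n z_n E_n^*` over the nodes. -/
def nodeVec (z : Γ.Node → ℝ) : V → ℝ := ∑ n : Γ.Node, z n • Γ.dualVec n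

theorem coef_nodeVec (z : Γ.Node → ℝ) (v : V) :
    Γ.coef (nodeVec z) v = ∑ n : Γ.Node, if n.1 = v then z n else 0 := by
  simp [nodeVec, map_sum, coef_dualVec]

theorem coef_nodeVec_node (z : Γ.Node → ℝ) (n : Γ.Node) : Γ.coef (nodeVec z) n = z n := by
  simp [coef_nodeVec, ← Subtype.ext_iff]

theorem coef_nodeVec_of_lt (z : Γ.Node → ℝ) {v : V} (h : Γ.graph.degree v < 3) :
    Γ.coef (nodeVec z) v = 0 := by
  rw [coef_nodeVec]
  refine Finset.sum_eq_zero fun n _ => if_neg ?_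
  rintro rfl
  have := n.2
  omega

theorem IsRay.degree_getVert_le {n x : V} (h : Γ.IsRay n x) (hx : Γ.graph.degree x = 1) {i : ℕ}
    (hi0 : 0 < i) (hil : i ≤ (Γ.pathWalk n x).length) :
    Γ.graph.degree ((Γ.pathWalk n x).getVert i) < 3 := by
  rcases hil.lt_or_eq with h1 | h1
  · rw [h.degree_getVert hi0 h1]; omega
  · rw [h1, SimpleGraph.Walk.getVert_length, hx]; omega

/-- A combination of the `E_n^*` at nodes has zero coefficients inside chains and legs, so only the
coefficient at `n` is left in `Λ_n`. This gives surjectivity of `Λ`, hence bijectivity by dimension.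
-/
theorem orbForm_nodeVec (z : Γ.Node → ℝ) : Γ.orbForm (Γ.proj (nodeVec z)) = z := by
  ext n
  rw [orbForm_proj, coef_nodeVec_node, Finset.sum_eq_zero, Finset.sum_eq_zero, add_zero, add_zero]
  · intro u hu
    rw [Finset.sum_eq_zero, zero_div]
    intro j hj
    rw [Finset.mem_Ioc] at hj
    rw [coef_nodeVec_of_lt _ ((mem_endsAt.1 hu).degree_getVert_le u.2 hj.1 hj.2), mul_zero]
  · intro n' hn'
    rw [Finset.sum_eq_zero, zero_div]
    intro j hj
    rw [Finset.mem_Ioo] at hj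
    rw [coef_nodeVec_of_lt _ (by rw [(mem_nodesAt.1 hn').degree_getVert hj.1 hj.2]; omega),
      mul_zero]

theorem orbForm_injective : Function.Injective Γ.orbForm :=
  LinearMap.injective_iff_surjective.2 fun z => ⟨_, orbForm_nodeVec z⟩

theorem proj_nodeVec_orbForm (z : Γ.Node → ℝ) : Γ.proj (nodeVec (Γ.orbForm z)) = z :=
  orbForm_injective (orbForm_nodeVec _)

/-- One inclusion is positivity of the weights in `orbForm_proj`; conversely `∑_n Λ_n(z) E_n^*` is a
point of the Lipman cone above `z`. The cone is thus simplicial, with facets given by the `Λ_n`. -/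
theorem mem_orbCone {z : Γ.Node → ℝ} : z ∈ Γ.orbCone ↔ ∀ n, 0 ≤ Γ.orbForm z n := by
  constructor
  · rintro ⟨x, hx, rfl⟩ n
    apply orbForm_proj_nonneg
    intro v
    have := hx v
    rw [pairing_single] at this
    linarith
  · intro h
    refine ⟨nodeVec (Γ.orbForm z), fun v => ?_, proj_nodeVec_orbForm z⟩
    rw [pairing_single, coef_nodeVec, neg_nonpos]
    exact Finset.sum_nonneg fun n _ => by split_ifs; exacts [h n, le_rfl]

theorem nonneg_of_mem_orbCone {z : Γ.Node → ℝ} (h : z ∈ Γ.orbCone) (n : Γ.Node) : 0 ≤ z n := by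
  obtain ⟨x, hx, rfl⟩ := h
  refine Γ.nonneg_of_coef_nonneg (fun v => ?_) n
  have := hx v
  rw [pairing_single] at this
  linarith

end ResolutionGraph

/-! ### First vertices of chains and integrality along rays -/

namespace ResolutionGraph

variable {V : Type*} [Fintype V] {Γ : ResolutionGraph V}

/-- The node `m` is adjacent to an interior vertex of the ray, so it is one of the two consecutive
vertices on the ray; being a node, it must be an endpoint. This locates the coefficients
`a_{n_{n'}}` on the chains. -/
theorem IsRay.firstVertex_eq_getVert_cases {n x : V} (h : Γ.IsRay n x)
    (hn : Γ.graph.degree n ≠ 2) (hx : Γ.graph.degree x ≠ 2) {m m' : Γ.Node}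
    (hm : m' ∈ Γ.nodesAt m) {i : ℕ} (hi0 : 0 < i) (hil : i < (Γ.pathWalk n x).length)
    (e : Γ.firstVertex m m' = (Γ.pathWalk n x).getVert i) :
    (m.1 = n ∧ m'.1 = x ∧ i = 1) ∨ (m.1 = x ∧ m'.1 = n ∧ i + 1 = (Γ.pathWalk n x).length) := by
  have hm := mem_nodesAt.1 hm
  have hadj := hm.adj_firstVertex
  rw [e] at hadj
  have hmem := (SimpleGraph.mem_neighborFinset _ _ _).2 hadj.symm
  obtain ⟨-, hnb⟩ := (Γ.pathWalk_isPath n x).neighborFinset_getVert hi0 hil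
    (h.degree_getVert hi0 hil)
  rw [hnb, Finset.mem_insert, Finset.mem_singleton] at hmem
  have h3 := m.2
  rcases hmem with hmem | hmem
  · left
    have hi : i = 1 := by
      by_contra hi
      have := h.degree_getVert (i := i - 1) (by omega) (by omega)
      rw [← hmem] at this
      omega
    subst hi
    have hmn : m.1 = n := by simpa using hmem
    rw [hmn] at e hm
    exact ⟨hmn, hm.eq_of_firstVertex_eq h m'.degree_ne_two hx e, rfl⟩
  · right
    have hi : i + 1 = (Γ.pathWalk n x).length := by
      by_contra hi
      have := h.degree_getVert (i := i + 1) (by omega) (by omega)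
      rw [← hmem] at this
      omega
    rw [hi, SimpleGraph.Walk.getVert_length] at hmem
    rw [hmem] at e hm
    refine ⟨hmem, hm.eq_of_firstVertex_eq h.symm m'.degree_ne_two hn ?_, hi⟩
    rw [e, firstVertex_eq_getVert, Γ.getVert_pathWalk_comm n x 1, ← hi, Nat.add_sub_cancel]

theorem firstVertex_cases {m m' : Γ.Node} (h : m' ∈ Γ.nodesAt m) :
    (Γ.firstVertex m m' = m' ∧ Γ.graph.Adj m m') ∨ Γ.graph.degree (Γ.firstVertex m m') = 2 := by
  have hr := mem_nodesAt.1 h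
  rcases Nat.lt_or_ge 1 (Γ.pathWalk m m').length with h1 | h1
  · exact Or.inr (hr.degree_getVert one_pos h1)
  · have : (Γ.pathWalk m m').length = 1 := by have := hr.length_pos; omega
    left
    refine ⟨?_, hr.length_eq_one_iff.1 this⟩
    rw [firstVertex_eq_getVert, ← this, SimpleGraph.Walk.getVert_length]

theorem firstVertex_of_adj {m m' : V} (h : Γ.graph.Adj m m') : Γ.firstVertex m m' = m' := by
  have hp : (SimpleGraph.Walk.cons h SimpleGraph.Walk.nil).IsPath := by simp [h.ne]
  rw [firstVertex, ← Γ.eq_pathWalk hp]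
  simp

theorem alphaChain_of_adj {n n' : Γ.Node} (h : n' ∈ Γ.nodesAt n) (hadj : Γ.graph.Adj n n') :
    Γ.alphaChain n n' = 1 := by
  rw [alphaChain_eq, (mem_nodesAt.1 h).length_eq_one_iff.2 hadj, stringDet_self]

theorem coef_integral {d : V → ℝ} (hd : d ∈ lattice (V := V)) (v : V) :
    ∃ k : ℤ, Γ.coef d v = k := by
  choose f hf using hd
  refine ⟨-Γ.euler v * f v - ∑ w ∈ Γ.graph.neighborFinset v, f w, ?_⟩
  rw [coef_apply]
  push_cast
  simp only [hf]

/-- Along vertices of degree two the coordinates obey a two-term recursion with integer data, so two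
integral initial values suffice. -/
theorem IsRay.integral_getVert {n x : V} (h : Γ.IsRay n x)
    (hd : ∀ v, Γ.graph.degree v = 2 → ∃ k : ℤ, Γ.coef d v = k) (h0 : ∃ k : ℤ, d n = k)
    (h1 : ∃ k : ℤ, d (Γ.firstVertex n x) = k) {i : ℕ} (hi : i ≤ (Γ.pathWalk n x).length) :
    ∃ k : ℤ, d ((Γ.pathWalk n x).getVert i) = k := by
  induction i using Nat.strong_induction_on with
  | _ i ih =>
    rcases i with _ | _ | i
    · simpa using h0
    · exact h1
    · obtain ⟨k0, hk0⟩ := ih i (by omega) (by omega)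
      obtain ⟨k1, hk1⟩ := ih (i + 1) (by omega) (by omega)
      obtain ⟨k2, hk2⟩ := hd _ (h.degree_getVert (i := i + 1) (by omega) (by omega))
      have e := h.coef_getVert d (i := i + 1) (by omega) (by omega)
      rw [Nat.add_sub_cancel, hk0, hk1, hk2] at e
      refine ⟨-Γ.euler ((Γ.pathWalk n x).getVert (i + 1)) * k1 - k0 - k2, ?_⟩
      push_cast
      linear_combination e

variable [PartialOrder Γ.Node]

/-! ### Coordinates of lifts -/

/-- The part of the `E_v^*`-coordinate of a lift that comes from the chains. -/
def LiftCoeffs.chainPart (a : Γ.LiftCoeffs) (v : V) : ℤ :=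
  ∑ n, ∑ n' ∈ (Γ.nodesAt n).filter (fun n' => n < n'),
    if Γ.firstVertex n n' = v then a.chain n n' else 0

theorem LiftCoeffs.coe_toDual (a : Γ.LiftCoeffs) : (a.toDual : V → ℝ) =
    ∑ n : Γ.Node, (a.node n : ℝ) • Γ.dualVec n + ∑ u : Γ.EndVertex, (a.leaf u : ℝ) • Γ.dualVec u +
    ∑ n, ∑ n' ∈ (Γ.nodesAt n).filter (fun n' => n < n'),
      (a.chain n n' : ℝ) • Γ.dualVec (Γ.firstVertex n n') := by
  simp only [LiftCoeffs.toDual, AddSubgroup.coe_add, AddSubgroup.val_finsetSum,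
    AddSubgroup.coe_zsmul, dualGen, Int.cast_smul_eq_zsmul]

theorem LiftCoeffs.coef_toDual (a : Γ.LiftCoeffs) (v : V) : Γ.coef a.toDual v =
    (∑ n : Γ.Node, if n.1 = v then (a.node n : ℝ) else 0) +
      (∑ u : Γ.EndVertex, if u.1 = v then (a.leaf u : ℝ) else 0) + a.chainPart v := by
  simp only [LiftCoeffs.coe_toDual, map_add, map_sum, map_smul, Pi.add_apply, Finset.sum_apply,
    Pi.smul_apply, coef_dualVec, smul_eq_mul, mul_ite, mul_one, mul_zero, LiftCoeffs.chainPart]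
  push_cast
  rfl

theorem LiftCoeffs.chainPart_chain (a : Γ.LiftCoeffs) {n n' : Γ.Node} (h : n' ∈ Γ.nodesAt n)
    (hlt : n < n') {i : ℕ} (hi0 : 0 < i) (hil : i < (Γ.pathWalk n n').length) :
    a.chainPart ((Γ.pathWalk n n').getVert i) = if i = 1 then a.chain n n' else 0 := by
  have hr := mem_nodesAt.1 h
  have key : ∀ m m', m' ∈ Γ.nodesAt m → m < m' →
      Γ.firstVertex m m' = (Γ.pathWalk n n').getVert i → m = n ∧ m' = n' ∧ i = 1 := by
    intro m m' hm hmm e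
    rcases hr.firstVertex_eq_getVert_cases n.degree_ne_two n'.degree_ne_two hm hi0 hil e with
      ⟨h1, h2, h3⟩ | ⟨h1, h2, -⟩
    · exact ⟨Subtype.ext h1, Subtype.ext h2, h3⟩
    · rw [Subtype.ext h1, Subtype.ext h2] at hmm
      exact absurd hmm hlt.asymm
  rw [LiftCoeffs.chainPart, Finset.sum_eq_single n, Finset.sum_eq_single n']
  · split_ifs with h1 h2 h2
    · rfl
    · exact absurd (key _ _ h hlt h1).2.2 h2
    · subst h2; exact absurd rfl h1
    · rfl
  · intro m' hm' hne
    rw [Finset.mem_filter] at hm'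
    exact if_neg fun e => hne (key _ _ hm'.1 hm'.2 e).2.1
  · intro h0
    exact absurd (Finset.mem_filter.2 ⟨h, hlt⟩) h0
  · intro m _ hne
    refine Finset.sum_eq_zero fun m' hm' => ?_
    rw [Finset.mem_filter] at hm'
    exact if_neg fun e => hne (key _ _ hm'.1 hm'.2 e).1
  · simp

theorem LiftCoeffs.chainPart_chain_symm (a : Γ.LiftCoeffs) {n n' : Γ.Node}
    (h : n' ∈ Γ.nodesAt n) (hlt : n' < n) {i : ℕ} (hi0 : 0 < i)
    (hil : i < (Γ.pathWalk n n').length) :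
    a.chainPart ((Γ.pathWalk n n').getVert i) =
      if i + 1 = (Γ.pathWalk n n').length then a.chain n' n else 0 := by
  have hl := Γ.length_pathWalk_comm n n'
  have := a.chainPart_chain (mem_nodesAt_comm.1 h) hlt (i := (Γ.pathWalk n' n).length - i)
    (by omega) (by omega)
  rw [getVert_pathWalk_comm, this]
  congr 1
  rw [eq_iff_iff]
  omega

theorem LiftCoeffs.chainPart_leg (a : Γ.LiftCoeffs) {n : Γ.Node} {u : Γ.EndVertex}
    (h : u ∈ Γ.endsAt n) {i : ℕ} (hi0 : 0 < i) (hil : i ≤ (Γ.pathWalk n u).length) :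
    a.chainPart ((Γ.pathWalk n u).getVert i) = 0 := by
  have hr := mem_endsAt.1 h
  refine Finset.sum_eq_zero fun m _ => Finset.sum_eq_zero fun m' hm' => if_neg fun e => ?_
  rw [Finset.mem_filter] at hm'
  have hu := u.2
  rcases hil.lt_or_eq with hlt | rfl
  · rcases hr.firstVertex_eq_getVert_cases n.degree_ne_two u.degree_ne_two hm'.1 hi0 hlt e with
      ⟨-, h2, -⟩ | ⟨h1, -, -⟩
    · have := m'.2
      rw [h2] at this
      omega
    · have := m.2
      rw [h1] at this
      omega
  · rw [SimpleGraph.Walk.getVert_length] at e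
    rcases firstVertex_cases hm'.1 with h1 | h1
    · have := m'.2
      rw [← h1.1, e] at this
      omega
    · rw [e] at h1
      omega

theorem LiftCoeffs.chainPart_end (a : Γ.LiftCoeffs) [Nonempty Γ.Node] (u : Γ.EndVertex) :
    a.chainPart u = 0 := by
  obtain ⟨n, hn, -⟩ := u.existsUnique_node
  have := a.chainPart_leg hn (mem_endsAt.1 hn).length_pos le_rfl
  rwa [SimpleGraph.Walk.getVert_length] at this

/-- A node receives chain coefficients only from empty chains: if `n' < n` are adjacent, the vertex
next to `n'` on the way to `n` is `n` itself. -/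
theorem LiftCoeffs.chainPart_node (a : Γ.LiftCoeffs) (n : Γ.Node) :
    a.chainPart n = ∑ n' ∈ (Γ.nodesAt n).filter (fun n' => n' < n),
      if Γ.graph.Adj n n' then a.chain n' n else 0 := by
  have e : ∀ m, ∑ m' ∈ (Γ.nodesAt m).filter (fun m' => m < m'),
      (if Γ.firstVertex m m' = n then a.chain m m' else 0) =
      if m ∈ (Γ.nodesAt n).filter (fun n' => n' < n) then
        if Γ.graph.Adj n m then a.chain m n else 0 else 0 := by
    intro m
    have key : ∀ m' ∈ (Γ.nodesAt m).filter (fun m' => m < m'), Γ.firstVertex m m' = n →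
        m' = n ∧ Γ.graph.Adj n m := by
      intro m' hm' e
      rcases firstVertex_cases (Finset.mem_filter.1 hm').1 with h1 | h1
      · have : m' = n := Subtype.ext (h1.1.symm.trans e)
        exact ⟨this, by rw [← this]; exact h1.2.symm⟩
      · rw [e] at h1
        exact absurd h1 n.degree_ne_two
    have hiff : m ∈ (Γ.nodesAt n).filter (fun n' => n' < n) ↔
        n ∈ (Γ.nodesAt m).filter (fun m' => m < m') := by
      simp only [Finset.mem_filter, mem_nodesAt_comm (n := n)]
    simp only [hiff]
    split_ifs with hmem hadj
    · rw [Finset.sum_eq_single n (fun m' hm' hne => if_neg fun e => hne (key m' hm' e).1)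
        (fun h0 => absurd hmem h0), if_pos (firstVertex_of_adj hadj.symm)]
    · exact Finset.sum_eq_zero fun m' hm' => if_neg fun e => hadj (key m' hm' e).2
    · exact Finset.sum_eq_zero fun m' hm' => if_neg fun e => hmem ((key m' hm' e).1 ▸ hm')
  rw [LiftCoeffs.chainPart, Finset.sum_congr rfl fun m _ => e m, Finset.sum_ite_mem,
    Finset.univ_inter]

/-! ### Relations for vectors whose coordinates at vertices of degree two come from a lift -/

section Relations

variable {a : Γ.LiftCoeffs} {d : V → ℝ} {c : ℝ}

/-- Only the vertex next to the smaller node carries a coefficient; seen from that node its weight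
is `ω`. The scalar `c` allows three uses: `c = 1` for the lift, `c = 0` for vectors supported at
nodes and ends, `c = -1` for their difference. -/
theorem sum_chain_coef_of_lt
    (hd : ∀ v, Γ.graph.degree v = 2 → Γ.coef d v = c * a.chainPart v)
    {n n' : Γ.Node} (h : n' ∈ Γ.nodesAt n) (hlt : n < n') :
    ∑ j ∈ Finset.Ioo 0 (Γ.pathWalk n n').length,
        (Γ.stringDet n n' j (Γ.pathWalk n n').length : ℝ) *
          Γ.coef d ((Γ.pathWalk n n').getVert j) = Γ.omegaChain n n' * (c * a.chain n n') := by
  have hr := mem_nodesAt.1 h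
  have e : ∀ j ∈ Finset.Ioo 0 (Γ.pathWalk n n').length,
      (Γ.stringDet n n' j (Γ.pathWalk n n').length : ℝ) *
          Γ.coef d ((Γ.pathWalk n n').getVert j) =
        if j = 1 then (Γ.stringDet n n' 1 (Γ.pathWalk n n').length : ℝ) * (c * a.chain n n')
        else 0 := by
    intro j hj
    rw [Finset.mem_Ioo] at hj
    rw [hd _ (hr.degree_getVert hj.1 hj.2), a.chainPart_chain h hlt hj.1 hj.2]
    split_ifs with h1
    · rw [h1]
    · simp
  rw [Finset.sum_congr rfl e, Finset.sum_ite_eq', omegaChain_eq hr]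
  have := hr.length_pos
  by_cases h1 : (Γ.pathWalk n n').length = 1
  · simp [h1]
  · rw [if_neg h1, if_pos (Finset.mem_Ioo.2 ⟨by omega, by omega⟩)]

/-- Seen from the larger node, the only coefficient sits at the last interior vertex, with weight
the empty determinant 1. For adjacent nodes there is no interior vertex and the sum is 0. -/
theorem sum_chain_coef_of_gt
    (hd : ∀ v, Γ.graph.degree v = 2 → Γ.coef d v = c * a.chainPart v)
    {n n' : Γ.Node} (h : n' ∈ Γ.nodesAt n) (hlt : n' < n) :
    ∑ j ∈ Finset.Ioo 0 (Γ.pathWalk n n').length,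
        (Γ.stringDet n n' j (Γ.pathWalk n n').length : ℝ) *
          Γ.coef d ((Γ.pathWalk n n').getVert j) =
      c * if Γ.graph.Adj n n' then 0 else (a.chain n' n : ℝ) := by
  have hr := mem_nodesAt.1 h
  have hl := hr.length_pos
  have e : ∀ j ∈ Finset.Ioo 0 (Γ.pathWalk n n').length,
      (Γ.stringDet n n' j (Γ.pathWalk n n').length : ℝ) *
          Γ.coef d ((Γ.pathWalk n n').getVert j) =
        if j = (Γ.pathWalk n n').length - 1 then c * (a.chain n' n : ℝ) else 0 := by
    intro j hj
    rw [Finset.mem_Ioo] at hj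
    rw [hd _ (hr.degree_getVert hj.1 hj.2), a.chainPart_chain_symm h hlt hj.1 hj.2]
    by_cases h1 : j + 1 = (Γ.pathWalk n n').length
    · rw [if_pos h1, if_pos (by omega), ← h1, stringDet_self]
      simp
    · rw [if_neg h1, if_neg (by omega)]
      simp
  rw [Finset.sum_congr rfl e, Finset.sum_ite_eq', ← hr.length_eq_one_iff]
  by_cases h1 : (Γ.pathWalk n n').length = 1
  · simp [h1]
  · rw [if_neg h1, if_pos (Finset.mem_Ioo.2 ⟨by omega, by omega⟩)]

theorem sum_leg_coef
    (hd : ∀ v, Γ.graph.degree v = 2 → Γ.coef d v = c * a.chainPart v)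
    {n : Γ.Node} {u : Γ.EndVertex} (h : u ∈ Γ.endsAt n) :
    ∑ j ∈ Finset.Ioc 0 (Γ.pathWalk n u).length,
        (Γ.stringDet n u j ((Γ.pathWalk n u).length + 1) : ℝ) *
          Γ.coef d ((Γ.pathWalk n u).getVert j) = Γ.coef d u := by
  have hr := mem_endsAt.1 h
  have hl := hr.length_pos
  rw [Finset.sum_eq_single (Γ.pathWalk n u).length]
  · rw [stringDet_self, SimpleGraph.Walk.getVert_length]
    simp
  · intro j hj hne
    rw [Finset.mem_Ioc] at hj
    rw [hd _ (hr.degree_getVert hj.1 (by omega)), a.chainPart_leg h hj.1 hj.2]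
    simp
  · intro h0
    exact absurd (Finset.mem_Ioc.2 ⟨hl, le_rfl⟩) h0

end Relations

theorem sum_nodesAt_eq (hord : ∀ n, ∀ n' ∈ Γ.nodesAt n, n < n' ∨ n' < n) (n : Γ.Node)
    (f : Γ.Node → ℝ) : ∑ n' ∈ Γ.nodesAt n, f n' =
      ∑ n' ∈ (Γ.nodesAt n).filter (fun n' => n < n'), f n' +
      ∑ n' ∈ (Γ.nodesAt n).filter (fun n' => n' < n), f n' := by
  rw [← Finset.sum_filter_add_sum_filter_not (Γ.nodesAt n) (fun n' => n < n')]
  congr 2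
  ext n'
  simp only [Finset.mem_filter]
  refine and_congr_right fun h => ⟨fun h1 => (hord n n' h).resolve_left h1, fun h1 => h1.asymm⟩

/-- The constant term of `Λ_n` on a lift, except for the node coordinate of the vector. -/
theorem orbForm_proj_of_chainPart (hord : ∀ n, ∀ n' ∈ Γ.nodesAt n, n < n' ∨ n' < n)
    {a : Γ.LiftCoeffs} {d : V → ℝ} {c : ℝ}
    (hd : ∀ v, Γ.graph.degree v = 2 → Γ.coef d v = c * a.chainPart v) (n : Γ.Node) :
    Γ.orbForm (Γ.proj d) n = Γ.coef d n - c * a.chainPart n +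
      c * (∑ n' ∈ (Γ.nodesAt n).filter (fun n' => n < n'),
        (Γ.omegaChain n n' : ℝ) / Γ.alphaChain n n' * a.chain n n' +
      ∑ n' ∈ (Γ.nodesAt n).filter (fun n' => n' < n),
        1 / (Γ.alphaChain n n' : ℝ) * a.chain n' n) +
      ∑ u ∈ Γ.endsAt n, Γ.coef d u / Γ.alphaEnd n u := by
  rw [orbForm_proj, sum_nodesAt_eq hord, a.chainPart_node, Finset.sum_congr rfl fun u hu =>
    congrArg (· / (Γ.alphaEnd n u : ℝ)) (sum_leg_coef hd hu)]
  have e1 : ∀ n' ∈ (Γ.nodesAt n).filter (fun n' => n < n'),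
      (∑ j ∈ Finset.Ioo 0 (Γ.pathWalk n n').length,
        (Γ.stringDet n n' j (Γ.pathWalk n n').length : ℝ) *
          Γ.coef d ((Γ.pathWalk n n').getVert j)) / Γ.alphaChain n n' =
      c * ((Γ.omegaChain n n' : ℝ) / Γ.alphaChain n n' * a.chain n n') := by
    intro n' hn'
    rw [Finset.mem_filter] at hn'
    rw [sum_chain_coef_of_lt hd hn'.1 hn'.2]
    ring
  -- The subtracted term is nonzero only for adjacent nodes, where the coefficient sits at `n`
  -- itself; these terms add up to the chain part at `n`.
  have e2 : ∀ n' ∈ (Γ.nodesAt n).filter (fun n' => n' < n),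
      (∑ j ∈ Finset.Ioo 0 (Γ.pathWalk n n').length,
        (Γ.stringDet n n' j (Γ.pathWalk n n').length : ℝ) *
          Γ.coef d ((Γ.pathWalk n n').getVert j)) / Γ.alphaChain n n' =
      c * (1 / (Γ.alphaChain n n' : ℝ) * a.chain n' n) -
        c * ((if Γ.graph.Adj n n' then a.chain n' n else 0 : ℤ) : ℝ) := by
    intro n' hn'
    rw [Finset.mem_filter] at hn'
    rw [sum_chain_coef_of_gt hd hn'.1 hn'.2]
    split_ifs with hadj
    · rw [alphaChain_of_adj hn'.1 hadj]; simp
    · push_cast; ring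
  rw [Finset.sum_congr rfl e1, Finset.sum_congr rfl e2, Finset.sum_sub_distrib, ← Finset.mul_sum,
    ← Finset.mul_sum, ← Finset.mul_sum]
  push_cast
  ring

theorem LiftCoeffs.coef_toDual_node (a : Γ.LiftCoeffs) (n : Γ.Node) :
    Γ.coef a.toDual n = a.node n + a.chainPart n := by
  have h : ∀ u : Γ.EndVertex, u.1 ≠ n.1 := by
    intro u e
    have h1 := u.2
    have h2 := n.2
    rw [e] at h1
    omega
  rw [LiftCoeffs.coef_toDual]
  simp [← Subtype.ext_iff, h]

theorem LiftCoeffs.coef_toDual_end (a : Γ.LiftCoeffs) [Nonempty Γ.Node] (u : Γ.EndVertex) :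
    Γ.coef a.toDual u = a.leaf u := by
  have h : ∀ n : Γ.Node, n.1 ≠ u.1 := by
    intro n e
    have h1 := u.2
    have h2 := n.2
    rw [e] at h2
    omega
  rw [LiftCoeffs.coef_toDual, chainPart_end]
  simp [← Subtype.ext_iff, h]

theorem LiftCoeffs.coef_toDual_of_degree_eq_two (a : Γ.LiftCoeffs) {v : V}
    (hv : Γ.graph.degree v = 2) : Γ.coef a.toDual v = a.chainPart v := by
  have h : ∀ n : Γ.Node, n.1 ≠ v := by
    rintro n rfl
    exact n.degree_ne_two hv
  have h' : ∀ n : Γ.EndVertex, n.1 ≠ v := by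
    rintro n rfl
    exact n.degree_ne_two hv
  rw [LiftCoeffs.coef_toDual]
  simp [h, h']

/-- `N̄_a(ℓ, n) = Λ_n(ℓ + 𝐜_a)`. -/
theorem quasiBar_eq_orbForm [Nonempty Γ.Node]
    (hord : ∀ n, ∀ n' ∈ Γ.nodesAt n, n < n' ∨ n' < n)
    (a : Γ.LiftCoeffs) (l : Γ.Node → ℤ) (n : Γ.Node) :
    quasiBar a l n = Γ.orbForm (fun i => a.center i + l i) n := by
  have h1 : (fun i => a.center i + (l i : ℝ)) = Γ.proj a.toDual + fun i => (l i : ℝ) := rfl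
  rw [h1, map_add, Pi.add_apply, orbForm_proj_of_chainPart hord (a := a) (c := 1)
    (fun v hv => by rw [a.coef_toDual_of_degree_eq_two hv, one_mul]), a.coef_toDual_node,
    orbForm_apply, quasiBar, quasi]
  simp only [a.coef_toDual_end]
  have h2 : ∑ u ∈ Γ.endsAt n, (⌊((a.leaf u : ℝ) - Γ.omegaEnd n u * l n) / Γ.alphaEnd n u⌋ : ℝ) +
      ∑ u ∈ Γ.endsAt n, Int.fract (((a.leaf u : ℝ) - Γ.omegaEnd n u * l n) / Γ.alphaEnd n u) =
      ∑ u ∈ Γ.endsAt n, (a.leaf u : ℝ) / Γ.alphaEnd n u -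
        (∑ u ∈ Γ.endsAt n, (Γ.omegaEnd n u : ℝ) / Γ.alphaEnd n u) * l n := by
    rw [← Finset.sum_add_distrib, Finset.sum_mul, ← Finset.sum_sub_distrib]
    refine Finset.sum_congr rfl fun u _ => ?_
    rw [Int.floor_add_fract]
    ring
  linear_combination h2

/-! ### Integrality -/

/-- For adjacent nodes `α = 1` and the congruence is void, so the chain coefficient can be replaced
by 0. The condition then has the shape of the chain relation seen from the larger node. -/
theorem mem_affineLattice_iff_dvd {a : Γ.LiftCoeffs} {l : Γ.Node → ℤ} :
    l ∈ affineLattice a ↔ ∀ n, ∀ n' ∈ Γ.nodesAt n, n < n' →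
      Γ.alphaChain n' n ∣ Γ.omegaChain n' n * l n' + l n -
        if Γ.graph.Adj n n' then 0 else a.chain n n' := by
  refine forall_congr' fun n => forall_congr' fun n' => forall_congr' fun h =>
    forall_congr' fun _ => ?_
  rw [Int.modEq_comm, Int.modEq_iff_dvd, alphaChain_comm n' n]
  split_ifs with hadj
  · rw [alphaChain_of_adj h hadj]
    simp
  · rw [add_comm (l n)]

section Integrality

variable {a : Γ.LiftCoeffs} {d : V → ℝ}

theorem chain_relation_of_chainPart
    (hd : ∀ v, Γ.graph.degree v = 2 → Γ.coef d v = (-1) * a.chainPart v)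
    {n n' : Γ.Node} (h : n' ∈ Γ.nodesAt n) (hlt : n < n') :
    (Γ.alphaChain n' n : ℝ) * d (Γ.firstVertex n' n) = Γ.omegaChain n' n * d n' + d n -
      if Γ.graph.Adj n n' then 0 else (a.chain n n' : ℝ) := by
  have h' := mem_nodesAt_comm.1 h
  rw [chain_relation h', sum_chain_coef_of_gt hd h' hlt, Γ.graph.adj_comm]
  ring

theorem leg_relation_of_chainPart
    (hd : ∀ v, Γ.graph.degree v = 2 → Γ.coef d v = (-1) * a.chainPart v)
    {n : Γ.Node} {u : Γ.EndVertex} (h : u ∈ Γ.endsAt n) :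
    (Γ.alphaEnd n u : ℝ) * d (Γ.firstVertex n u) = Γ.omegaEnd n u * d n + Γ.coef d u := by
  rw [leg_relation h, sum_leg_coef hd h]

/-- Once the node coordinates are integers, all others follow by recursion from the first coordinate
on each leg and chain, and the leg and chain relations make integrality of that coordinate a
divisibility by `α`. Chains are traversed from the larger node, where the prescribed coefficient
enters with weight 1. -/
theorem integral_iff [Nonempty Γ.Node] (hord : ∀ n, ∀ n' ∈ Γ.nodesAt n, n < n' ∨ n' < n)
    (hd : ∀ v, Γ.graph.degree v = 2 → Γ.coef d v = (-1) * a.chainPart v)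
    {l : Γ.Node → ℤ} (hl : ∀ n : Γ.Node, d n = l n)
    {y : Γ.EndVertex → ℤ} (hy : ∀ u : Γ.EndVertex, Γ.coef d u = y u) :
    d ∈ lattice (V := V) ↔ l ∈ affineLattice a ∧
      ∀ n, ∀ u ∈ Γ.endsAt n, Γ.alphaEnd n u ∣ Γ.omegaEnd n u * l n + y u := by
  rw [mem_affineLattice_iff_dvd]
  constructor
  · intro h
    refine ⟨fun n n' hn' hlt => ?_, fun n u hu => ?_⟩
    · obtain ⟨k, hk⟩ := h (Γ.firstVertex n' n)
      have := chain_relation_of_chainPart hd hn' hlt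
      rw [hk, hl, hl] at this
      exact ⟨k, by exact_mod_cast this.symm⟩
    · obtain ⟨k, hk⟩ := h (Γ.firstVertex n u)
      have := leg_relation_of_chainPart hd hu
      rw [hk, hl, hy] at this
      exact ⟨k, by exact_mod_cast this.symm⟩
  · rintro ⟨h1, h2⟩ v
    have hd' : ∀ v, Γ.graph.degree v = 2 → ∃ k : ℤ, Γ.coef d v = k := fun v hv =>
      ⟨-a.chainPart v, by rw [hd v hv]; push_cast; ring⟩
    by_cases hv : 3 ≤ Γ.graph.degree v
    · exact ⟨_, hl ⟨v, hv⟩⟩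
    have hchain : ∀ n n' : Γ.Node, n' ∈ Γ.nodesAt n → n < n' → v ∈ Γ.path n n' →
        ∃ k : ℤ, d v = k := by
      intro n n' hn' hlt hmem
      rw [path_comm] at hmem
      obtain ⟨i, hi, rfl⟩ := mem_path_iff_getVert.1 hmem
      refine (mem_nodesAt.1 hn').symm.integral_getVert hd' ⟨_, hl n'⟩ ?_ hi
      obtain ⟨k, hk⟩ := h1 n n' hn' hlt
      refine ⟨k, ?_⟩
      have h0 : (Γ.alphaChain n' n : ℝ) ≠ 0 := by exact_mod_cast (alphaChain_pos n' n).ne'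
      apply mul_left_cancel₀ h0
      rw [chain_relation_of_chainPart hd hn' hlt, hl, hl]
      exact_mod_cast hk
    rcases exists_mem_path hv with ⟨n, n', hn', hmem⟩ | ⟨n, u, hu, hmem⟩
    · rcases hord n n' hn' with hlt | hlt
      · exact hchain n n' hn' hlt hmem
      · exact hchain n' n (mem_nodesAt_comm.1 hn') hlt (by rwa [path_comm])
    · obtain ⟨i, hi, rfl⟩ := mem_path_iff_getVert.1 hmem
      refine (mem_endsAt.1 hu).integral_getVert hd' ⟨_, hl n⟩ ?_ hi
      obtain ⟨k, hk⟩ := h2 n u hu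
      refine ⟨k, ?_⟩
      have h0 : (Γ.alphaEnd n u : ℝ) ≠ 0 := by exact_mod_cast (alphaEnd_pos n u).ne'
      apply mul_left_cancel₀ h0
      rw [leg_relation_of_chainPart hd hu, hl, hy]
      exact_mod_cast hk

end Integrality

end ResolutionGraph

/-! ### Multivariate geometric series -/

section Geometric

variable {ι κ R : Type*} [Fintype ι] [CommRing R]

/-- The monoid of exponents `∑_i m_i g_i`. -/
def latticePoint (g : ι → κ → ℝ) (m : ι → ℕ) : κ → ℝ := ∑ i, m i • g i

theorem latticePoint_monotone {g : ι → κ → ℝ} (hg : ∀ i, 0 < g i) :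
    Monotone (latticePoint g) := fun _ _ h =>
  Finset.sum_le_sum fun i _ => nsmul_le_nsmul_left (hg i).le (h i)

theorem latticePoint_finite {g : ι → κ → ℝ} (hg : ∀ i, 0 < g i) (l : κ → ℝ) :
    {m | latticePoint g m = l}.Finite := by
  have hpos : ∀ i, ∃ k, 0 < g i k := fun i => by
    obtain ⟨k, hk⟩ := (Pi.lt_def.1 (hg i)).2
    exact ⟨k, hk⟩
  choose k hk using hpos
  refine (Set.finite_Iic (fun i => ⌊l (k i) / g i (k i)⌋₊)).subset ?_
  rintro m rfl i
  apply Nat.le_floor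
  rw [le_div_iff₀ (hk i), latticePoint, Finset.sum_apply]
  have := Finset.single_le_sum (f := fun j => (m j • g j) (k i))
    (fun j _ => by
      simp only [Pi.smul_apply, nsmul_eq_mul]
      exact mul_nonneg (Nat.cast_nonneg _) ((hg j).le _)) (Finset.mem_univ i)
  simpa using this

/-- The expansion of `∏_{i ∈ s} (1 - r_i t^{g_i})⁻¹`. -/
def geomSeries (g : ι → κ → ℝ) (hg : ∀ i, 0 < g i) (r : ι → R) (s : Finset ι) :
    HahnSeries (κ → ℝ) R where
  coeff l := ∑ᶠ m ∈ {m : ι → ℕ | (∀ i ∉ s, m i = 0) ∧ latticePoint g m = l}, ∏ i, r i ^ m i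
  isPWO_support' := by
    -- By Dickson's lemma the exponents `m` are well-quasi-ordered, and monotone images keep this
    -- property.
    have h : (latticePoint g '' Set.univ).IsPWO :=
      (Set.isPWO_of_wellQuasiOrderedLE (Set.univ : Set (ι → ℕ))).image_of_monotone
        (latticePoint_monotone hg)
    refine h.mono fun l hl => ?_
    rw [Function.mem_support] at hl
    obtain ⟨m, hm, -⟩ := exists_ne_zero_of_finsum_mem_ne_zero hl
    exact ⟨m, Set.mem_univ _, hm.2⟩

theorem geomSeries_coeff (g : ι → κ → ℝ) (hg : ∀ i, 0 < g i) (r : ι → R) (s : Finset ι)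
    (l : κ → ℝ) : (geomSeries g hg r s).coeff l =
      ∑ᶠ m ∈ {m : ι → ℕ | (∀ i ∉ s, m i = 0) ∧ latticePoint g m = l}, ∏ i, r i ^ m i := rfl

theorem coeff_one_sub_single_mul (g : κ → ℝ) (r : R) (F : HahnSeries (κ → ℝ) R) (l : κ → ℝ) :
    ((1 - HahnSeries.single g r) * F).coeff l = F.coeff l - r * F.coeff (l - g) := by
  rw [sub_mul, one_mul, HahnSeries.coeff_sub]
  congr 1
  have := HahnSeries.coeff_single_mul_add (r := r) (x := F) (a := l - g) (b := g)
  rwa [sub_add_cancel] at this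

theorem geomSeries_empty (g : ι → κ → ℝ) (hg : ∀ i, 0 < g i) (r : ι → R) :
    geomSeries g hg r ∅ = 1 := by
  ext l
  rw [geomSeries_coeff, HahnSeries.coeff_one]
  have h : {m : ι → ℕ | (∀ i ∉ (∅ : Finset ι), m i = 0) ∧ latticePoint g m = l} =
      if l = 0 then {0} else ∅ := by
    ext m
    have h0 : latticePoint g 0 = 0 := by simp [latticePoint]
    split_ifs with hl
    · subst hl
      simp only [Finset.notMem_empty, not_false_eq_true, forall_true_left, Set.mem_ofPred_eq,
        Set.mem_singleton_iff]
      constructor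
      · rintro ⟨h1, -⟩; exact funext h1
      · rintro rfl; exact ⟨fun _ => rfl, h0⟩
    · simp only [Finset.notMem_empty, not_false_eq_true, forall_true_left, Set.mem_ofPred_eq,
        Set.mem_empty_iff_false, iff_false, not_and]
      intro h1 h2
      obtain rfl : m = 0 := funext h1
      exact hl (h2.symm.trans h0)
  rw [h]
  split_ifs
  · rw [finsum_mem_singleton]; simp
  · rw [finsum_mem_empty]

/-- Exponents with `m i ≥ 1` are the translates by `g i` of all exponents for `insert i s`; removing
them leaves those with `m i = 0`. -/
theorem one_sub_single_mul_geomSeries (g : ι → κ → ℝ) (hg : ∀ i, 0 < g i) (r : ι → R)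
    {s : Finset ι} {i : ι} (hi : i ∉ s) :
    (1 - HahnSeries.single (g i) (r i)) * geomSeries g hg r (insert i s) = geomSeries g hg r s := by
  ext l
  rw [coeff_one_sub_single_mul, sub_eq_iff_eq_add]
  simp only [geomSeries_coeff]
  set A := {m : ι → ℕ | (∀ j ∉ s, m j = 0) ∧ latticePoint g m = l}
  set B := {m : ι → ℕ | (∀ j ∉ insert i s, m j = 0) ∧ latticePoint g m = l - g i}
  have hA : A.Finite := (latticePoint_finite hg l).subset fun m hm => hm.2
  have hB : B.Finite := (latticePoint_finite hg (l - g i)).subset fun m hm => hm.2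
  have hlp : ∀ m, latticePoint g (m + Pi.single i 1) = latticePoint g m + g i := by
    intro m
    simp [latticePoint, add_smul, Finset.sum_add_distrib, Pi.single_apply, ite_smul]
  have hsplit : {m : ι → ℕ | (∀ j ∉ insert i s, m j = 0) ∧ latticePoint g m = l} =
      A ∪ (fun m => m + Pi.single i 1) '' B := by
    ext m
    constructor
    · rintro ⟨h1, h2⟩
      by_cases h0 : m i = 0
      · left
        refine ⟨fun j hj => ?_, h2⟩
        by_cases hji : j = i
        · rw [hji, h0]
        · exact h1 j (by simp [hji, hj])
      · right
        have e : (m - Pi.single i 1 : ι → ℕ) + Pi.single i 1 = m := by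
          ext j
          by_cases hji : j = i
          · subst hji; simp; omega
          · simp [hji]
        refine ⟨m - Pi.single i 1, ⟨fun j hj => ?_, ?_⟩, e⟩
        · simp [h1 j hj]
        · rw [eq_sub_iff_add_eq, ← hlp, e, h2]
    · rintro (⟨h1, h2⟩ | ⟨m, ⟨h1, h2⟩, rfl⟩)
      · exact ⟨fun j hj => h1 j fun h => hj (Finset.mem_insert_of_mem h), h2⟩
      · refine ⟨fun j hj => ?_, by rw [hlp, h2, sub_add_cancel]⟩
        have : j ≠ i := by rintro rfl; simp at hj
        simp [this, h1 j hj]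
  have hdisj : Disjoint A ((fun m => m + Pi.single i 1) '' B) := by
    rw [Set.disjoint_left]
    rintro _ h1 ⟨m, -, rfl⟩
    have := h1.1 i hi
    simp at this
  rw [hsplit, finsum_mem_union hdisj hA (hB.image _), mul_finsum_mem' _ _ hB,
    finsum_mem_image (fun m _ m' _ h => add_right_cancel h)]
  congr 1
  refine finsum_mem_congr rfl fun m _ => ?_
  simp only [Pi.add_apply, pow_add, Finset.prod_mul_distrib]
  rw [mul_comm]
  congr 1
  rw [Finset.prod_eq_single i] <;> simp +contextual

theorem prod_one_sub_single_mul_geomSeries (g : ι → κ → ℝ) (hg : ∀ i, 0 < g i) (r : ι → R)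
    (s : Finset ι) :
    (∏ i ∈ s, (1 - HahnSeries.single (g i) (r i))) * geomSeries g hg r s = 1 := by
  induction s using Finset.induction_on with
  | empty => rw [Finset.prod_empty, one_mul, geomSeries_empty]
  | insert i s hi ih =>
    rw [Finset.prod_insert hi, mul_comm (1 - _), mul_assoc, one_sub_single_mul_geomSeries _ _ _ hi,
      ih]

theorem isUnit_prod_one_sub_single (g : ι → κ → ℝ) (hg : ∀ i, 0 < g i) (r : ι → R)
    (s : Finset ι) : IsUnit (∏ i ∈ s, (1 - HahnSeries.single (g i) (r i))) :=
  IsUnit.of_mul_eq_one _ (prod_one_sub_single_mul_geomSeries g hg r s)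

theorem inverse_prod_one_sub_single (g : ι → κ → ℝ) (hg : ∀ i, 0 < g i) (r : ι → R)
    (s : Finset ι) : Ring.inverse (∏ i ∈ s, (1 - HahnSeries.single (g i) (r i))) =
      geomSeries g hg r s := by
  have h := isUnit_prod_one_sub_single g hg r s
  have h1 := prod_one_sub_single_mul_geomSeries g hg r s
  exact left_inv_eq_right_inv (Ring.inverse_mul_cancel _ h) h1

theorem isUnit_one_sub_single {g : κ → ℝ} (hg : 0 < g) (r : R) :
    IsUnit (1 - HahnSeries.single g r) := by
  have := isUnit_prod_one_sub_single (fun _ : Unit => g) (fun _ => hg) (fun _ => r) Finset.univ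
  simpa using this

end Geometric

/-! ### `Z_H` as node factors times the end series -/

namespace ResolutionGraph

variable {V : Type*} [Fintype V] {Γ : ResolutionGraph V}

theorem dualVec_lt (v : V) : 0 < Γ.dualVec v :=
  Pi.lt_def.2 ⟨fun w => (Γ.dualVec_pos v w).le, v, Γ.dualVec_pos v v⟩

variable (Γ) in
theorem isUnit_zetaFactor (v : V) : IsUnit (Γ.zetaFactor v) :=
  isUnit_one_sub_single (dualVec_lt v) _

variable (Γ) in
/-- The expansion of the product of the factors of `Z_H` at the ends. -/
def endSeries : HahnSeries (V → ℝ) (AddMonoidAlgebra ℤ Γ.H) :=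
  geomSeries (fun u : Γ.EndVertex => Γ.dualVec u) (fun u => dualVec_lt u.1)
    (fun u => AddMonoidAlgebra.single (Γ.cls (Γ.dualGen u)) 1) Finset.univ

/-- Vertices of degree two have exponent 0, and degree zero cannot occur because there is a node to
which every other vertex is joined. -/
theorem poincareH_eq [Nonempty Γ.Node] : Γ.poincareH =
    (∏ n : Γ.Node, Γ.zetaFactor n ^ (Γ.graph.degree n - 2)) * Γ.endSeries := by
  have hE : ∏ u : Γ.EndVertex, Ring.inverse (Γ.zetaFactor u) = Γ.endSeries := by
    refine left_inv_eq_right_inv (a := ∏ u : Γ.EndVertex, Γ.zetaFactor u) ?_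
      (prod_one_sub_single_mul_geomSeries _ _ _ _)
    rw [← Finset.prod_mul_distrib]
    exact Finset.prod_eq_one fun u _ => Ring.inverse_mul_cancel _ (Γ.isUnit_zetaFactor u)
  have hN : ∏ n : Γ.Node, Γ.zetaFactor n ^ (Γ.graph.degree n - 2) =
      ∏ v, if 3 ≤ Γ.graph.degree v then Γ.zetaFactor v ^ (Γ.graph.degree v - 2) else 1 := by
    rw [← Finset.prod_filter]
    exact (Finset.prod_subtype _ (p := fun v => 3 ≤ Γ.graph.degree v) (by simp)
      (fun v => Γ.zetaFactor v ^ (Γ.graph.degree v - 2))).symm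
  have hE' : ∏ u : Γ.EndVertex, Ring.inverse (Γ.zetaFactor u) =
      ∏ v, if Γ.graph.degree v = 1 then Ring.inverse (Γ.zetaFactor v) else 1 := by
    rw [← Finset.prod_filter]
    exact (Finset.prod_subtype _ (p := fun v => Γ.graph.degree v = 1) (by simp)
      (fun v => Ring.inverse (Γ.zetaFactor v))).symm
  rw [← hE, hN, hE', ← Finset.prod_mul_distrib, poincareH]
  refine Finset.prod_congr rfl fun v _ => ?_
  by_cases h3 : 3 ≤ Γ.graph.degree v
  · rw [if_pos (by omega), if_pos h3, if_neg (by omega), mul_one]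
  · obtain ⟨n, hn⟩ := exists_ray_to_node h3
    have h1 : 0 < Γ.graph.degree v :=
      (Γ.graph.degree_pos_iff_exists_adj v).2 ⟨_, hn.adj_firstVertex⟩
    rw [if_neg h3, one_mul]
    rcases (show Γ.graph.degree v = 1 ∨ Γ.graph.degree v = 2 by omega) with h | h
    · rw [h]; simp
    · rw [h]; simp

/-! ### Reduction of series to the node variables -/

/-- The series `F` has a well defined reduction. -/
def Reducible (F : HahnSeries (V → ℝ) (AddMonoidAlgebra ℤ Γ.H)) : Prop :=
  ∀ x : Γ.Node → ℝ, {l : V → ℝ | Γ.proj l = x ∧ F.coeff l ≠ 0}.Finite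

/-- The coefficient of `t_𝒩^x h` in the reduction of `F`. -/
def reduction (F : HahnSeries (V → ℝ) (AddMonoidAlgebra ℤ Γ.H)) (h : Γ.H) (x : Γ.Node → ℝ) : ℤ :=
  ∑ᶠ l ∈ {l : V → ℝ | Γ.proj l = x}, (F.coeff l).coeff h

theorem coeff_zetaFactor_mul (v : V) (F : HahnSeries (V → ℝ) (AddMonoidAlgebra ℤ Γ.H))
    (l : V → ℝ) : (Γ.zetaFactor v * F).coeff l = F.coeff l -
      AddMonoidAlgebra.single (Γ.cls (Γ.dualGen v)) 1 * F.coeff (l - Γ.dualVec v) :=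
  coeff_one_sub_single_mul _ _ _ _

theorem proj_sub (l m : V → ℝ) : Γ.proj (l - m) = Γ.proj l - Γ.proj m := rfl

theorem Reducible.zetaFactor_mul {F : HahnSeries (V → ℝ) (AddMonoidAlgebra ℤ Γ.H)}
    (hF : Reducible F) (v : V) : Reducible (Γ.zetaFactor v * F) := by
  intro x
  refine ((hF x).union ((hF (x - Γ.proj (Γ.dualVec v))).image (· + Γ.dualVec v))).subset ?_
  rintro l ⟨hl, hne⟩
  by_cases h0 : F.coeff l = 0
  · right
    refine ⟨l - Γ.dualVec v, ⟨by rw [proj_sub, hl], fun h1 => hne ?_⟩, by simp⟩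
    rw [coeff_zetaFactor_mul, h0, h1, mul_zero, sub_zero]
  · exact Or.inl ⟨hl, h0⟩

theorem reduction_zetaFactor_mul {F : HahnSeries (V → ℝ) (AddMonoidAlgebra ℤ Γ.H)}
    (hF : Reducible F) (v : V) (h : Γ.H) (x : Γ.Node → ℝ) :
    reduction (Γ.zetaFactor v * F) h x = reduction F h x -
      reduction F (h - Γ.cls (Γ.dualGen v)) (x - Γ.proj (Γ.dualVec v)) := by
  have e : ∀ l, ((Γ.zetaFactor v * F).coeff l).coeff h = (F.coeff l).coeff h -
      (F.coeff (l - Γ.dualVec v)).coeff (h - Γ.cls (Γ.dualGen v)) := by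
    intro l
    rw [coeff_zetaFactor_mul, AddMonoidAlgebra.coeff_sub, Finsupp.sub_apply]
    rw [AddMonoidAlgebra.coeff_single_mul_apply, one_mul, neg_add_eq_sub]
  have e2 : ∑ᶠ l ∈ {l : V → ℝ | Γ.proj l = x},
      (F.coeff (l - Γ.dualVec v)).coeff (h - Γ.cls (Γ.dualGen v)) =
      reduction F (h - Γ.cls (Γ.dualGen v)) (x - Γ.proj (Γ.dualVec v)) := by
    refine finsum_mem_eq_of_bijOn (fun l => l - Γ.dualVec v) ⟨?_, ?_, ?_⟩ fun _ _ => rfl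
    · rintro l hl
      rw [Set.mem_ofPred_eq] at hl ⊢
      rw [proj_sub, hl]
    · intro l _ l' _ hll
      exact sub_left_injective hll
    · intro l hl
      rw [Set.mem_ofPred_eq] at hl
      refine ⟨l + Γ.dualVec v, ?_, by simp⟩
      exact (eq_sub_iff_add_eq.1 hl)
  rw [← e2, eq_sub_iff_add_eq, reduction, reduction, ← finsum_mem_add_distrib']
  · exact finsum_mem_congr rfl fun l _ => by rw [e, sub_add_cancel]
  · refine (hF.zetaFactor_mul v x).subset ?_
    rintro l ⟨hl, hne⟩
    refine ⟨hl, fun h0 => hne ?_⟩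
    simp only [h0]
    rfl
  · refine ((hF (x - Γ.proj (Γ.dualVec v))).image (· + Γ.dualVec v)).subset ?_
    rintro l ⟨hl, hne⟩
    rw [Set.mem_ofPred_eq] at hl
    refine ⟨l - Γ.dualVec v, ⟨by rw [proj_sub, hl], fun h0 => hne ?_⟩, by simp⟩
    simp only [h0]
    rfl

/-- The exponent `∑_u m_u E_u^*`. -/
def endVec (m : Γ.EndVertex → ℕ) : V → ℝ := latticePoint (fun u : Γ.EndVertex => Γ.dualVec u) m

/-- All coordinates of `E_u^*` are positive and there is a node, so the projected exponents are
still positive and each value is attained finitely often. -/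
theorem finite_proj_endVec [Nonempty Γ.Node] (x : Γ.Node → ℝ) :
    {m : Γ.EndVertex → ℕ | Γ.proj (endVec m) = x}.Finite := by
  have h := latticePoint_finite (g := fun u : Γ.EndVertex => Γ.proj (Γ.dualVec u))
    (fun u => Pi.lt_def.2 ⟨fun n => (Γ.dualVec_pos u n).le,
      ⟨Classical.arbitrary _, Γ.dualVec_pos u _⟩⟩) x
  refine h.subset fun m hm => ?_
  rw [Set.mem_ofPred_eq] at hm ⊢
  rw [← hm]
  ext n
  simp [latticePoint, endVec, proj]

theorem coeff_endSeries (l : V → ℝ) (h : Γ.H) {M : Finset (Γ.EndVertex → ℕ)}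
    (hM : ∀ m, endVec m = l → m ∈ M) : (Γ.endSeries.coeff l).coeff h =
      ∑ m ∈ M with endVec m = l, if ∑ u, m u • Γ.cls (Γ.dualGen u) = h then 1 else 0 := by
  have hs : {m : Γ.EndVertex → ℕ | (∀ i ∉ Finset.univ, m i = 0) ∧
      latticePoint (fun u : Γ.EndVertex => Γ.dualVec u) m = l} =
      (M.filter (fun m => endVec m = l) : Set _) := by
    ext m
    simp only [Finset.mem_univ, not_true_eq_false, false_imp_iff, implies_true, true_and,
      Set.mem_ofPred_eq, Finset.coe_filter]
    exact ⟨fun h => ⟨hM m h, h⟩, fun h => h.2⟩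
  rw [endSeries, geomSeries_coeff, hs, finsum_mem_coe_finset, AddMonoidAlgebra.coeff_sum,
    Finsupp.finsetSum_apply]
  refine Finset.sum_congr rfl fun m _ => ?_
  simp only [AddMonoidAlgebra.single_pow, one_pow, AddMonoidAlgebra.prod_single, Finset.prod_const_one,
    AddMonoidAlgebra.coeff_single, Finsupp.single_apply]

theorem reducible_endSeries [Nonempty Γ.Node] : Reducible Γ.endSeries := by
  intro x
  refine ((finite_proj_endVec x).image endVec).subset ?_
  rintro l ⟨hl, hne⟩
  obtain ⟨m, hm, -⟩ := exists_ne_zero_of_finsum_mem_ne_zero hne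
  exact ⟨m, by rw [Set.mem_ofPred_eq, ← hl]; exact congrArg _ hm.2, hm.2⟩

theorem reduction_endSeries [Nonempty Γ.Node] (h : Γ.H) (x : Γ.Node → ℝ) :
    reduction Γ.endSeries h x = ({m : Γ.EndVertex → ℕ | Γ.proj (endVec m) = x ∧
      ∑ u, m u • Γ.cls (Γ.dualGen u) = h}.ncard : ℤ) := by
  set M := (finite_proj_endVec (Γ := Γ) x).toFinset with hM
  have hmem : ∀ m, m ∈ M ↔ Γ.proj (endVec m) = x := fun m => by simp [hM]
  have e : ∀ l ∈ {l : V → ℝ | Γ.proj l = x}, (Γ.endSeries.coeff l).coeff h =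
      ∑ m ∈ M with endVec m = l, if ∑ u, m u • Γ.cls (Γ.dualGen u) = h then (1 : ℤ) else 0 := by
    intro l hl
    apply coeff_endSeries
    rintro m rfl
    exact (hmem m).2 hl
  rw [reduction, finsum_mem_congr rfl e, finsum_mem_eq_sum_of_inter_support_eq
    (t := M.image endVec)]
  · rw [Finset.sum_fiberwise_of_maps_to (fun m hm => Finset.mem_image_of_mem _ hm),
      ← Finset.sum_filter, Finset.sum_const, nsmul_one]
    norm_cast
    rw [← Set.ncard_coe_finset]
    congr 1
    ext m
    simp [hmem]
  · ext l
    simp only [Set.mem_inter_iff, Finset.coe_image, Set.mem_image, Finset.mem_coe, Set.mem_ofPred_eq]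
    refine and_congr_left fun hl => ⟨fun _ => ?_, ?_⟩
    · obtain ⟨m, hm, -⟩ := Finset.exists_ne_zero_of_sum_ne_zero hl
      rw [Finset.mem_filter] at hm
      exact ⟨m, hm⟩
    · rintro ⟨m, hm, rfl⟩
      exact (hmem m).1 hm

end ResolutionGraph

/-! ### Coefficients of power series at integers -/

/-- The coefficient of `φ` at an integer exponent. -/
def coeffZ (φ : PowerSeries ℤ) (N : ℤ) : ℤ := if N < 0 then 0 else PowerSeries.coeff N.toNat φ

theorem coeffZ_of_neg (φ : PowerSeries ℤ) {N : ℤ} (h : N < 0) : coeffZ φ N = 0 := if_pos h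

theorem coeffZ_natCast (φ : PowerSeries ℤ) (N : ℕ) : coeffZ φ N = PowerSeries.coeff N φ := by
  rw [coeffZ, if_neg (by omega), Int.toNat_natCast]

/-- Extension by zero to negative exponents makes the recursion valid at `N = 0` as well, so no case
distinction is needed when a lift is shifted. -/
theorem coeffZ_one_sub_X_mul (φ : PowerSeries ℤ) (N : ℤ) :
    coeffZ ((1 - PowerSeries.X) * φ) N = coeffZ φ N - coeffZ φ (N - 1) := by
  rcases lt_or_ge N 0 with h | h
  · rw [coeffZ_of_neg _ h, coeffZ_of_neg _ h, coeffZ_of_neg _ (by omega), sub_zero]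
  · obtain ⟨k, rfl⟩ := Int.eq_ofNat_of_zero_le h
    rcases k with _ | k
    · rw [coeffZ_of_neg (N := ((0 : ℕ) : ℤ) - 1) _ (by omega), coeffZ_natCast, coeffZ_natCast, sub_mul,
        one_mul, map_sub, PowerSeries.coeff_zero_X_mul]
    · rw [show ((k + 1 : ℕ) : ℤ) - 1 = (k : ℕ) by push_cast; ring, coeffZ_natCast, coeffZ_natCast,
        coeffZ_natCast, sub_mul, one_mul, map_sub, PowerSeries.coeff_succ_X_mul]

theorem coeff_mk_one_pow_card (ι : Type*) [Fintype ι] (N : ℕ) :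
    PowerSeries.coeff N ((PowerSeries.mk 1 : PowerSeries ℤ) ^ Fintype.card ι) =
      (Nat.card {f : ι → ℕ // ∑ i, f i = N} : ℤ) := by
  have h := PowerSeries.coeff_prod (fun _ : ι => (PowerSeries.mk 1 : PowerSeries ℤ)) N Finset.univ
  rw [Finset.prod_const, Finset.card_univ] at h
  rw [h]
  simp only [PowerSeries.coeff_mk, Pi.one_apply, Finset.prod_const_one, Finset.sum_const,
    nsmul_one]
  norm_cast
  rw [← Fintype.card_coe, ← Nat.card_eq_fintype_card]
  exact Nat.card_congr (Finsupp.equivFunOnFinite.subtypeEquiv fun f => by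
    simp [Finset.mem_finsuppAntidiag])

theorem card_fiberwise_sum {ι κ : Type*} [Fintype ι] [Fintype κ] (ν : ι → κ) (N : κ → ℕ) :
    Nat.card {j : ι → ℕ // ∀ n, ∑ u with ν u = n, j u = N n} =
      ∏ n, Nat.card {f : {u // ν u = n} → ℕ // ∑ u, f u = N n} := by
  rw [← Nat.card_pi]
  refine Nat.card_congr
    { toFun := fun j n => ⟨fun u => j.1 u, ?_⟩
      invFun := fun F => ⟨fun u => (F (ν u)).1 ⟨u, rfl⟩, ?_⟩
      left_inv := fun j => rfl
      right_inv := ?_ }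
  · rw [← j.2 n]
    exact (Finset.sum_subtype _ (by simp) j.1).symm
  · intro n
    rw [← (F n).2]
    rw [Finset.sum_subtype (p := fun u => ν u = n) _ (by simp)]
    refine Finset.sum_congr rfl ?_
    rintro ⟨u, rfl⟩ _
    rfl
  · intro F
    funext n
    apply Subtype.ext
    funext ⟨u, hu⟩
    subst hu
    rfl

/-! ### Counting coefficients at the ends -/

namespace ResolutionGraph

variable {V : Type*} [Fintype V] {Γ : ResolutionGraph V}

/-- The node to which the leg of an end is attached. -/
def EndVertex.toNode [Nonempty Γ.Node] (u : Γ.EndVertex) : Γ.Node := u.existsUnique_node.choose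

theorem EndVertex.toNode_eq_iff [Nonempty Γ.Node] {u : Γ.EndVertex} {n : Γ.Node} :
    EndVertex.toNode u = n ↔ u ∈ Γ.endsAt n := by
  constructor
  · rintro rfl
    exact u.existsUnique_node.choose_spec.1
  · intro h
    exact (u.existsUnique_node.choose_spec.2 n h).symm

theorem EndVertex.filter_toNode [Nonempty Γ.Node] (n : Γ.Node) :
    Finset.univ.filter (fun u : Γ.EndVertex => EndVertex.toNode u = n) = Γ.endsAt n := by
  ext u; simp [EndVertex.toNode_eq_iff]

/-- Each end belongs to exactly one node, so the equations decouple. At each node the number of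
solutions is a coefficient of `(1 - X)^(-|ℰ_n|)`, and both sides vanish if some `N n` is negative.
-/
theorem card_ends_with_sums [Nonempty Γ.Node] (N : Γ.Node → ℤ) :
    ({j : Γ.EndVertex → ℕ | ∀ n, ((∑ u ∈ Γ.endsAt n, j u : ℕ) : ℤ) = N n}.ncard : ℤ) =
      ∏ n, coeffZ (PowerSeries.mk 1 ^ (Γ.endsAt n).card) (N n) := by
  by_cases h : ∀ n, 0 ≤ N n
  · lift N to Γ.Node → ℕ using h
    have hc : ∀ n, (Γ.endsAt n).card =
        Fintype.card {u : Γ.EndVertex // EndVertex.toNode u = n} := fun n => by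
      rw [Fintype.card_subtype, EndVertex.filter_toNode]
    simp only [coeffZ_natCast, hc, coeff_mk_one_pow_card, Nat.cast_inj]
    rw [← Nat.cast_prod, Nat.cast_inj, ← Nat.card_coe_set_eq]
    refine Eq.trans ?_ ((card_fiberwise_sum (EndVertex.toNode (Γ := Γ)) N).trans ?_)
    · refine Nat.card_congr (Equiv.subtypeEquivRight fun j => ?_)
      rw [Set.mem_ofPred_eq]
      refine forall_congr' fun n => ?_
      rw [← EndVertex.filter_toNode]
      congr!
    · congr!
  · push Not at h
    obtain ⟨n, hn⟩ := h
    rw [Finset.prod_eq_zero (Finset.mem_univ n) (coeffZ_of_neg _ hn)]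
    have : {j : Γ.EndVertex → ℕ | ∀ n, ((∑ u ∈ Γ.endsAt n, j u : ℕ) : ℤ) = N n} = ∅ := by
      ext j
      simp only [Set.mem_ofPred_eq, Set.mem_empty_iff_false, iff_false]
      intro hj
      have := hj n
      omega
    rw [this, Set.ncard_empty, Nat.cast_zero]

/-! ### Vectors supported at nodes and ends -/

/-- The combination `∑_n p_n E_n^* + ∑_u m_u E_u^*`. -/
def nodeEndVec (p : Γ.Node → ℝ) (m : Γ.EndVertex → ℤ) : V → ℝ :=
  nodeVec p + ∑ u : Γ.EndVertex, (m u : ℝ) • Γ.dualVec u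

theorem coef_nodeEndVec (p : Γ.Node → ℝ) (m : Γ.EndVertex → ℤ) (v : V) :
    Γ.coef (nodeEndVec p m) v = Γ.coef (nodeVec p) v +
      ∑ u : Γ.EndVertex, if u.1 = v then (m u : ℝ) else 0 := by
  simp [nodeEndVec, map_sum, coef_dualVec]

theorem coef_nodeEndVec_node (p : Γ.Node → ℝ) (m : Γ.EndVertex → ℤ) (n : Γ.Node) :
    Γ.coef (nodeEndVec p m) n = p n := by
  rw [coef_nodeEndVec, coef_nodeVec_node, Finset.sum_eq_zero, add_zero]
  intro u _
  refine if_neg fun e => ?_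
  have h1 := u.2
  have h2 := n.2
  rw [e] at h1
  omega

theorem coef_nodeEndVec_end (p : Γ.Node → ℝ) (m : Γ.EndVertex → ℤ) (u : Γ.EndVertex) :
    Γ.coef (nodeEndVec p m) u = m u := by
  rw [coef_nodeEndVec, coef_nodeVec_of_lt _ (by rw [u.2]; omega)]
  simp [← Subtype.ext_iff]

theorem coef_nodeEndVec_of_degree_eq_two (p : Γ.Node → ℝ) (m : Γ.EndVertex → ℤ) {v : V}
    (hv : Γ.graph.degree v = 2) : Γ.coef (nodeEndVec p m) v = 0 := by
  rw [coef_nodeEndVec, coef_nodeVec_of_lt _ (by omega), Finset.sum_eq_zero, add_zero]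
  intro u _
  refine if_neg ?_
  rintro rfl
  exact u.degree_ne_two hv

theorem endVec_eq (m : Γ.EndVertex → ℕ) : endVec m = nodeEndVec (0 : Γ.Node → ℝ) (fun u => m u) := by
  simp [endVec, latticePoint, nodeEndVec, nodeVec, Nat.cast_smul_eq_nsmul]

section EndRem

variable [Nonempty Γ.Node]

/-- The least non-negative coefficient at an end that is compatible with `l`. -/
def endRem (a : Γ.LiftCoeffs) (l : Γ.Node → ℤ) (u : Γ.EndVertex) : ℤ :=
  (a.leaf u - Γ.omegaEnd (EndVertex.toNode u) u * l (EndVertex.toNode u)) %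
    Γ.alphaEnd (EndVertex.toNode u) u

theorem fract_eq_endRem (a : Γ.LiftCoeffs) (l : Γ.Node → ℤ) {n : Γ.Node} {u : Γ.EndVertex}
    (h : u ∈ Γ.endsAt n) :
    Int.fract (((a.leaf u : ℝ) - Γ.omegaEnd n u * l n) / Γ.alphaEnd n u) =
      endRem a l u / Γ.alphaEnd n u := by
  obtain rfl := EndVertex.toNode_eq_iff.2 h
  have h0 : (0 : ℝ) < Γ.alphaEnd (EndVertex.toNode u) u := by
    exact_mod_cast alphaEnd_pos _ u
  rw [Int.fract_eq_iff]
  refine ⟨div_nonneg ?_ h0.le, (div_lt_one h0).2 ?_, ?_⟩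
  · exact_mod_cast Int.emod_nonneg _ (alphaEnd_pos _ u).ne'
  · exact_mod_cast Int.emod_lt_of_pos _ (alphaEnd_pos _ u)
  · refine ⟨(a.leaf u - Γ.omegaEnd (EndVertex.toNode u) u * l (EndVertex.toNode u)) /
      Γ.alphaEnd (EndVertex.toNode u) u, ?_⟩
    have := Int.emod_add_mul_ediv (a.leaf u - Γ.omegaEnd (EndVertex.toNode u) u *
      l (EndVertex.toNode u)) (Γ.alphaEnd (EndVertex.toNode u) u)
    rw [← sub_div, div_eq_iff h0.ne', endRem]
    have h2 : (((a.leaf u - Γ.omegaEnd (EndVertex.toNode u) u * l (EndVertex.toNode u) : ℤ)) : ℝ) =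
        (a.leaf u : ℝ) - Γ.omegaEnd (EndVertex.toNode u) u * l (EndVertex.toNode u) := by
      push_cast; ring
    rw [← h2]
    have h3 := congrArg (Int.cast : ℤ → ℝ) this
    rw [Int.cast_add, Int.cast_mul] at h3
    linear_combination -h3

theorem dvd_endRem (a : Γ.LiftCoeffs) (l : Γ.Node → ℤ) {n : Γ.Node} {u : Γ.EndVertex}
    (h : u ∈ Γ.endsAt n) :
    Γ.alphaEnd n u ∣ Γ.omegaEnd n u * l n + (endRem a l u - a.leaf u) := by
  obtain rfl := EndVertex.toNode_eq_iff.2 h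
  have := Int.emod_add_mul_ediv (a.leaf u - Γ.omegaEnd (EndVertex.toNode u) u *
      l (EndVertex.toNode u)) (Γ.alphaEnd (EndVertex.toNode u) u)
  refine ⟨-((a.leaf u - Γ.omegaEnd (EndVertex.toNode u) u *
      l (EndVertex.toNode u)) / (Γ.alphaEnd (EndVertex.toNode u) u)), ?_⟩
  rw [endRem]
  linear_combination this

end EndRem

variable [PartialOrder Γ.Node]

theorem LiftCoeffs.coef_toDual_node_int (a : Γ.LiftCoeffs) (n : Γ.Node) :
    ∃ k : ℤ, Γ.coef a.toDual n = k :=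
  ⟨a.node n + a.chainPart n, by rw [a.coef_toDual_node]; push_cast; rfl⟩

theorem cls_sum_eq_iff (a : Γ.LiftCoeffs) (m : Γ.EndVertex → ℕ) :
    ∑ u, m u • Γ.cls (Γ.dualGen u) = Γ.cls a.toDual ↔
      nodeEndVec (0 : Γ.Node → ℝ) (fun u => m u) - a.toDual ∈ lattice (V := V) := by
  have h : ∑ u : Γ.EndVertex, m u • Γ.cls (Γ.dualGen u) =
      Γ.cls (∑ u : Γ.EndVertex, m u • Γ.dualGen u) :=
    (map_sum (QuotientAddGroup.mk' _) (fun u : Γ.EndVertex => m u • Γ.dualGen u) _).symm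
  rw [h, eq_comm, cls, cls, QuotientAddGroup.eq, AddSubgroup.mem_addSubgroupOf, ← endVec_eq,
    neg_add_eq_sub]
  have e : ((∑ u : Γ.EndVertex, m u • Γ.dualGen u - a.toDual : Γ.dualLattice) : V → ℝ) =
      endVec m - a.toDual := by
    simp only [AddSubgroup.coe_sub, AddSubgroup.val_finsetSum, AddSubgroup.coe_nsmul, dualGen,
      endVec, latticePoint]
  rw [e]

/-! ### Shifted lifts -/

theorem LiftCoeffs.toDual_shift (a : Γ.LiftCoeffs) (k : Γ.Node → ℕ) :
    (a.shift k).toDual = a.toDual - ∑ n : Γ.Node, k n • Γ.dualGen n := by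
  simp only [LiftCoeffs.toDual, LiftCoeffs.shift, sub_smul, Finset.sum_sub_distrib,
    natCast_zsmul]
  abel

theorem quasi_shift (a : Γ.LiftCoeffs) (k : Γ.Node → ℕ) (l : Γ.Node → ℤ) (n : Γ.Node) :
    quasi (a.shift k) l n = quasi a l n - k n := by
  simp only [quasi, LiftCoeffs.shift]
  push_cast
  ring

/-! ### Reductions in product form -/

/-- The reduction of `F` is given by the coefficients of the power series `φ_n` at the values of
the quasilinear functions. -/
structure HasReduction (F : HahnSeries (V → ℝ) (AddMonoidAlgebra ℤ Γ.H))
    (φ : Γ.Node → PowerSeries ℤ) : Prop where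
  reducible : Reducible F
  eq_prod : ∀ (a : Γ.LiftCoeffs), ∀ l ∈ affineLattice a,
    reduction F (Γ.cls a.toDual) (fun i => a.center i + l i) = ∏ n, coeffZ (φ n) ⌊quasi a l n⌋
  eq_zero : ∀ (a : Γ.LiftCoeffs) (x : Γ.Node → ℝ),
    (¬ ∃ l ∈ affineLattice a, x = fun i => a.center i + l i) → reduction F (Γ.cls a.toDual) x = 0

/-- The second term of the factor moves both the class and the exponent by `E_n^*`, which amounts to
replacing `a` by `a - E_n^*` with the same `ℓ`. This lowers `N_a(·, n)` by one and leaves the other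
values alone. -/
theorem HasReduction.zetaFactor_mul {F : HahnSeries (V → ℝ) (AddMonoidAlgebra ℤ Γ.H)}
    {φ : Γ.Node → PowerSeries ℤ} (h : HasReduction F φ) (n : Γ.Node) :
    HasReduction (Γ.zetaFactor n * F) (Function.update φ n ((1 - PowerSeries.X) * φ n)) := by
  have hdual : ∀ a : Γ.LiftCoeffs, (a.shift (Pi.single n 1)).toDual = a.toDual - Γ.dualGen n := by
    intro a
    rw [a.toDual_shift]
    congr 1
    rw [Finset.sum_eq_single n] <;> simp +contextual
  have hcls : ∀ a : Γ.LiftCoeffs, Γ.cls a.toDual - Γ.cls (Γ.dualGen n) =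
      Γ.cls (a.shift (Pi.single n 1)).toDual := by
    intro a; rw [hdual]; rfl
  have hcen : ∀ (a : Γ.LiftCoeffs) i, (a.shift (Pi.single n 1)).center i =
      a.center i - Γ.proj (Γ.dualVec n) i := by
    intro a i; rw [LiftCoeffs.center, hdual]; rfl
  refine ⟨h.reducible.zetaFactor_mul n, fun a l hl => ?_, fun a x hx => ?_⟩
  · have e : (fun i => a.center i + (l i : ℝ)) - Γ.proj (Γ.dualVec n) =
        fun i => (a.shift (Pi.single n 1)).center i + (l i : ℝ) := by
      ext i; rw [hcen, Pi.sub_apply]; ring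
    rw [reduction_zetaFactor_mul h.reducible, hcls, e, h.eq_prod a l hl,
      h.eq_prod (a.shift (Pi.single n 1)) l hl, ← Finset.mul_prod_erase _ _ (Finset.mem_univ n),
      ← Finset.mul_prod_erase Finset.univ (fun i => coeffZ (φ i) ⌊quasi (a.shift _) l i⌋)
        (Finset.mem_univ n), ← Finset.mul_prod_erase Finset.univ (fun i => coeffZ
          (Function.update φ n ((1 - PowerSeries.X) * φ n) i) _) (Finset.mem_univ n),
      Function.update_self, coeffZ_one_sub_X_mul, sub_mul]
    congr 1
    · congr 1
      refine Finset.prod_congr rfl fun i hi => ?_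
      rw [Function.update_of_ne (Finset.ne_of_mem_erase hi)]
    · congr 1
      · rw [quasi_shift, Pi.single_eq_same, Nat.cast_one, Int.floor_sub_one]
      · refine Finset.prod_congr rfl fun i hi => ?_
        rw [Function.update_of_ne (Finset.ne_of_mem_erase hi), quasi_shift,
          Pi.single_eq_of_ne (Finset.ne_of_mem_erase hi), Nat.cast_zero, sub_zero]
  · rw [reduction_zetaFactor_mul h.reducible, hcls, h.eq_zero a x hx, h.eq_zero, sub_zero]
    rintro ⟨l, hl, e⟩
    refine hx ⟨l, hl, ?_⟩
    ext i
    have := congrFun e i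
    simp only [Pi.sub_apply, hcen] at this
    linarith

theorem HasReduction.prod_zetaFactor_mul {F : HahnSeries (V → ℝ) (AddMonoidAlgebra ℤ Γ.H)}
    {φ : Γ.Node → PowerSeries ℤ} (h : HasReduction F φ) (e : Γ.Node → ℕ) (s : Finset Γ.Node) :
    HasReduction ((∏ n ∈ s, Γ.zetaFactor n ^ e n) * F)
      (fun n => if n ∈ s then (1 - PowerSeries.X) ^ e n * φ n else φ n) := by
  have hpow : ∀ {F : HahnSeries (V → ℝ) (AddMonoidAlgebra ℤ Γ.H)} {φ : Γ.Node → PowerSeries ℤ}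
      (_ : HasReduction F φ) (n : Γ.Node) (k : ℕ), HasReduction (Γ.zetaFactor n ^ k * F)
        (Function.update φ n ((1 - PowerSeries.X) ^ k * φ n)) := by
    intro F φ h n k
    induction k with
    | zero => simpa using h
    | succ k ih =>
      have := ih.zetaFactor_mul n
      rw [← mul_assoc, ← pow_succ', Function.update_self, ← mul_assoc, ← pow_succ',
        Function.update_idem] at this
      exact this
  induction s using Finset.induction_on with
  | empty => simpa using h
  | insert n s hn ih =>
    have := hpow ih n (e n)
    rw [if_neg hn, ← mul_assoc] at this
    rw [Finset.prod_insert hn]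
    convert this using 1
    ext1 i
    by_cases hi : i = n
    · subst hi; simp
    · simp [hi]

variable [Nonempty Γ.Node]

/-- Equality of projections is tested by the injective map `Λ`, and membership in `L` by
`integral_iff` applied to the difference. The node part `p` is kept real and arbitrary: `p = 0`
serves the end series, `p = N_a(ℓ, ·)` the integrality of `N_a`. -/
theorem nodeEndVec_mem_iff (hord : ∀ n, ∀ n' ∈ Γ.nodesAt n, n < n' ∨ n' < n) (a : Γ.LiftCoeffs)
    (l : Γ.Node → ℤ) (p : Γ.Node → ℝ) (m : Γ.EndVertex → ℤ) :
    (Γ.proj (nodeEndVec p m) = (fun i => a.center i + l i) ∧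
      nodeEndVec p m - a.toDual ∈ lattice (V := V)) ↔
    l ∈ affineLattice a ∧
      (∀ n, ∀ u ∈ Γ.endsAt n, Γ.alphaEnd n u ∣ Γ.omegaEnd n u * l n + (m u - a.leaf u)) ∧
      ∀ n, p n + ∑ u ∈ Γ.endsAt n, (m u : ℝ) / Γ.alphaEnd n u = quasiBar a l n := by
  have hproj : Γ.proj (nodeEndVec p m) = (fun i => a.center i + l i) ↔
      ∀ n, p n + ∑ u ∈ Γ.endsAt n, (m u : ℝ) / Γ.alphaEnd n u = quasiBar a l n := by
    rw [← orbForm_injective.eq_iff, funext_iff]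
    refine forall_congr' fun n => ?_
    rw [quasiBar_eq_orbForm hord, orbForm_proj_of_chainPart hord (a := a) (c := 0)
      (fun v hv => by rw [coef_nodeEndVec_of_degree_eq_two _ _ hv, zero_mul])]
    simp only [coef_nodeEndVec_node, coef_nodeEndVec_end, zero_mul, sub_zero, add_zero]
  rw [← hproj, and_comm (a := ∀ n, ∀ u ∈ Γ.endsAt n, _), ← and_assoc, and_comm (a := l ∈ _),
    and_assoc]
  refine and_congr_right fun h => ?_
  have := integral_iff (d := nodeEndVec p m - a.toDual) (l := l) hord (a := a) ?_ ?_
    (y := fun u => m u - a.leaf u) ?_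
  · exact this
  · intro v hv
    rw [map_sub, Pi.sub_apply, coef_nodeEndVec_of_degree_eq_two _ _ hv,
      a.coef_toDual_of_degree_eq_two hv]
    ring
  · intro n
    have := congrFun h n
    simp only [proj, LiftCoeffs.center] at this
    rw [Pi.sub_apply, this]
    ring
  · intro u
    rw [map_sub, Pi.sub_apply, coef_nodeEndVec_end, a.coef_toDual_end]
    push_cast
    rfl

theorem quasiBar_eq_quasi_add (a : Γ.LiftCoeffs) (l : Γ.Node → ℤ) (n : Γ.Node) :
    quasiBar a l n = quasi a l n + ∑ u ∈ Γ.endsAt n, (endRem a l u : ℝ) / Γ.alphaEnd n u := by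
  rw [quasiBar]
  congr 1
  exact Finset.sum_congr rfl fun u hu => fract_eq_endRem a l hu

/-- The vector with coefficients `N_a(ℓ, n)` at the nodes and the least remainders at the ends
differs from `a` by an element of `L`, so its coefficients are integers. In particular `N_a` is
integral on `ℤ^𝒩(a)`. -/
theorem quasi_eq_floor (hord : ∀ n, ∀ n' ∈ Γ.nodesAt n, n < n' ∨ n' < n) {a : Γ.LiftCoeffs}
    {l : Γ.Node → ℤ} (hl : l ∈ affineLattice a) (n : Γ.Node) :
    quasi a l n = ⌊quasi a l n⌋ := by
  have h := (nodeEndVec_mem_iff hord a l (quasi a l) (endRem a l)).2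
    ⟨hl, fun n u hu => dvd_endRem a l hu, fun n => (quasiBar_eq_quasi_add a l n).symm⟩
  obtain ⟨k, hk⟩ := coef_integral (Γ := Γ) h.2 n
  obtain ⟨k', hk'⟩ := a.coef_toDual_node_int n
  rw [map_sub, Pi.sub_apply, coef_nodeEndVec_node, hk'] at hk
  have : quasi a l n = ((k + k' : ℤ) : ℝ) := by push_cast; linarith
  rw [this, Int.floor_intCast]

theorem hasReduction_endSeries (hord : ∀ n, ∀ n' ∈ Γ.nodesAt n, n < n' ∨ n' < n) :
    HasReduction Γ.endSeries (fun n => PowerSeries.mk 1 ^ (Γ.endsAt n).card) where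
  reducible := reducible_endSeries
  eq_zero a x hx := by
    rw [reduction_endSeries]
    have : {m : Γ.EndVertex → ℕ | Γ.proj (endVec m) = x ∧
        ∑ u, m u • Γ.cls (Γ.dualGen u) = Γ.cls a.toDual} = ∅ := by
      ext m
      simp only [Set.mem_ofPred_eq, Set.mem_empty_iff_false, iff_false]
      rintro ⟨h1, h2⟩
      rw [cls_sum_eq_iff] at h2
      rw [endVec_eq] at h1
      choose k hk using h2
      have h3 : x = fun i => a.center i + (k i : ℝ) := by
        ext i
        rw [← hk, ← h1]
        simp [proj, LiftCoeffs.center]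
      have h4 := (nodeEndVec_mem_iff hord a (fun n => k n) 0 (fun u => m u)).1
        ⟨h1.trans h3, fun v => ⟨k v, hk v⟩⟩
      exact hx ⟨_, h4.1, h3⟩
    rw [this, Set.ncard_empty, Nat.cast_zero]
  eq_prod a l hl := by
    rw [reduction_endSeries, ← card_ends_with_sums]
    congr 1
    -- Division with remainder `m_u = r_u + α_u j_u`: the remainders account exactly for `N̄_a -
    -- N_a`, so the equation on `m` becomes `∑ j_u = N_a(ℓ, n)`.
    set Φ : (Γ.EndVertex → ℕ) → (Γ.EndVertex → ℕ) := fun j u =>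
      (endRem a l u).toNat + (Γ.alphaEnd (EndVertex.toNode u) u).toNat * j u with hΦ
    have hα : ∀ u : Γ.EndVertex, ((Γ.alphaEnd (EndVertex.toNode u) u).toNat : ℤ) =
        Γ.alphaEnd (EndVertex.toNode u) u := fun u => Int.toNat_of_nonneg (alphaEnd_pos _ u).le
    have hr : ∀ u : Γ.EndVertex, ((endRem a l u).toNat : ℤ) = endRem a l u := fun u =>
      Int.toNat_of_nonneg (Int.emod_nonneg _ (alphaEnd_pos _ u).ne')
    have hΦc : ∀ j u, ((Φ j u : ℕ) : ℤ) =
        endRem a l u + Γ.alphaEnd (EndVertex.toNode u) u * j u := fun j u => by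
      rw [hΦ]; push_cast; rw [hα, hr]
    have hinj : Function.Injective Φ := by
      intro j j' h
      ext u
      have h1 := congrArg (Nat.cast : ℕ → ℤ) (congrFun h u)
      rw [hΦc, hΦc, add_right_inj] at h1
      exact_mod_cast mul_left_cancel₀ (alphaEnd_pos _ u).ne' h1
    rw [← Set.ncard_image_of_injective
      {j : Γ.EndVertex → ℕ | ∀ n, ((∑ u ∈ Γ.endsAt n, j u : ℕ) : ℤ) = ⌊quasi a l n⌋} hinj]
    congr 1
    have hsum : ∀ j n, ∑ u ∈ Γ.endsAt n, (((Φ j u : ℕ) : ℤ) : ℝ) / Γ.alphaEnd n u =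
        ∑ u ∈ Γ.endsAt n, (endRem a l u : ℝ) / Γ.alphaEnd n u + ((∑ u ∈ Γ.endsAt n, j u : ℕ) : ℤ) := by
      intro j n
      push_cast
      rw [← Finset.sum_add_distrib]
      refine Finset.sum_congr rfl fun u hu => ?_
      have h0 : (Γ.alphaEnd n u : ℝ) ≠ 0 := by exact_mod_cast (alphaEnd_pos n u).ne'
      have h1 := congrArg (Int.cast : ℤ → ℝ) (hΦc j u)
      rw [EndVertex.toNode_eq_iff.2 hu] at h1
      push_cast at h1
      rw [h1]
      field_simp
    ext m
    simp only [Set.mem_ofPred_eq, Set.mem_image]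
    rw [cls_sum_eq_iff, endVec_eq, nodeEndVec_mem_iff hord]
    constructor
    · rintro ⟨-, h1, h2⟩
      have hex : ∀ u, ∃ j : ℕ, m u = (endRem a l u).toNat +
          (Γ.alphaEnd (EndVertex.toNode u) u).toNat * j := by
        intro u
        have hmem := EndVertex.toNode_eq_iff.1 (rfl : EndVertex.toNode u = _)
        have hd := dvd_sub (h1 _ u hmem) (dvd_endRem a l hmem)
        have hd' : Γ.alphaEnd (EndVertex.toNode u) u ∣ (m u : ℤ) - endRem a l u := by
          rwa [add_sub_add_left_eq_sub, sub_sub_sub_cancel_right] at hd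
        obtain ⟨q, hq⟩ := hd'
        have hlt : endRem a l u < Γ.alphaEnd (EndVertex.toNode u) u :=
          Int.emod_lt_of_pos _ (alphaEnd_pos _ u)
        -- A negative quotient would make `m u` at most the remainder minus `α`, hence negative.
        have hq0 : 0 ≤ q := by
          by_contra hneg
          have : Γ.alphaEnd (EndVertex.toNode u) u * q ≤ Γ.alphaEnd (EndVertex.toNode u) u * (-1) :=
            mul_le_mul_of_nonneg_left (by omega) (alphaEnd_pos _ u).le
          have hm0 : (0 : ℤ) ≤ m u := Int.natCast_nonneg _
          linarith
        obtain ⟨j, rfl⟩ := Int.eq_ofNat_of_zero_le hq0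
        refine ⟨j, ?_⟩
        zify
        rw [hr, hα, ← hq]
        ring
      choose j hj using hex
      have hmj : Φ j = m := funext fun u => (hj u).symm
      refine ⟨j, fun n => ?_, hmj⟩
      have h3 := h2 n
      rw [← hmj, hsum, quasiBar_eq_quasi_add] at h3
      simp only [Pi.zero_apply] at h3
      have h4 : (((∑ u ∈ Γ.endsAt n, j u : ℕ) : ℤ) : ℝ) = quasi a l n := by linarith
      rw [← h4, Int.floor_intCast]
    · rintro ⟨j, hj, rfl⟩
      refine ⟨hl, fun n u hu => ?_, fun n => ?_⟩
      · rw [hΦc, EndVertex.toNode_eq_iff.2 hu]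
        have := dvd_add (dvd_endRem a l hu) (Dvd.intro (j u : ℤ) (rfl : Γ.alphaEnd n u * j u = _))
        rwa [add_assoc, sub_add_eq_add_sub] at this
      · rw [hsum, hj, ← quasi_eq_floor hord hl, quasiBar_eq_quasi_add]
        simp [add_comm]

theorem hasReduction_poincareH (hord : ∀ n, ∀ n' ∈ Γ.nodesAt n, n < n' ∨ n' < n) :
    HasReduction Γ.poincareH (fun n => (1 - PowerSeries.X) ^ (Γ.graph.degree n - 2) *
      PowerSeries.mk 1 ^ (Γ.endsAt n).card) := by
  have := (hasReduction_endSeries hord).prod_zetaFactor_mul (fun n => Γ.graph.degree n - 2)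
    Finset.univ
  rw [← poincareH_eq] at this
  simpa using this

end ResolutionGraph

/-! ### Coefficients of multiples of powers of `1 - X` -/

theorem coeffZ_add (φ ψ : PowerSeries ℤ) (N : ℤ) : coeffZ (φ + ψ) N = coeffZ φ N + coeffZ ψ N := by
  unfold coeffZ; split_ifs <;> simp

theorem coeffZ_sum {ι : Type*} (s : Finset ι) (f : ι → PowerSeries ℤ) (N : ℤ) :
    coeffZ (∑ i ∈ s, f i) N = ∑ i ∈ s, coeffZ (f i) N := by
  unfold coeffZ; split_ifs <;> simp

theorem coeffZ_intCast_mul (c : ℤ) (φ : PowerSeries ℤ) (N : ℤ) :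
    coeffZ ((c : PowerSeries ℤ) * φ) N = c * coeffZ φ N := by
  unfold coeffZ
  split_ifs
  · simp
  · rw [← zsmul_eq_mul, map_zsmul, zsmul_eq_mul, Int.cast_id]

theorem coeffZ_X_pow_mul (k : ℕ) (φ : PowerSeries ℤ) (N : ℤ) :
    coeffZ (PowerSeries.X ^ k * φ) N = coeffZ φ (N - k) := by
  induction k generalizing N with
  | zero => simp
  | succ k ih =>
    have h := coeffZ_one_sub_X_mul (PowerSeries.X ^ k * φ) N
    have e : PowerSeries.X ^ k * φ = (1 - PowerSeries.X) * (PowerSeries.X ^ k * φ) +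
      PowerSeries.X ^ (k + 1) * φ := by ring
    have h2 := congrArg (coeffZ · N) e
    simp only [coeffZ_add] at h2
    rw [h, ih, ih] at h2
    rw [show N - ((k + 1 : ℕ) : ℤ) = N - 1 - k by push_cast; ring]
    linarith

theorem coeffZ_one_sub_X_pow_mul (e : ℕ) (φ : PowerSeries ℤ) (N : ℤ) :
    coeffZ ((1 - PowerSeries.X) ^ e * φ) N =
      ∑ k ∈ Finset.Icc 0 e, (-1) ^ k * (e.choose k : ℤ) * coeffZ φ (N - k) := by
  have h : ((1 - PowerSeries.X) ^ e * φ : PowerSeries ℤ) = ∑ k ∈ Finset.Icc 0 e,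
      (((-1) ^ k * (e.choose k : ℤ) : ℤ) : PowerSeries ℤ) * (PowerSeries.X ^ k * φ) := by
    rw [sub_eq_neg_add, add_pow, Finset.sum_mul, Finset.range_eq_Ico]
    refine Finset.sum_congr rfl fun k _ => ?_
    push_cast
    rw [neg_pow]
    ring
  rw [h, coeffZ_sum]
  exact Finset.sum_congr rfl fun k _ => by rw [coeffZ_intCast_mul, coeffZ_X_pow_mul]

theorem coeffZ_mk_one (N : ℤ) : coeffZ (PowerSeries.mk 1) N = if 0 ≤ N then 1 else 0 := by
  unfold coeffZ
  rcases lt_or_ge N 0 with h | h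
  · rw [if_pos h, if_neg (by omega)]
  · rw [if_neg (by omega), if_pos h]; simp

theorem coeffZ_one (N : ℤ) : coeffZ 1 N = if N = 0 then 1 else 0 := by
  unfold coeffZ
  rcases lt_or_ge N 0 with h | h
  · rw [if_pos h, if_neg (by omega)]
  · rw [if_neg (by omega), PowerSeries.coeff_one]
    congr 1
    rw [eq_iff_iff]
    omega

/-! ### Expansion of the node factors over the levels `k` -/

namespace ResolutionGraph

variable {V : Type*} [Fintype V] {Γ : ResolutionGraph V}

variable (Γ) in
/-- The power series `(1 - X)^(δ_n - 2) (1 - X)^(-|ℰ_n|)`. -/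
def nodeSeries (n : Γ.Node) : PowerSeries ℤ :=
  (1 - PowerSeries.X) ^ (Γ.graph.degree n - 2) * PowerSeries.mk 1 ^ (Γ.endsAt n).card

theorem one_sub_X_pow_mul_mk_one_pow (e : ℕ) :
    ((1 - PowerSeries.X) ^ e * PowerSeries.mk 1 ^ e : PowerSeries ℤ) = 1 := by
  rw [← mul_pow, mul_comm, PowerSeries.mk_one_mul_one_sub_eq_one, one_pow]

theorem nodeSeries_of_mem_hatN {n : Γ.Node} (h : n ∈ Γ.hatN) :
    Γ.nodeSeries n = (1 - PowerSeries.X) ^ (Γ.deltaN n - 2) := by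
  have h2 : 2 ≤ Γ.deltaN n := by simpa [hatN] using h
  have hd := degree_node n
  rw [nodeSeries, show Γ.graph.degree n - 2 = Γ.deltaN n - 2 + (Γ.endsAt n).card by omega, pow_add,
    mul_assoc, one_sub_X_pow_mul_mk_one_pow, mul_one]

theorem nodeSeries_of_notMem_hatN {n : Γ.Node} (h : n ∉ Γ.hatN) (h1 : 1 ≤ Γ.deltaN n) :
    Γ.nodeSeries n = PowerSeries.mk 1 := by
  have h2 : ¬ 2 ≤ Γ.deltaN n := by simpa [hatN] using h
  have hd := degree_node n
  have h3 := n.2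
  rw [nodeSeries, show (Γ.endsAt n).card = Γ.graph.degree n - 2 + 1 by omega, pow_succ, ← mul_assoc,
    one_sub_X_pow_mul_mk_one_pow, one_mul]

/-- Distributivity in the form common to both representations: a product of signed sums of tests is
a signed sum, over the levels, of the conjunctions of the tests. -/
theorem prod_eq_sum_levels (r : ℕ) (f : Γ.Node → ℤ) (I : Γ.Node → ℕ → Prop)
    [∀ n, DecidablePred (I n)]
    (hf : ∀ n, f n = ∑ k ∈ (if n ∈ Γ.hatN then Finset.Icc 0 (Γ.deltaN n - r) else {0}),
      (if n ∈ Γ.hatN then (-1) ^ k * ((Γ.deltaN n - r).choose k : ℤ) else 1) *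
        if I n k then 1 else 0) :
    ∏ n, f n = ∑ k ∈ Γ.levels r, Γ.signedBinom r k * if ∀ n, I n (k n) then 1 else 0 := by
  rw [Finset.prod_congr rfl fun n _ => hf n, Finset.prod_univ_sum, levels]
  refine Finset.sum_congr rfl fun k _ => ?_
  rw [Finset.prod_mul_distrib, signedBinom, Finset.prod_ite_mem, Finset.univ_inter]
  congr 1
  rw [Finset.prod_boole]
  simp

/-- For `n` in `hatN` one factor `1 / (1 - X)` is kept: `(1 - X)^(δ - 2) = (1 - X)^(δ - 1) / (1 -
X)`, and the coefficients of `X^k / (1 - X)` test `N ≥ k`. -/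
theorem prod_nodeSeries_eq_sum_levels_one (hdelta : ∀ n, 1 ≤ Γ.deltaN n) (N : Γ.Node → ℤ) :
    ∏ n, coeffZ (Γ.nodeSeries n) (N n) =
      ∑ k ∈ Γ.levels 1, Γ.signedBinom 1 k * if ∀ n, 0 ≤ N n - k n then 1 else 0 := by
  refine (prod_eq_sum_levels 1 _ (fun n k => 0 ≤ N n - k) fun n => ?_).trans
    (Finset.sum_congr rfl fun k _ => by congr)
  by_cases h : n ∈ Γ.hatN
  · have h2 : 2 ≤ Γ.deltaN n := by simpa [hatN] using h
    have e : ((1 - PowerSeries.X) ^ (Γ.deltaN n - 2) : PowerSeries ℤ) =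
        (1 - PowerSeries.X) ^ (Γ.deltaN n - 1) * PowerSeries.mk 1 := by
      rw [show Γ.deltaN n - 1 = Γ.deltaN n - 2 + 1 by omega, pow_succ, mul_assoc,
        mul_comm (1 - PowerSeries.X), PowerSeries.mk_one_mul_one_sub_eq_one, mul_one]
    rw [if_pos h, nodeSeries_of_mem_hatN h, e, coeffZ_one_sub_X_pow_mul]
    simp only [coeffZ_mk_one, if_pos h]
  · rw [if_neg h, nodeSeries_of_notMem_hatN h (hdelta n), coeffZ_mk_one, Finset.sum_singleton]
    simp [h]

/-- For `n` in `hatN` the polynomial `(1 - X)^(δ - 2)` is expanded directly, so equalities replace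
inequalities; the remaining nodes keep the test `0 ≤ N` of `1 / (1 - X)`. -/
theorem prod_nodeSeries_eq_sum_levels_two (hdelta : ∀ n, 1 ≤ Γ.deltaN n) (N : Γ.Node → ℤ) :
    ∏ n, coeffZ (Γ.nodeSeries n) (N n) =
      ∑ k ∈ Γ.levels 2, Γ.signedBinom 2 k *
        if ∀ n, (if n ∈ Γ.hatN then N n = k n else 0 ≤ N n) then 1 else 0 := by
  refine (prod_eq_sum_levels 2 _ (fun n k => if n ∈ Γ.hatN then N n = k else 0 ≤ N n)
    fun n => ?_).trans (Finset.sum_congr rfl fun k _ => by congr)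
  by_cases h : n ∈ Γ.hatN
  · rw [if_pos h, nodeSeries_of_mem_hatN h, ← mul_one ((1 - PowerSeries.X) ^ _),
      coeffZ_one_sub_X_pow_mul]
    simp only [coeffZ_one, if_pos h, sub_eq_zero]
  · rw [if_neg h, nodeSeries_of_notMem_hatN h (hdelta n), coeffZ_mk_one]
    simp [h]

/-! ### Coefficients of the rational functions -/

/-- The integer vectors `v n` with real entries. -/
def realVec (v : Γ.Node → Γ.Node → ℤ) (n : Γ.Node) : Γ.Node → ℝ := fun i => v n i

theorem denominator_eq (v : Γ.Node → Γ.Node → ℤ) (S : Finset Γ.Node) :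
    Γ.denominator v S = ∏ n ∈ Sᶜ, (1 - HahnSeries.single (realVec v n) 1) := rfl

theorem latticePoint_realVec (v : Γ.Node → Γ.Node → ℤ) (m : Γ.Node → ℕ) (i : Γ.Node) :
    latticePoint (realVec v) m i = ((∑ n, m n • v n : Γ.Node → ℤ) i : ℤ) := by
  simp [latticePoint, realVec]

theorem isUnit_denominator {v : Γ.Node → Γ.Node → ℤ} (hv : ∀ n, 0 < realVec v n)
    (S : Finset Γ.Node) : IsUnit (Γ.denominator v S) :=
  isUnit_prod_one_sub_single (realVec v) hv (fun _ => 1) Sᶜ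

variable [PartialOrder Γ.Node]

theorem coeff_numerator_mul_inverse {v : Γ.Node → Γ.Node → ℤ} (hv : ∀ n, 0 < realVec v n)
    (a : Γ.LiftCoeffs) {D : Set (Γ.Node → ℤ)} (hD : D.Finite) (S : Finset Γ.Node)
    (x : Γ.Node → ℝ) :
    (numerator a D * Ring.inverse (Γ.denominator v S)).coeff x = ∑ l ∈ hD.toFinset,
      ∑ᶠ m ∈ {m : Γ.Node → ℕ | (∀ n ∈ S, m n = 0) ∧
        (fun i => a.center i + (l i : ℝ)) + latticePoint (realVec v) m = x}, (1 : ℤ) := by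
  rw [denominator_eq, inverse_prod_one_sub_single (realVec v) hv (fun _ => (1 : ℤ)), numerator,
    finsum_mem_eq_finite_toFinset_sum _ hD, Finset.sum_mul, HahnSeries.coeff_sum]
  refine Finset.sum_congr rfl fun l _ => ?_
  have h := HahnSeries.coeff_single_mul_add (r := (1 : ℤ))
    (x := geomSeries (realVec v) hv (fun _ => (1 : ℤ)) Sᶜ)
    (a := x - fun i => a.center i + (l i : ℝ)) (b := fun i => a.center i + (l i : ℝ))
  rw [sub_add_cancel, one_mul] at h
  rw [mono, h, geomSeries_coeff]
  refine finsum_mem_congr ?_ fun m _ => by simp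
  ext m
  simp only [Set.mem_ofPred_eq, Finset.mem_compl, not_not, eq_sub_iff_add_eq']

/-- Elements of the box and multiples of the `𝔳_n` are determined by their sum. -/
theorem box_decomposition_unique {v : Γ.Node → Γ.Node → ℤ}
    (hv : LinearIndependent ℝ (realVec v)) {a : Γ.LiftCoeffs} {l l' : Γ.Node → ℤ}
    (hl : l ∈ box a v) (hl' : l' ∈ box a v) {m m' : Γ.Node → ℕ}
    (h : (fun i => (l i : ℝ)) + latticePoint (realVec v) m =
      (fun i => (l' i : ℝ)) + latticePoint (realVec v) m') : l = l' ∧ m = m' := by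
  obtain ⟨s, hs, hls⟩ := hl
  obtain ⟨s', hs', hls'⟩ := hl'
  have key : ∑ n, (s n + m n) • realVec v n = ∑ n, (s' n + m' n) • realVec v n := by
    ext i
    have h1 := congrFun h i
    simp only [latticePoint, Pi.add_apply, Finset.sum_apply, Pi.smul_apply] at h1
    simp only [nsmul_eq_mul] at h1
    simp only [Finset.sum_apply, Pi.smul_apply, smul_eq_mul, add_mul, Finset.sum_add_distrib]
    have e1 := hls i
    have e2 := hls' i
    simp only [realVec] at h1 ⊢
    linarith
  have key2 := hv.fintypeLinearCombination_injective (a₁ := fun n => s n + m n)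
    (a₂ := fun n => s' n + m' n) (by simpa [Fintype.linearCombination_apply] using key)
  -- The fractional parts lie in `[0, 1)`, so equal sums `s n + m n` have equal integer parts.
  have hm : m = m' := by
    ext n
    have h1 := congrFun key2 n
    have h2 := hs n
    have h3 := hs' n
    have h4 : ((m n : ℤ) : ℝ) < (m' n : ℤ) + 1 := by push_cast; linarith
    have h5 : ((m' n : ℤ) : ℝ) < (m n : ℤ) + 1 := by push_cast; linarith
    have h4' : (m n : ℤ) < m' n + 1 := by exact_mod_cast h4
    have h5' : (m' n : ℤ) < m n + 1 := by exact_mod_cast h5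
    omega
  subst hm
  refine ⟨?_, rfl⟩
  ext i
  have := congrFun (add_right_cancel h) i
  exact_mod_cast this

/-- By uniqueness of the decomposition at most one term contributes. Two lifts occur because
exponents are always centred at `𝐜_a`, while the box may belong to `a - k`. -/
theorem coeff_numerator_mul_inverse_eq_ite {v : Γ.Node → Γ.Node → ℤ} (hv : ∀ n, 0 < realVec v n)
    (hli : LinearIndependent ℝ (realVec v)) (a a' : Γ.LiftCoeffs) {D : Set (Γ.Node → ℤ)}
    (hD : D ⊆ box a' v) (S : Finset Γ.Node) {l : Γ.Node → ℤ} (hl : l ∈ box a' v)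
    (m : Γ.Node → ℕ) :
    (numerator a D * Ring.inverse (Γ.denominator v S)).coeff
      ((fun i => a.center i + (l i : ℝ)) + latticePoint (realVec v) m) =
      if l ∈ D ∧ ∀ n ∈ S, m n = 0 then 1 else 0 := by
  have hfin : D.Finite := (box_finite a' v).subset hD
  have huniq : ∀ l' ∈ D, ∀ m', (fun i => a.center i + (l' i : ℝ)) + latticePoint (realVec v) m' =
      (fun i => a.center i + (l i : ℝ)) + latticePoint (realVec v) m → l' = l ∧ m' = m := by
    intro l' hl' m' e
    refine box_decomposition_unique hli (hD hl') hl ?_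
    ext i
    have := congrFun e i
    simp only [Pi.add_apply] at this ⊢
    linarith
  rw [coeff_numerator_mul_inverse hv a hfin]
  split_ifs with h
  · rw [Finset.sum_eq_single l]
    · have : {m' : Γ.Node → ℕ | (∀ n ∈ S, m' n = 0) ∧ (fun i => a.center i + (l i : ℝ)) +
          latticePoint (realVec v) m' = (fun i => a.center i + (l i : ℝ)) +
          latticePoint (realVec v) m} = {m} := by
        ext m'
        rw [Set.mem_ofPred_eq, Set.mem_singleton_iff]
        constructor
        · exact fun h' => (huniq l h.1 m' h'.2).2
        · rintro rfl; exact ⟨h.2, rfl⟩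
      rw [this, finsum_mem_singleton]
    · intro l' hl' hne
      refine finsum_mem_eq_zero_of_forall_eq_zero fun m' hm' => ?_
      exact absurd (huniq l' (hfin.mem_toFinset.1 hl') m' hm'.2).1 hne
    · intro h0
      exact absurd (hfin.mem_toFinset.2 h.1) h0
  · refine Finset.sum_eq_zero fun l' hl' => finsum_mem_eq_zero_of_forall_eq_zero fun m' hm' => ?_
    rw [hfin.mem_toFinset] at hl'
    obtain ⟨rfl, rfl⟩ := huniq l' hl' m' hm'.2
    exact absurd ⟨hl', hm'.1⟩ h

theorem coeff_numerator_mul_inverse_eq_zero {v : Γ.Node → Γ.Node → ℤ} (hv : ∀ n, 0 < realVec v n)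
    (a a' : Γ.LiftCoeffs) {D : Set (Γ.Node → ℤ)} (hD : D ⊆ box a' v) (S : Finset Γ.Node)
    {x : Γ.Node → ℝ} (hx : ∀ l ∈ box a' v, ∀ m : Γ.Node → ℕ,
      x ≠ (fun i => a.center i + (l i : ℝ)) + latticePoint (realVec v) m) :
    (numerator a D * Ring.inverse (Γ.denominator v S)).coeff x = 0 := by
  have hfin : D.Finite := (box_finite a' v).subset hD
  rw [coeff_numerator_mul_inverse hv a hfin]
  refine Finset.sum_eq_zero fun l hl => finsum_mem_eq_zero_of_forall_eq_zero fun m hm => ?_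
  exact absurd hm.2.symm (hx l (hD (hfin.mem_toFinset.1 hl)) m)

/-! ### Adapted vectors -/

theorem add_mem_affineLattice_iff {a : Γ.LiftCoeffs} {l w : Γ.Node → ℤ}
    (hw : w ∈ affineLattice (zeroLift : Γ.LiftCoeffs)) :
    l + w ∈ affineLattice a ↔ l ∈ affineLattice a := by
  refine forall_congr' fun n => forall_congr' fun n' => forall_congr' fun h =>
    forall_congr' fun hlt => ?_
  have h0 : w n + Γ.omegaChain n' n * w n' ≡ 0 [ZMOD Γ.alphaChain n n'] := hw n n' h hlt
  have e : (l + w) n + Γ.omegaChain n' n * (l + w) n' =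
      l n + Γ.omegaChain n' n * l n' + (w n + Γ.omegaChain n' n * w n') := by
    simp only [Pi.add_apply]; ring
  rw [e]
  have h1 := h0.add_left (l n + Γ.omegaChain n' n * l n')
  rw [add_zero] at h1
  exact ⟨fun h2 => h1.symm.trans h2, fun h2 => h1.trans h2⟩

theorem sum_mem_affineLattice_zeroLift {v : Γ.Node → Γ.Node → ℤ}
    (hv : ∀ n, v n ∈ affineLattice (zeroLift : Γ.LiftCoeffs)) (m : Γ.Node → ℕ)
    (s : Finset Γ.Node) : ∑ n ∈ s, m n • v n ∈ affineLattice (zeroLift : Γ.LiftCoeffs) := by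
  have h0 : (0 : Γ.Node → ℤ) ∈ affineLattice (zeroLift : Γ.LiftCoeffs) := by
    intro n n' _ _
    simp [zeroLift]
  have hk : ∀ (n : Γ.Node) (k : ℕ), k • v n ∈ affineLattice (zeroLift : Γ.LiftCoeffs) := by
    intro n k
    induction k with
    | zero => simpa using h0
    | succ k ih => rw [succ_nsmul, add_mem_affineLattice_iff (hv n)]; exact ih
  induction s using Finset.induction_on with
  | empty => simpa using h0
  | insert n s hn ih => rw [Finset.sum_insert hn, add_mem_affineLattice_iff ih]; exact hk _ _

theorem mem_modSetBar_of_modSet {a : Γ.LiftCoeffs} {l : Γ.Node → ℤ} (h : l ∈ affineLattice a)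
    (h0 : ∀ n, 0 ≤ quasi a l n) : l ∈ modSetBar a :=
  ⟨h, fun n => add_nonneg (h0 n) (Finset.sum_nonneg fun _ _ => Int.fract_nonneg _)⟩

namespace IsAdapted

variable {a : Γ.LiftCoeffs} {κ : ℕ} {v : Γ.Node → Γ.Node → ℤ}

theorem realVec_mem_orbCone (h : IsAdapted a κ v) (n : Γ.Node) : realVec v n ∈ Γ.orbCone := by
  rw [← h.cone]
  refine ⟨Pi.single n 1, fun i => ?_, fun i => ?_⟩
  · by_cases hi : i = n
    · subst hi; simp
    · simp [hi]
  · simp [Pi.single_apply, realVec]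

/-- The cone generated by the `𝔳_n` is `𝒞^orb`, which spans the space: splitting `Λ(z)` into
positive and negative parts writes any `z` as a difference of two cone elements. There are as many
vectors as dimensions. -/
theorem linearIndependent (h : IsAdapted a κ v) : LinearIndependent ℝ (realVec v) := by
  refine linearIndependent_of_top_le_span_of_card_eq_finrank ?_ (by simp)
  have hcone : ∀ z ∈ Γ.orbCone, z ∈ Submodule.span ℝ (Set.range (realVec v)) := by
    intro z hz
    rw [← h.cone] at hz
    obtain ⟨s, -, hs⟩ := hz
    have : z = ∑ n, s n • realVec v n := by
      ext i; rw [hs i]; simp [realVec]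
    rw [this]
    exact Submodule.sum_mem _ fun n _ =>
      Submodule.smul_mem _ _ (Submodule.subset_span ⟨n, rfl⟩)
  intro z _
  have hz : z = Γ.proj (nodeVec fun n => max (Γ.orbForm z n) 0) -
      Γ.proj (nodeVec fun n => max (-Γ.orbForm z n) 0) := by
    apply orbForm_injective
    rw [map_sub, orbForm_nodeVec, orbForm_nodeVec]
    ext n
    rw [Pi.sub_apply]
    rcases le_total (Γ.orbForm z n) 0 with h0 | h0
    · rw [max_eq_right h0, max_eq_left (by linarith)]; ring
    · rw [max_eq_left h0, max_eq_right (by linarith)]; ring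
  rw [hz]
  refine Submodule.sub_mem _ (hcone _ ?_) (hcone _ ?_) <;>
  · rw [mem_orbCone, orbForm_nodeVec]
    exact fun n => le_max_right _ _

theorem realVec_pos (h : IsAdapted a κ v) (n : Γ.Node) : 0 < realVec v n :=
  lt_of_le_of_ne (fun i => nonneg_of_mem_orbCone (h.realVec_mem_orbCone n) i)
    (h.linearIndependent.ne_zero n).symm

end IsAdapted

section Adapted

variable [Nonempty Γ.Node]

theorem mem_modSetBar_iff (hord : ∀ n, ∀ n' ∈ Γ.nodesAt n, n < n' ∨ n' < n) {a : Γ.LiftCoeffs}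
    {l : Γ.Node → ℤ} : l ∈ modSetBar a ↔
      l ∈ affineLattice a ∧ (fun i => a.center i + (l i : ℝ)) ∈ Γ.orbCone := by
  rw [modSetBar, Set.mem_ofPred_eq, mem_orbCone]
  simp only [quasiBar_eq_orbForm hord]

namespace IsAdapted

variable {a : Γ.LiftCoeffs} {κ : ℕ} {v : Γ.Node → Γ.Node → ℤ}

theorem add_mem_modSetBar (hord : ∀ n, ∀ n' ∈ Γ.nodesAt n, n < n' ∨ n' < n)
    (h : IsAdapted a κ v) {l : Γ.Node → ℤ} (hl : l ∈ modSetBar a) (n : Γ.Node) :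
    l + v n ∈ modSetBar a := by
  rw [mem_modSetBar_iff hord] at hl ⊢
  refine ⟨(add_mem_affineLattice_iff (h.mem n).1).2 hl.1, ?_⟩
  have e : (fun i => a.center i + ((l + v n) i : ℝ)) =
      (fun i => a.center i + (l i : ℝ)) + realVec v n := by
    ext i; simp [realVec, add_assoc]
  have h1 := mem_orbCone.1 hl.2
  have h2 := mem_orbCone.1 (h.realVec_mem_orbCone n)
  rw [e, mem_orbCone, map_add]
  exact fun i => add_nonneg (h1 i) (h2 i)

/-- The vectors are added one at a time. Every partial sum stays in the normalization, where the
invariance in `IsAdapted` can be used again. -/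
theorem add_sum (hord : ∀ n, ∀ n' ∈ Γ.nodesAt n, n < n' ∨ n' < n)
    (h : IsAdapted a κ v) {l : Γ.Node → ℤ} (hl : l ∈ modSetBar a) (m : Γ.Node → ℕ)
    (s : Finset Γ.Node) : l + ∑ i ∈ s, m i • v i ∈ modSetBar a ∧
      ∀ n, (n ∈ s → m n = 0) → quasi a (l + ∑ i ∈ s, m i • v i) n = quasi a l n := by
  have hk : ∀ {l : Γ.Node → ℤ} (_ : l ∈ modSetBar a) (i : Γ.Node) (k : ℕ),
      l + k • v i ∈ modSetBar a ∧ ∀ n, (n = i → k = 0) →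
        quasi a (l + k • v i) n = quasi a l n := by
    intro l hl i k
    induction k with
    | zero => simpa using hl
    | succ k ih =>
      rw [succ_nsmul, ← add_assoc]
      refine ⟨h.add_mem_modSetBar hord ih.1 i, fun n hn => ?_⟩
      have hni : n ≠ i := fun e => by simpa using hn e
      rw [h.unchanged _ ih.1 i n hni]
      exact ih.2 n fun e => absurd e hni
  induction s using Finset.induction_on with
  | empty => simpa using hl
  | insert i s hi ih =>
    rw [Finset.sum_insert hi, add_comm (m i • v i), ← add_assoc]
    refine ⟨(hk ih.1 i (m i)).1, fun n hn => ?_⟩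
    rw [(hk ih.1 i (m i)).2 n fun e => e ▸ hn (e ▸ Finset.mem_insert_self _ _)]
    exact ih.2 n fun hns => hn (Finset.mem_insert_of_mem hns)

theorem quasi_add_sum_of_eq_zero (hord : ∀ n, ∀ n' ∈ Γ.nodesAt n, n < n' ∨ n' < n)
    (h : IsAdapted a κ v) {l : Γ.Node → ℤ} (hl : l ∈ modSetBar a) {m : Γ.Node → ℕ} {n : Γ.Node}
    (hn : m n = 0) : quasi a (l + ∑ i, m i • v i) n = quasi a l n :=
  (h.add_sum hord hl m Finset.univ).2 n fun _ => hn

theorem le_quasi_add_sum (hord : ∀ n, ∀ n' ∈ Γ.nodesAt n, n < n' ∨ n' < n)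
    (h : IsAdapted a κ v) {l : Γ.Node → ℤ} (hl : l ∈ modSetBar a) {m : Γ.Node → ℕ} {n : Γ.Node}
    (hn : m n ≠ 0) : (κ : ℝ) ≤ quasi a (l + ∑ i, m i • v i) n := by
  obtain ⟨k, hk⟩ := Nat.exists_eq_succ_of_ne_zero hn
  -- One copy of `v n` is added last, to a vector already in the normalization, so that `bound`
  -- applies.
  have e : l + ∑ i, m i • v i = l + ∑ i, (Function.update m n k) i • v i + v n := by
    rw [← Finset.add_sum_erase _ _ (Finset.mem_univ n),
      ← Finset.add_sum_erase _ (fun i => Function.update m n k i • v i) (Finset.mem_univ n),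
      Function.update_self, hk, succ_nsmul]
    have : ∑ i ∈ Finset.univ.erase n, Function.update m n k i • v i =
        ∑ i ∈ Finset.univ.erase n, m i • v i :=
      Finset.sum_congr rfl fun i hi => by rw [Function.update_of_ne (Finset.ne_of_mem_erase hi)]
    rw [this]
    abel
  rw [e]
  exact h.bound _ (h.add_sum hord hl _ _).1 n

theorem mem_modSetBar_of_mem_box (hord : ∀ n, ∀ n' ∈ Γ.nodesAt n, n < n' ∨ n' < n)
    (h : IsAdapted a κ v) {l : Γ.Node → ℤ} (hb : l ∈ box a v) (hl : l ∈ affineLattice a) :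
    l ∈ modSetBar a := by
  rw [mem_modSetBar_iff hord, ← h.cone]
  obtain ⟨s, hs, hls⟩ := hb
  exact ⟨hl, s, fun n => (hs n).1, fun i => by rw [← hls i, add_comm]⟩

theorem exists_decomposition (hord : ∀ n, ∀ n' ∈ Γ.nodesAt n, n < n' ∨ n' < n)
    (h : IsAdapted a κ v) {l : Γ.Node → ℤ} (hl : l ∈ modSetBar a) :
    ∃ l₀ ∈ box a v, ∃ m : Γ.Node → ℕ, l = l₀ + ∑ i, m i • v i := by
  rw [mem_modSetBar_iff hord, ← h.cone] at hl
  obtain ⟨-, s, hs, hls⟩ := hl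
  -- The multiplicities are the integer parts of the cone coordinates of `𝐜_a + ℓ`; the fractional
  -- parts describe the box element.
  refine ⟨l - ∑ i, ⌊s i⌋₊ • v i, ⟨fun n => s n - ⌊s n⌋₊, fun n => ?_, fun i => ?_⟩,
    fun n => ⌊s n⌋₊, by simp⟩
  · have h1 := Nat.floor_le (hs n)
    have h2 := Nat.lt_floor_add_one (s n)
    constructor <;> linarith
  · simp only [sub_mul, Finset.sum_sub_distrib, ← hls i]
    simp
    ring

end IsAdapted

end Adapted

end ResolutionGraph

/-! ### Inclusion-exclusion over sets of nodes -/

/-- With `S = T ∪ A` the sum runs over `T ⊆ Q`, and an alternating sum over a power set vanishes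
unless the set is empty. The choice `A = ∅` serves (a), `A = hatN` serves (b). -/
theorem sum_neg_one_pow_card_sdiff {ι : Type*} [Fintype ι] [DecidableEq ι] {A Q : Finset ι}
    (h : Disjoint Q A) :
    ∑ S ∈ Finset.univ.filter (fun S : Finset ι => A ⊆ S),
      (-1 : ℤ) ^ (S \ A).card * (if S \ A ⊆ Q then 1 else 0) = if Q = ∅ then 1 else 0 := by
  rw [← Finset.sum_powerset_neg_one_pow_card]
  simp only [mul_ite, mul_one, mul_zero]
  rw [← Finset.sum_filter]
  refine Finset.sum_nbij' (fun S => S \ A) (fun T => T ∪ A) ?_ ?_ ?_ ?_ fun _ _ => rfl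
  · intro S hS
    simpa using (Finset.mem_filter.1 hS).2
  · intro T hT
    have hd : Disjoint T A := h.mono_left (Finset.mem_powerset.1 hT)
    refine Finset.mem_filter.2
      ⟨Finset.mem_filter.2 ⟨Finset.mem_univ _, Finset.subset_union_right⟩, ?_⟩
    rw [Finset.union_sdiff_cancel_right hd]
    exact Finset.mem_powerset.1 hT
  · intro S hS
    simp only [Finset.mem_filter, Finset.mem_univ, true_and] at hS
    exact Finset.sdiff_union_of_subset hS.1
  · intro T hT
    exact Finset.union_sdiff_cancel_right (h.mono_left (Finset.mem_powerset.1 hT))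

theorem HahnSeries.coeff_neg_one_pow_mul {G : Type*} [AddCommMonoid G] [PartialOrder G]
    [IsOrderedCancelAddMonoid G] (c : ℕ) (F : HahnSeries G ℤ) (x : G) :
    ((-1) ^ c * F).coeff x = (-1) ^ c * F.coeff x := by
  rcases Nat.even_or_odd c with h | h <;> simp [h.neg_one_pow]

/-! ### Holes and the two representations -/

namespace ResolutionGraph

variable {V : Type*} [Fintype V] {Γ : ResolutionGraph V}

theorem zero_mem_levels (r : ℕ) : (0 : Γ.Node → ℕ) ∈ Γ.levels r := by
  rw [levels, Fintype.mem_piFinset]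
  intro n
  split_ifs <;> simp

theorem eq_zero_of_mem_levels {r : ℕ} {k : Γ.Node → ℕ} (hk : k ∈ Γ.levels r) {n : Γ.Node}
    (hn : n ∉ Γ.hatN) : k n = 0 := by
  rw [levels, Fintype.mem_piFinset] at hk
  simpa [hn] using hk n

variable [PartialOrder Γ.Node]

theorem IsAdapted.isUnit_denominator {a : Γ.LiftCoeffs} {κ : ℕ} {v : Γ.Node → Γ.Node → ℤ}
    (h : IsAdapted a κ v) (S : Finset Γ.Node) : IsUnit (Γ.denominator v S) :=
  ResolutionGraph.isUnit_denominator h.realVec_pos S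

/-- The exponent `𝐜_a + ℓ`. -/
def exponent (a : Γ.LiftCoeffs) (l : Γ.Node → ℤ) : Γ.Node → ℝ := fun i => a.center i + l i

theorem exponent_injective (a : Γ.LiftCoeffs) : Function.Injective (exponent a) := by
  intro l l' h
  ext i
  have := congrFun h i
  simpa [exponent] using this

theorem exponent_add_sum (a : Γ.LiftCoeffs) (v : Γ.Node → Γ.Node → ℤ) (l : Γ.Node → ℤ)
    (m : Γ.Node → ℕ) : exponent a (l + ∑ n, m n • v n) =
      (fun i => a.center i + (l i : ℝ)) + latticePoint (realVec v) m := by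
  ext i
  rw [Pi.add_apply, latticePoint_realVec, exponent, Pi.add_apply]
  push_cast
  ring

theorem exists_eq_exponent_iff {a : Γ.LiftCoeffs} {P : (Γ.Node → ℤ) → Prop} {l : Γ.Node → ℤ} :
    (∃ l', P l' ∧ exponent a l = exponent a l') ↔ P l :=
  ⟨fun ⟨_, h, e⟩ => exponent_injective a e ▸ h, fun h => ⟨l, h, rfl⟩⟩

section Representations

variable [Nonempty Γ.Node]

/-- The rational function attached to the holes of `ℳ_{a'}` is the generating series of
`ℳ_{a'}`. -/
theorem IsAdapted.coeff_sum_holes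
    (hord : ∀ n, ∀ n' ∈ Γ.nodesAt n, n < n' ∨ n' < n) {a' : Γ.LiftCoeffs} {κ : ℕ} {v : Γ.Node → Γ.Node → ℤ}
    (h : IsAdapted a' κ v) (a : Γ.LiftCoeffs) (x : Γ.Node → ℝ) :
    (∑ S : Finset Γ.Node, (-1) ^ S.card *
      (numerator a (holes a' v S) * Ring.inverse (Γ.denominator v S))).coeff x =
      if ∃ l, l ∈ modSet a' ∧ x = exponent a l then 1 else 0 := by
  have hsub : ∀ S, holes a' v S ⊆ box a' v := fun S l hl => hl.1
  simp only [HahnSeries.coeff_sum, HahnSeries.coeff_neg_one_pow_mul]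
  by_cases hx : ∃ l ∈ box a' v, ∃ m : Γ.Node → ℕ, x = exponent a (l + ∑ i, m i • v i)
  · obtain ⟨l, hl, m, rfl⟩ := hx
    simp only [exists_eq_exponent_iff]
    simp only [exponent_add_sum,
      coeff_numerator_mul_inverse_eq_ite h.realVec_pos h.linearIndependent a a' (hsub _) _ hl]
    by_cases haff : l ∈ affineLattice a'
    · have hbar := h.mem_modSetBar_of_mem_box hord hl haff
      -- `Q` is the set of nodes where the inequality fails after adding `∑ m_i 𝔳_i`: the value is
      -- negative at the box element and no copy of `𝔳_n` has been added.
      set Q := Finset.univ.filter fun n => quasi a' l n < 0 ∧ m n = 0 with hQ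
      have e : ∀ S : Finset Γ.Node, (l ∈ holes a' v S ∧ ∀ n ∈ S, m n = 0) ↔ S \ ∅ ⊆ Q := by
        intro S
        rw [Finset.sdiff_empty]
        constructor
        · exact fun h' n hn => Finset.mem_filter.2 ⟨Finset.mem_univ n, h'.1.2.2 n hn, h'.2 n hn⟩
        · intro h'
          exact ⟨⟨hl, haff, fun n hn => (Finset.mem_filter.1 (h' hn)).2.1⟩,
            fun n hn => (Finset.mem_filter.1 (h' hn)).2.2⟩
      have e2 := sum_neg_one_pow_card_sdiff (Finset.disjoint_empty_right Q)
      simp only [Finset.empty_subset, Finset.filter_true] at e2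
      simp only [e]
      refine Eq.trans ?_ (e2.trans (if_congr ?_ rfl rfl))
      · exact Finset.sum_congr rfl fun S _ => by simp only [Finset.sdiff_empty]
      · rw [Finset.eq_empty_iff_forall_notMem]
        constructor
        · refine fun h0 => ⟨(h.add_sum hord hbar m Finset.univ).1.1, fun n => ?_⟩
          by_cases hm : m n = 0
          · rw [h.quasi_add_sum_of_eq_zero hord hbar hm]
            by_contra hneg
            exact h0 n (Finset.mem_filter.2 ⟨Finset.mem_univ n, not_le.1 hneg, hm⟩)
          · exact (Nat.cast_nonneg κ).trans (h.le_quasi_add_sum hord hbar hm)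
        · rintro h0 n hn
          obtain ⟨-, h1, h2⟩ := Finset.mem_filter.1 hn
          have := h0.2 n
          rw [h.quasi_add_sum_of_eq_zero hord hbar h2] at this
          linarith
    · rw [if_neg, Finset.sum_eq_zero]
      · intro S _
        rw [if_neg fun h' => haff h'.1.2.1, mul_zero]
      · exact fun h' => haff ((add_mem_affineLattice_iff
          (sum_mem_affineLattice_zeroLift (fun n => (h.mem n).1) m Finset.univ)).1 h'.1)
  · rw [if_neg, Finset.sum_eq_zero]
    · intro S _
      rw [coeff_numerator_mul_inverse_eq_zero h.realVec_pos a a' (hsub S), mul_zero]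
      intro l hl m e
      exact hx ⟨l, hl, m, by rw [e, exponent_add_sum]⟩
    · rintro ⟨l, hl, rfl⟩
      obtain ⟨l₀, hl₀, m, rfl⟩ := h.exists_decomposition hord (mem_modSetBar_of_modSet hl.1 hl.2)
      exact hx ⟨l₀, hl₀, m, rfl⟩

/-- The rational function attached to the graded holes is the generating series of the elements
where the quasilinear functions take the values `k_n`, for `n` in `hatN`. -/
theorem IsAdapted.coeff_sum_gradedHoles
    (hord : ∀ n, ∀ n' ∈ Γ.nodesAt n, n < n' ∨ n' < n) {a : Γ.LiftCoeffs} {k : Γ.Node → ℕ}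
    {v : Γ.Node → Γ.Node → ℤ} (h : IsAdapted (a.shift k) 1 v) (hk : ∀ n ∉ Γ.hatN, k n = 0)
    (x : Γ.Node → ℝ) :
    (∑ S ∈ Finset.univ.filter (fun S : Finset Γ.Node => Γ.hatN ⊆ S), (-1) ^ (S \ Γ.hatN).card *
      (numerator a (gradedHoles a k v S) * Ring.inverse (Γ.denominator v S))).coeff x =
      if ∃ l, (l ∈ affineLattice a ∧
        ∀ n, if n ∈ Γ.hatN then quasi a l n = k n else 0 ≤ quasi a l n) ∧ x = exponent a l
      then 1 else 0 := by
  have hsub : ∀ S, gradedHoles a k v S ⊆ box (a.shift k) v := fun S l hl => hl.1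
  have hq : ∀ (l : Γ.Node → ℤ) (n), n ∉ Γ.hatN → quasi (a.shift k) l n = quasi a l n := by
    intro l n hn
    rw [quasi_shift, hk n hn, Nat.cast_zero, sub_zero]
  simp only [HahnSeries.coeff_sum, HahnSeries.coeff_neg_one_pow_mul]
  by_cases hx : ∃ l ∈ box (a.shift k) v, ∃ m : Γ.Node → ℕ, x = exponent a (l + ∑ i, m i • v i)
  · obtain ⟨l, hl, m, rfl⟩ := hx
    simp only [exists_eq_exponent_iff]
    simp only [exponent_add_sum, coeff_numerator_mul_inverse_eq_ite h.realVec_pos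
      h.linearIndependent a (a.shift k) (hsub _) _ hl]
    -- Every `S` in the sum contains `hatN`, so this condition on the nodes of `hatN` is necessary
    -- for any term to be nonzero, whatever `S` is.
    by_cases hC : l ∈ affineLattice a ∧ ∀ n ∈ Γ.hatN, quasi a l n = k n ∧ m n = 0
    · obtain ⟨haff, hC⟩ := hC
      have hbar := h.mem_modSetBar_of_mem_box hord hl haff
      have hadd : ∀ n, m n = 0 → quasi a (l + ∑ i, m i • v i) n = quasi a l n := by
        intro n hm
        have := h.quasi_add_sum_of_eq_zero hord hbar hm
        rwa [quasi_shift, quasi_shift, sub_left_inj] at this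
      set Q := Finset.univ.filter fun n => n ∉ Γ.hatN ∧ quasi a l n < 0 ∧ m n = 0 with hQ
      have hdisj : Disjoint Q Γ.hatN :=
        Finset.disjoint_left.2 fun n hn => (Finset.mem_filter.1 hn).2.1
      have e : ∀ S : Finset Γ.Node,
          (l ∈ gradedHoles a k v S ∧ ∀ n ∈ S, m n = 0) ↔ S \ Γ.hatN ⊆ Q := by
        intro S
        constructor
        · intro h' n hn
          have hn2 := Finset.mem_sdiff.1 hn
          exact Finset.mem_filter.2
            ⟨Finset.mem_univ n, hn2.2, h'.1.2.2.1 n hn, h'.2 n hn2.1⟩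
        · intro h'
          refine ⟨⟨hl, haff, fun n hn => (Finset.mem_filter.1 (h' hn)).2.2.1,
            fun n hn => (hC n hn).1⟩, fun n hn => ?_⟩
          by_cases hn2 : n ∈ Γ.hatN
          · exact (hC n hn2).2
          · exact (Finset.mem_filter.1 (h' (Finset.mem_sdiff.2 ⟨hn, hn2⟩))).2.2.2
      simp only [e]
      refine (sum_neg_one_pow_card_sdiff hdisj).trans (if_congr ?_ rfl rfl)
      rw [Finset.eq_empty_iff_forall_notMem]
      constructor
      · refine fun h0 => ⟨(h.add_sum hord hbar m Finset.univ).1.1, fun n => ?_⟩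
        split_ifs with hn
        · rw [hadd n (hC n hn).2]
          exact (hC n hn).1
        · by_cases hm : m n = 0
          · rw [hadd n hm]
            by_contra hneg
            exact h0 n (Finset.mem_filter.2 ⟨Finset.mem_univ n, hn, not_le.1 hneg, hm⟩)
          · rw [← hq _ n hn]
            exact (Nat.cast_nonneg 1).trans (h.le_quasi_add_sum hord hbar hm)
      · rintro h0 n hn
        obtain ⟨-, h1, h2, h3⟩ := Finset.mem_filter.1 hn
        have := h0.2 n
        rw [if_neg h1, hadd n h3] at this
        linarith
    · rw [if_neg, Finset.sum_eq_zero]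
      · intro S hS
        rw [if_neg, mul_zero]
        exact fun h' => hC ⟨h'.1.2.1, fun n hn =>
          ⟨h'.1.2.2.2 n hn, h'.2 n ((Finset.mem_filter.1 hS).2 hn)⟩⟩
      · intro h'
        have haff : l ∈ affineLattice a := (add_mem_affineLattice_iff
          (sum_mem_affineLattice_zeroLift (fun n => (h.mem n).1) m Finset.univ)).1 h'.1
        have hbar := h.mem_modSetBar_of_mem_box hord hl haff
        refine hC ⟨haff, fun n hn => ?_⟩
        have h1 := h'.2 n
        rw [if_pos hn] at h1
        -- Here `κ = 1` is needed: a copy of `𝔳_n` would give `N_{a-k}(·, n) ≥ 1`, that is, `N_a(·,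
        -- n) > k_n`.
        have hm : m n = 0 := by
          by_contra hm
          have := h.le_quasi_add_sum hord hbar hm
          rw [quasi_shift, h1, sub_self, Nat.cast_one] at this
          linarith
        have h2 := h.quasi_add_sum_of_eq_zero hord hbar hm
        rw [quasi_shift, quasi_shift, sub_left_inj] at h2
        exact ⟨h2 ▸ h1, hm⟩
  · rw [if_neg, Finset.sum_eq_zero]
    · intro S _
      rw [coeff_numerator_mul_inverse_eq_zero h.realVec_pos a (a.shift k) (hsub S), mul_zero]
      intro l hl m e
      exact hx ⟨l, hl, m, by rw [e, exponent_add_sum]⟩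
    · rintro ⟨l, ⟨hl, hl2⟩, rfl⟩
      have hmem : l ∈ modSetBar (a.shift k) := by
        refine mem_modSetBar_of_modSet hl fun n => ?_
        have := hl2 n
        split_ifs at this with hn
        · rw [quasi_shift, this, sub_self]
        · rwa [hq l n hn]
      obtain ⟨l₀, hl₀, m, rfl⟩ := h.exists_decomposition hord hmem
      exact hx ⟨l₀, hl₀, m, rfl⟩

/-- Interface for both representations: exponents outside `𝐜_a + ℤ^𝒩(a)` have coefficient 0, and on
the others the product formula is replaced by any expansion `hP` into tests. -/
theorem reducedCoeff_eq (hord : ∀ n, ∀ n' ∈ Γ.nodesAt n, n < n' ∨ n' < n)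
    (a : Γ.LiftCoeffs) (x : Γ.Node → ℝ) {s : Finset (Γ.Node → ℕ)}
    {c : (Γ.Node → ℕ) → ℤ} {P : (Γ.Node → ℕ) → (Γ.Node → ℤ) → Prop}
    [∀ k N, Decidable (P k N)] (hP : ∀ N : Γ.Node → ℤ, ∏ n, coeffZ (Γ.nodeSeries n) (N n) =
      ∑ k ∈ s, c k * if P k N then 1 else 0) :
    Γ.reducedCoeff (Γ.cls a.toDual) x = ∑ k ∈ s, c k *
      if ∃ l, (l ∈ affineLattice a ∧ P k fun n => ⌊quasi a l n⌋) ∧ x = exponent a l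
      then 1 else 0 := by
  have hred := hasReduction_poincareH (Γ := Γ) hord
  change reduction Γ.poincareH _ x = _
  by_cases hx : ∃ l ∈ affineLattice a, x = exponent a l
  · obtain ⟨l, hl, rfl⟩ := hx
    simp only [exists_eq_exponent_iff, hl, true_and]
    exact (hred.eq_prod a l hl).trans (hP _)
  · rw [hred.eq_zero a x hx, Finset.sum_eq_zero]
    intro k _
    rw [if_neg, mul_zero]
    rintro ⟨l, ⟨hl, -⟩, e⟩
    exact hx ⟨l, hl, e⟩

end Representations

end ResolutionGraph

end

theorem theorem5p1 {V : Type*} [Fintype V] (Γ : ResolutionGraph V) [PartialOrder Γ.Node]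
    (hord : ∀ n, ∀ n' ∈ Γ.nodesAt n, n < n' ∨ n' < n)
    (hne : Nonempty Γ.Node) (hdelta : ∀ n, 1 ≤ Γ.deltaN n)
    (h : Γ.H) (a : Γ.LiftCoeffs) (ha : a.IsLiftOf h) :
    -- the series `Z_H(t)` and its reduction `Z_h(t_𝒩)` are well defined
    ((∀ v, IsUnit (Γ.zetaFactor v)) ∧
      ∀ x : Γ.Node → ℝ, {l : V → ℝ | Γ.proj l = x ∧ Γ.poincareCoeff h l ≠ 0}.Finite) ∧
    -- first representation
    (∀ v : Γ.Node → Γ.Node → ℤ,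
      (∀ k ∈ Γ.levels 1, ResolutionGraph.IsAdapted (a.shift k) 0 v) →
      (∀ S, IsUnit (Γ.denominator v S)) ∧
      ∀ x : Γ.Node → ℝ, Γ.reducedCoeff h x =
        (∑ k ∈ Γ.levels 1, Γ.signedBinom 1 k •
          ∑ S : Finset Γ.Node, (-1) ^ S.card *
            (ResolutionGraph.numerator a (ResolutionGraph.holes (a.shift k) v S) *
              Ring.inverse (Γ.denominator v S))).coeff x) ∧
    -- second representation
    (∀ v : Γ.Node → Γ.Node → ℤ,
      (∀ k ∈ Γ.levels 2, ResolutionGraph.IsAdapted (a.shift k) 1 v) →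
      (∀ S, IsUnit (Γ.denominator v S)) ∧
      ∀ x : Γ.Node → ℝ, Γ.reducedCoeff h x =
        (∑ k ∈ Γ.levels 2, Γ.signedBinom 2 k •
          ∑ S ∈ Finset.univ.filter (fun S : Finset Γ.Node => Γ.hatN ⊆ S),
            (-1) ^ (S \ Γ.hatN).card *
            (ResolutionGraph.numerator a (ResolutionGraph.gradedHoles a k v S) *
              Ring.inverse (Γ.denominator v S))).coeff x) := by
  have := hne
  subst ha
  have hred := ResolutionGraph.hasReduction_poincareH (Γ := Γ) hord
  refine ⟨⟨Γ.isUnit_zetaFactor, fun x => (hred.reducible x).subset ?_⟩, fun v hv => ?_,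
    fun v hv => ?_⟩
  · rintro l ⟨hl, h0⟩
    refine ⟨hl, fun h1 => h0 ?_⟩
    rw [ResolutionGraph.poincareCoeff, h1]
    rfl
  -- The level `k = 0` always occurs, so at least one adaptedness hypothesis is available to make
  -- the denominators invertible.
  · refine ⟨(hv 0 (ResolutionGraph.zero_mem_levels 1)).isUnit_denominator, fun x => ?_⟩
    rw [ResolutionGraph.reducedCoeff_eq hord a x (P := fun k N => ∀ n, 0 ≤ N n - k n)
      (ResolutionGraph.prod_nodeSeries_eq_sum_levels_one hdelta), HahnSeries.coeff_sum]
    refine Finset.sum_congr rfl fun k hk => ?_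
    rw [HahnSeries.coeff_smul, (hv k hk).coeff_sum_holes hord a x, smul_eq_mul]
    congr 1
    refine if_congr (exists_congr fun l => and_congr_left fun _ => ?_) rfl rfl
    refine and_congr_right fun hl => forall_congr' fun n => ?_
    -- On `ℤ^𝒩(a)` the values of `N_a` are integers, so tests on their floors are tests on `N_a`
    -- itself.
    rw [ResolutionGraph.quasi_shift, ResolutionGraph.quasi_eq_floor hord hl n]
    exact_mod_cast Iff.rfl
  · refine ⟨(hv 0 (ResolutionGraph.zero_mem_levels 2)).isUnit_denominator, fun x => ?_⟩
    rw [ResolutionGraph.reducedCoeff_eq hord a x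
      (P := fun k N => ∀ n, if n ∈ Γ.hatN then N n = k n else 0 ≤ N n)
      (ResolutionGraph.prod_nodeSeries_eq_sum_levels_two hdelta), HahnSeries.coeff_sum]
    refine Finset.sum_congr rfl fun k hk => ?_
    rw [HahnSeries.coeff_smul, (hv k hk).coeff_sum_gradedHoles hord
      (fun n hn => ResolutionGraph.eq_zero_of_mem_levels hk hn) x, smul_eq_mul]
    congr 1
    refine if_congr (exists_congr fun l => and_congr_left fun _ => ?_) rfl rfl
    refine and_congr_right fun hl => forall_congr' fun n => ?_
    rw [ResolutionGraph.quasi_eq_floor hord hl n]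
    split_ifs <;> exact_mod_cast Iff.rfl
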